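/- **Setting.** Finitary type theories: there are four syntactic classes $\mathsf{Ty},\mathsf{Tm},\mathsf{EqTy},\mathsf{EqTm}$, the first two being the object classes. A signature assigns to each symbol $\mathsf S$ an arity $(c,[(c_1,n_1),\dots,(c_k,n_k)])$, with $c$ an object class; its $i$-th argument has class $c_i$ and binds $n_i$ variables. Expressions are built from variables, symbols applied to arguments, and object metavariables of arity $(c,n)$ applied to $n$ terms; arguments are expressions, dummies $\star$ (class $\mathsf{EqTy}$ or $\mathsf{EqTm}$) and abstractions $\{x\}e$. Judgement theses are $A\ \mathsf{type}$, $t:A$, $A\equiv B$, $s\equiv t:A$; boundary theses are $\Box\ \mathsf{type}$, $\Box:A$ (object boundaries), $A\equiv B\ \mathsf{by}\ \Box$, $s\equiv t:A\ \mathsf{by}\ \Box$ (equality boundaries); both may be abstracted, $\{x:A\}\,\cdots$. $\mathcal B[e]$ is the judgement that fills $\Box$ with $e$, and for an object boundary $\mathcal B[e\equiv e']$ is the corresponding equality judgement and $\mathcal B[e\equiv e'\ \mathsf{by}\ \Box]$ the corresponding equality boundary. A metavariable context $\Theta=[\mathsf M_1:\mathcal B_1,\dots,\mathsf M_n:\mathcal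 B_n]$ lists closed boundaries, a variable context $\Gamma$ lists types of variables; an instantiation $I=\langle \mathsf M_i\mapsto e_i\rangle$ of $\Xi$ over $\Theta;\Gamma$ assigns to each metavariable of $\Xi$ an argument over $\Theta;\Gamma$ of its arity and acts on syntax over $\Xi$, $I_*(\mathsf M(\vec t))=e[I_*\vec t/\vec x]$ if $I(\mathsf M)=\{\vec x\}e$. A raw rule is $\Xi\Longrightarrow\mathcal B[e]$ with $\mathcal B$ a boundary thesis over $\Xi$ and no variables. A raw type theory is a family of raw rules (its specific rules); its derivable judgements $\Theta;\Gamma\vdash\mathcal J$ and boundaries $\Theta;\Gamma\vdash\mathcal B$ are generated by the variable, metavariable, metavariable congruence and abstraction rules, reflexivity, symmetry, transitivity and conversion, the rules for well-formed boundaries, the instances of the specific rules (premises: $\Theta;\Gamma\vdash (I_*\mathcal B_i)[I(\mathsf M_i)]$ for all $i$, and $\Theta;\Gamma\vdash I_*\mathcal B$), and the congruence rules of the specific object rules. $\vdash\Theta\ \mathsf{mctx}$ and $\Theta\vdash\Gamma\ \mathsf{vctx}$ mean that each entry is a derivable boundary, respectively a derivable type, over the entries before it. The instantiation $I$ is derivable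 if $\Theta;\Gamma\vdash (I_*\mathcal B_i)[I(\mathsf M_i)]$ for all $i$. The generic application $\widehat{\mathsf M}$ is $\{\vec x\}\mathsf M(\vec x)$, or $\{\vec x\}\star$ if $\mathsf M$ is an equality metavariable. The theory is *standard* if every specific rule $\Xi\Longrightarrow\mathcal B[e]$ is finitary ($\vdash\Xi\ \mathsf{mctx}$ and $\Xi;\cdot\vdash\mathcal B$), every specific object rule is a symbol rule $\mathsf M_1:\mathcal B_1,\dots,\mathsf M_n:\mathcal B_n\Longrightarrow\mathcal B[\mathsf S(\widehat{\mathsf M}_1,\dots,\widehat{\mathsf M}_n)]$, and each symbol has exactly one rule. If that rule has conclusion boundary $\Box:B$, the natural type of $\mathsf S(\vec e)$ is $\langle\mathsf M_i\mapsto e_i\rangle_*B$. **Rules of the algorithm.** A rule $\Xi\Longrightarrow\mathcal J$ is *deterministic* if for each judgement $\mathcal J'$ over any $\Theta;\Gamma$ at most one instantiation $I$ of $\Xi$ has $I_*\mathcal J=\mathcal J'$. A derivable rule $\Xi\Longrightarrow\mathcal J$ is *object-invertible* if, whenever $\vdash\Theta\ \mathsf{mctx}$, $|\Xi|\cap|\Theta|=\emptyset$,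 $I$ instantiates $\Xi$ over $\Theta;\cdot$ and $\Theta;\cdot\vdash I_*\mathcal J$, the instantiation that agrees with $I$ on object metavariables and is $\widehat{\mathsf M}$ on equality metavariables is derivable over $\Theta$ extended by the entries $\mathsf M:I_*\mathcal B$ for the equality entries $\mathsf M:\mathcal B$ of $\Xi$. A *type computation rule* is a derivable finitary rule $\Xi\Longrightarrow A\equiv B$ with $\Xi\Longrightarrow A\ \mathsf{type}$ deterministic and object-invertible. A *term computation rule* is a derivable finitary rule $\Xi\Longrightarrow u\equiv v:A$ with $u$ a symbol application and $\Xi\Longrightarrow u:C$ deterministic and object-invertible, $C$ being the natural type of $u$. An *extensionality rule* is a derivable finitary rule $\Xi,\mathsf s:(\Box:P),\mathsf t:(\Box:P),\Phi\Longrightarrow\mathsf s\equiv\mathsf t:P$ with $\Phi$ consisting of equality premises and $\Xi\Longrightarrow P\ \mathsf{type}$ deterministic and object-invertible. **The algorithm.** Fix families $\mathcal C$ of computation rules and $\mathcal E$ of extensionality rules and, for every symbol and every metavariable, a set $\wp$ of principal argument positions. The following relations are defined by mutual induction. In the clauses about symbols below, $I=\langle \mathsf M_i\mapsto e_i\rangle$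 where the rule for $\mathsf S$ has premises $\mathsf M_i:\mathcal B_i$; object metavariables of $\Theta$ applied to terms are treated in the same way, as symbols whose arguments are these terms (at their types). "Check the equality entries of $\Xi$ under $I$" means: $\Theta;\Gamma\vdash (I_*\mathcal B)[I_*e\sim I_*e']$ for every $(\mathsf M:\mathcal B[e\equiv e'\ \mathsf{by}\ \Box])\in\Xi$. * $\mathcal B[s\rightsquigarrow_c I_*v]$ if $(\Xi\Longrightarrow\mathcal B'[p\equiv v])\in\mathcal C$, $I_*p=s$, and the equality entries of $\Xi$ check under $I$. * $\mathcal B[\mathsf S(\vec e)\rightsquigarrow_p\mathsf S(\vec e')]$ if $(I_*\mathcal B_i)[e_i\rightsquigarrow e_i']$ for $i\in\wp(\mathsf S)$ and $e_i=e'_i$ for $i\notin\wp(\mathsf S)$. * $\mathcal B[e\rightsquigarrow e''']$ if $\mathcal B[e\rightsquigarrow_p e']$, $\mathcal B[e'\rightsquigarrow_c e'']$, $\mathcal B[e''\rightsquigarrow e''']$; $\mathcal B[e\rightsquigarrow e']$ if $\mathcal B[e\rightsquigarrow_p e']$ and no left-hand side of a rule of $\mathcal C$ matches $e'$; variables and dummies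 normalize to themselves; abstractions are normalized by normalizing their bodies in the extended context. * General comparison: $u\sim v:A$ if $A\rightsquigarrow A'$ and $u\sim_{\mathrm e}v:A'$; $A\sim B$ for types if $A\rightsquigarrow A'$, $B\rightsquigarrow B'$ and $A'\sim_{\mathrm n}B'$; abstractions are compared by comparing their bodies in the extended context. * Type-directed comparison: $u\sim_{\mathrm e}v:A$ if $\mathcal E$ has a rule as above with $I_*P=A$ for an instantiation $I$ of $\Xi$, and the equality entries of $\Xi$ check under $I$ and those of $\Phi$ under $\langle I,\mathsf s\mapsto u,\mathsf t\mapsto v\rangle$; or if $A$ matches the type $P$ of no rule of $\mathcal E$, and $u\rightsquigarrow u':A$, $v\rightsquigarrow v':A$, $u'\sim_{\mathrm n}v':A$. * Comparison of normalized expressions: $x\sim_{\mathrm n}x:A$ for variables $x$; $\mathcal B[\mathsf S(\vec e)\sim_{\mathrm n}\mathsf S(\vec e')]$ if for every $i$ for which $\mathcal B_i$ is an object boundary, $(I_*\mathcal B_i)[e_i\sim_{\mathrm n}e'_i]$ when $i\in\wp(\mathsf S)$ and $(I_*\mathcal B_i)[e_i\sim e'_i]$ when $i\notin\wp(\mathsf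 S)$; abstractions are compared by comparing their bodies in the extended context. **Theorem (Soundness of equality checking).** Let a standard type theory, families $\mathcal C$ and $\mathcal E$ of computation and extensionality rules for it, and a choice $\wp$ of principal arguments be given, and let $\vdash\Theta\ \mathsf{mctx}$ and $\Theta\vdash\Gamma\ \mathsf{vctx}$. Then: 1. for every (possibly abstracted) object boundary $\mathcal B$: if $\Theta;\Gamma\vdash\mathcal B[e]$, $\Theta;\Gamma\vdash\mathcal B[e']$ and $\Theta;\Gamma\vdash\mathcal B[e\sim e']$, then $\Theta;\Gamma\vdash\mathcal B[e\equiv e']$; 2. if $\Theta;\Gamma\vdash u:A$, $\Theta;\Gamma\vdash v:A$ and $\Theta;\Gamma\vdash u\sim_{\mathrm e}v:A$, then $\Theta;\Gamma\vdash u\equiv v:A$; 3. if $\Theta;\Gamma\vdash A\ \mathsf{type}$, $\Theta;\Gamma\vdash B\ \mathsf{type}$ and $\Theta;\Gamma\vdash A\sim_{\mathrm n}B$, then $\Theta;\Gamma\vdash A\equiv B$; 4. if $\Theta;\Gamma\vdash u:A$, $\Theta;\Gamma\vdash v:A$ and $\Theta;\Gamma\vdash u\sim_{\mathrm n}v:A$,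 then $\Theta;\Gamma\vdash u\equiv v:A$. -/

import Mathlib

universe u v

namespace FTT



/-! ### Syntactic classes, signatures, expressions -/

/-- The four syntactic classes: types, terms, type equalities, term equalities. -/
inductive Cls where
  | ty | tm | eqTy | eqTm

/-- The object classes are `ty` and `tm`; the other two are the equality classes. -/
def Cls.isObj : Cls → Bool
  | .ty => true
  | .tm => true
  | .eqTy => false
  | .eqTm => false

/-- The equality class that belongs to an object class (no meaning on the equality classes). -/
def Cls.eqOf : Cls → Cls
  | .ty => .eqTy
  | .tm => .eqTm
  | .eqTy => .eqTy
  | .eqTm => .eqTm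

/-- A signature: the symbol `s` has arity
`(cls s, [(argCls s 0, argBinds s 0), …, (argCls s (k-1), argBinds s (k-1))])`, `k = nargs s`. -/
structure Signature where
  Sym : Type u
  cls : Sym → Cls
  cls_obj : ∀ s, (cls s).isObj = true
  nargs : Sym → ℕ
  argCls : (s : Sym) → Fin (nargs s) → Cls
  argBinds : (s : Sym) → Fin (nargs s) → ℕ

/-- Metavariables of arity `(c, k)`: a countable supply of names for every arity. -/
structure MVar (c : Cls) (k : ℕ) where
  name : ℕ

/-- A metavariable of some arity. -/
abbrev AnyMVar : Type := Σ c : Cls, Σ k : ℕ, MVar c k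

/-- `Arg S c k n`: arguments of metavariable arity `(c, k)` (that is, of class `c` under `k`
abstractions) in `n` variables. Variables (free ones as well as bound ones) are de Bruijn
indices, `0` is the variable that was introduced last. Type expressions are `Arg S .ty 0 n`, term
expressions are `Arg S .tm 0 n`. -/
inductive Arg (S : Signature.{u}) : Cls → ℕ → ℕ → Type u where
  | var {n : ℕ} (x : Fin n) : Arg S .tm 0 n
  | sym {n : ℕ} {c : Cls} (s : S.Sym) (hs : S.cls s = c)
      (args : (i : Fin (S.nargs s)) → Arg S (S.argCls s i) (S.argBinds s i) n) : Arg S c 0 n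
  | mvar {n : ℕ} {c : Cls} {k : ℕ} (hc : c.isObj = true) (M : MVar c k)
      (ts : Fin k → Arg S .tm 0 n) : Arg S c 0 n
  | dummyTy {n : ℕ} : Arg S .eqTy 0 n
  | dummyTm {n : ℕ} : Arg S .eqTm 0 n
  | abs {n : ℕ} {c : Cls} {k : ℕ} (e : Arg S c k (n + 1)) : Arg S c (k + 1) n

/-- Type expressions in `n` variables. -/
abbrev Ty (S : Signature.{u}) (n : ℕ) : Type u := Arg S .ty 0 n
/-- Term expressions in `n` variables. -/
abbrev Tm (S : Signature.{u}) (n : ℕ) : Type u := Arg S .tm 0 n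

variable {S : Signature.{u}}

/-- The extension of a renaming under one binder. -/
def liftRen {l n : ℕ} (ρ : Fin l → Fin n) : Fin (l + 1) → Fin (n + 1) :=
  Fin.cases 0 (fun i => (ρ i).succ)

/-- Renaming of variables. -/
def Arg.ren : {c : Cls} → {k l : ℕ} → Arg S c k l → {n : ℕ} → (Fin l → Fin n) → Arg S c k n
  | _, _, _, .var x, _, ρ => .var (ρ x)
  | _, _, _, .sym s hs args, _, ρ => .sym s hs (fun i => (args i).ren ρ)
  | _, _, _, .mvar hc M ts, _, ρ => .mvar hc M (fun j => (ts j).ren ρ)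
  | _, _, _, .dummyTy, _, _ => .dummyTy
  | _, _, _, .dummyTm, _, _ => .dummyTm
  | _, _, _, .abs e, _, ρ => .abs (e.ren (liftRen ρ))

/-- Weakening by one variable. -/
def Arg.wk {c : Cls} {k n : ℕ} (e : Arg S c k n) : Arg S c k (n + 1) := e.ren Fin.succ

/-- The extension of a substitution under one binder. -/
def liftSub {l n : ℕ} (σ : Fin l → Tm S n) : Fin (l + 1) → Tm S (n + 1) :=
  Fin.cases (.var 0) (fun i => (σ i).wk)

/-- Simultaneous capture-avoiding substitution of terms for variables. -/
def Arg.sub : {c : Cls} → {k l : ℕ} → Arg S c k l → {n : ℕ} → (Fin l → Tm S n) → Arg S c k n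
  | _, _, _, .var x, _, σ => σ x
  | _, _, _, .sym s hs args, _, σ => .sym s hs (fun i => (args i).sub σ)
  | _, _, _, .mvar hc M ts, _, σ => .mvar hc M (fun j => (ts j).sub σ)
  | _, _, _, .dummyTy, _, _ => .dummyTy
  | _, _, _, .dummyTm, _, _ => .dummyTm
  | _, _, _, .abs e, _, σ => .abs (e.sub (liftSub σ))

/-- The substitution `[t/x]` for the last variable. -/
def single {n : ℕ} (t : Tm S n) : Fin (n + 1) → Tm S n := Fin.cases t Arg.var

/-- The body of an abstraction. -/
def Arg.body {c : Cls} {k n : ℕ} : Arg S c (k + 1) n → Arg S c k (n + 1)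
  | .abs e => e

/-- `({x₁}…{xₖ} e).app t = e[t₁/x₁, …, tₖ/xₖ]`. -/
def Arg.app {c : Cls} : {k n : ℕ} → Arg S c k n → (Fin k → Tm S n) → Arg S c 0 n
  | 0, _, e, _ => e
  | _ + 1, _, e, ts => Arg.app (e.body.sub (single (ts 0))) (fun j => ts j.succ)

/-- The number of variables below `k` further binders. -/
def scope : ℕ → ℕ → ℕ
  | n, 0 => n
  | n, k + 1 => scope (n + 1) k

/-- Weakening of a variable by `k` binders. -/
def wkVar : {n : ℕ} → (k : ℕ) → Fin n → Fin (scope n k)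
  | _, 0, x => x
  | _, k + 1, x => wkVar k x.succ

/-- The variables `x₁, …, xₖ` bound by `k` binders, outermost first. -/
def boundVar : {n : ℕ} → (k : ℕ) → Fin k → Fin (scope n k)
  | _, 0 => fun i => i.elim0
  | n, k + 1 => Fin.cases (wkVar k (0 : Fin (n + 1))) (fun i => boundVar k i)

/-- Iterated abstraction `{x₁}…{xₖ} e`. -/
def absN {c : Cls} : {n : ℕ} → (k : ℕ) → Arg S c 0 (scope n k) → Arg S c k n
  | _, 0, e => e
  | _, k + 1, e => .abs (absN k e)

/-- The application `M(t₁, …, tₖ)` of a metavariable, which is the dummy expression when `M` is an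
equality metavariable. -/
def MVar.app {n k : ℕ} : {c : Cls} → MVar c k → (Fin k → Tm S n) → Arg S c 0 n
  | .ty, M, ts => .mvar rfl M ts
  | .tm, M, ts => .mvar rfl M ts
  | .eqTy, _, _ => .dummyTy
  | .eqTm, _, _ => .dummyTm

/-- The generic application: `{x₁}…{xₖ} M(x₁, …, xₖ)` if `M` is an object metavariable and
`{x₁}…{xₖ} ⋆` if it is an equality metavariable. -/
def MVar.gen {c : Cls} {k n : ℕ} (M : MVar c k) : Arg S c k n :=
  absN k (M.app (fun i => .var (boundVar k i)))

/-- The set of metavariables that occur in an argument. -/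
def Arg.mv : {c : Cls} → {k n : ℕ} → Arg S c k n → Set AnyMVar
  | _, _, _, .var _ => ∅
  | _, _, _, .sym _ _ args => ⋃ i, (args i).mv
  | _, _, _, .mvar _ M ts => {⟨_, _, M⟩} ∪ ⋃ j, (ts j).mv
  | _, _, _, .dummyTy => ∅
  | _, _, _, .dummyTm => ∅
  | _, _, _, .abs e => e.mv

/-! ### Instantiations -/

/-- An instantiation over `n` variables assigns to every metavariable an argument of its arity. An
instantiation of a metavariable context `Ξ` is recorded by such a total assignment, of which only
the values at the metavariables of `Ξ` matter: it is only applied to entities over `Ξ`. -/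
abbrev Inst (S : Signature.{u}) (n : ℕ) : Type u := ⦃c : Cls⦄ → ⦃k : ℕ⦄ → MVar c k → Arg S c k n

/-- Weakening of an instantiation by one variable. -/
def Inst.wk {n : ℕ} (I : Inst S n) : Inst S (n + 1) := fun _ _ M => (I M).wk

/-- The action of an instantiation on an entity in `l` variables, where `σ` tells what becomes of
these variables: `I_*(M(t⃗)) = e[I_* t⃗/x⃗]` if `I(M) = {x⃗} e`. -/
def Arg.act : {c : Cls} → {k l : ℕ} → Arg S c k l → {n : ℕ} → Inst S n → (Fin l → Tm S n) →
    Arg S c k n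
  | _, _, _, .var x, _, _, σ => σ x
  | _, _, _, .sym s hs args, _, I, σ => .sym s hs (fun i => (args i).act I σ)
  | _, _, _, .mvar _ M ts, _, I, σ => (I M).app (fun j => (ts j).act I σ)
  | _, _, _, .dummyTy, _, _, _ => .dummyTy
  | _, _, _, .dummyTm, _, _, _ => .dummyTm
  | _, _, _, .abs e, _, I, σ => .abs (e.act I.wk (liftSub σ))

/-- The action `I_* e` on a closed argument. -/
def Arg.inst {c : Cls} {k n : ℕ} (e : Arg S c k 0) (I : Inst S n) : Arg S c k n :=
  e.act I (fun i => i.elim0)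

/-! ### Judgements and boundaries -/

/-- Judgement theses: `A type`, `t : A`, `A ≡ B`, `s ≡ t : A` (the mandatory dummy heads of
equality judgements carry no information and are not recorded). -/
inductive Jdg (S : Signature.{u}) (n : ℕ) : Type u where
  | isTy (A : Ty S n)
  | hasTy (t : Tm S n) (A : Ty S n)
  | eqTy (A B : Ty S n)
  | eqTm (s t : Tm S n) (A : Ty S n)

/-- Abstracted judgements. -/
inductive AJdg (S : Signature.{u}) : ℕ → Type u where
  | base {n : ℕ} (J : Jdg S n) : AJdg S n
  | abs {n : ℕ} (A : Ty S n) (J : AJdg S (n + 1)) : AJdg S n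

/-- Boundary theses: `□ type`, `□ : A`, `A ≡ B by □`, `s ≡ t : A by □`. -/
inductive Bdry (S : Signature.{u}) : Cls → ℕ → Type u where
  | ty {n : ℕ} : Bdry S .ty n
  | tm {n : ℕ} (A : Ty S n) : Bdry S .tm n
  | eqTy {n : ℕ} (A B : Ty S n) : Bdry S .eqTy n
  | eqTm {n : ℕ} (s t : Tm S n) (A : Ty S n) : Bdry S .eqTm n

/-- Abstracted boundaries of metavariable arity `(c, k)`. -/
inductive ABdry (S : Signature.{u}) : Cls → ℕ → ℕ → Type u where
  | base {n : ℕ} {c : Cls} (B : Bdry S c n) : ABdry S c 0 n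
  | abs {n : ℕ} {c : Cls} {k : ℕ} (A : Ty S n) (B : ABdry S c k (n + 1)) : ABdry S c (k + 1) n

/-- `𝓑[e]`, filling the head of a boundary thesis. -/
def Bdry.plug {n : ℕ} : {c : Cls} → Bdry S c n → Arg S c 0 n → Jdg S n
  | _, .ty, A => .isTy A
  | _, .tm A, t => .hasTy t A
  | _, .eqTy A B, _ => .eqTy A B
  | _, .eqTm s t A, _ => .eqTm s t A

/-- `𝓑[e]` for an abstracted boundary. -/
def ABdry.plug : {c : Cls} → {k n : ℕ} → ABdry S c k n → Arg S c k n → AJdg S n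
  | _, _, _, .base B, e => .base (B.plug e)
  | _, _, _, .abs A B, e => .abs A (B.plug e.body)

/-- `𝓑[e ≡ e']` for an object boundary thesis. -/
def Bdry.plugEq {n : ℕ} : {c : Cls} → Bdry S c n → c.isObj = true →
    Arg S c 0 n → Arg S c 0 n → Jdg S n
  | _, .ty, _, A, B => .eqTy A B
  | _, .tm A, _, s, t => .eqTm s t A
  | _, .eqTy _ _, h, _, _ => absurd h Bool.false_ne_true
  | _, .eqTm _ _ _, h, _, _ => absurd h Bool.false_ne_true

/-- `𝓑[e ≡ e']` for an abstracted object boundary. -/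
def ABdry.plugEq : {c : Cls} → {k n : ℕ} → ABdry S c k n → c.isObj = true →
    Arg S c k n → Arg S c k n → AJdg S n
  | _, _, _, .base B, h, e, e' => .base (B.plugEq h e e')
  | _, _, _, .abs A B, h, e, e' => .abs A (B.plugEq h e.body e'.body)

/-- `𝓑[e ≡ e' by □]`, the equation boundary made of an object boundary thesis. -/
def Bdry.eqBdry {n : ℕ} : {c : Cls} → Bdry S c n → c.isObj = true →
    Arg S c 0 n → Arg S c 0 n → Bdry S c.eqOf n
  | _, .ty, _, A, B => .eqTy A B
  | _, .tm A, _, s, t => .eqTm s t A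
  | _, .eqTy _ _, h, _, _ => absurd h Bool.false_ne_true
  | _, .eqTm _ _ _, h, _, _ => absurd h Bool.false_ne_true

/-- `𝓑[e ≡ e' by □]` for an abstracted object boundary. -/
def ABdry.eqBdry : {c : Cls} → {k n : ℕ} → ABdry S c k n → c.isObj = true →
    Arg S c k n → Arg S c k n → ABdry S c.eqOf k n
  | _, _, _, .base B, h, e, e' => .base (B.eqBdry h e e')
  | _, _, _, .abs A B, h, e, e' => .abs A (B.eqBdry h e.body e'.body)

/-- The type `A` of a boundary `□ : A`. -/
def Bdry.objTy {n : ℕ} : {c : Cls} → Bdry S c n → Option (Ty S n)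
  | _, .ty => none
  | _, .tm A => some A
  | _, .eqTy _ _ => none
  | _, .eqTm _ _ _ => none

/-- Renaming of variables in a boundary. -/
def Bdry.ren {l n : ℕ} : {c : Cls} → Bdry S c l → (Fin l → Fin n) → Bdry S c n
  | _, .ty, _ => .ty
  | _, .tm A, ρ => .tm (A.ren ρ)
  | _, .eqTy A B, ρ => .eqTy (A.ren ρ) (B.ren ρ)
  | _, .eqTm s t A, ρ => .eqTm (s.ren ρ) (t.ren ρ) (A.ren ρ)

/-- Renaming of variables in an abstracted boundary. -/
def ABdry.ren : {c : Cls} → {k l : ℕ} → ABdry S c k l → {n : ℕ} → (Fin l → Fin n) → ABdry S c k n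
  | _, _, _, .base B, _, ρ => .base (B.ren ρ)
  | _, _, _, .abs A B, _, ρ => .abs (A.ren ρ) (B.ren (liftRen ρ))

/-- Substitution in a boundary. -/
def Bdry.sub {l n : ℕ} : {c : Cls} → Bdry S c l → (Fin l → Tm S n) → Bdry S c n
  | _, .ty, _ => .ty
  | _, .tm A, σ => .tm (A.sub σ)
  | _, .eqTy A B, σ => .eqTy (A.sub σ) (B.sub σ)
  | _, .eqTm s t A, σ => .eqTm (s.sub σ) (t.sub σ) (A.sub σ)

/-- Substitution in an abstracted boundary. -/
def ABdry.sub : {c : Cls} → {k l : ℕ} → ABdry S c k l → {n : ℕ} → (Fin l → Tm S n) → ABdry S c k n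
  | _, _, _, .base B, _, σ => .base (B.sub σ)
  | _, _, _, .abs A B, _, σ => .abs (A.sub σ) (B.sub (liftSub σ))

/-- The action of an instantiation on a boundary. -/
def Bdry.act {l n : ℕ} : {c : Cls} → Bdry S c l → Inst S n → (Fin l → Tm S n) → Bdry S c n
  | _, .ty, _, _ => .ty
  | _, .tm A, I, σ => .tm (A.act I σ)
  | _, .eqTy A B, I, σ => .eqTy (A.act I σ) (B.act I σ)
  | _, .eqTm s t A, I, σ => .eqTm (s.act I σ) (t.act I σ) (A.act I σ)

/-- The action of an instantiation on an abstracted boundary. -/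
def ABdry.act : {c : Cls} → {k l : ℕ} → ABdry S c k l → {n : ℕ} → Inst S n →
    (Fin l → Tm S n) → ABdry S c k n
  | _, _, _, .base B, _, I, σ => .base (B.act I σ)
  | _, _, _, .abs A B, _, I, σ => .abs (A.act I σ) (B.act I.wk (liftSub σ))

/-- The action `I_* 𝓑` on a closed boundary thesis. -/
def Bdry.inst {c : Cls} {n : ℕ} (B : Bdry S c 0) (I : Inst S n) : Bdry S c n :=
  B.act I (fun i => i.elim0)

/-- The action `I_* 𝓑` on a closed abstracted boundary. -/
def ABdry.inst {c : Cls} {k n : ℕ} (B : ABdry S c k 0) (I : Inst S n) : ABdry S c k n :=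
  B.act I (fun i => i.elim0)

/-- A closed abstracted boundary, regarded as one in `n` variables. -/
def ABdry.wk0 {c : Cls} {k : ℕ} (B : ABdry S c k 0) (n : ℕ) : ABdry S c k n :=
  B.ren (fun i => i.elim0)

/-- `({x₁:A₁}…{xₖ:Aₖ} 𝓑).app t = 𝓑[t⃗/x⃗]`. -/
def ABdry.app {c : Cls} : {k n : ℕ} → ABdry S c k n → (Fin k → Tm S n) → Bdry S c n
  | 0, _, .base B, _ => B
  | _ + 1, _, .abs _ B, ts => ABdry.app (B.sub (single (ts 0))) (fun j => ts j.succ)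

/-- `({x₁:A₁}…{xₖ:Aₖ} 𝓑).argTy t j = Aⱼ[t₁/x₁, …, tⱼ₋₁/xⱼ₋₁]`. -/
def ABdry.argTy {c : Cls} : {k n : ℕ} → ABdry S c k n → (Fin k → Tm S n) → Fin k → Ty S n
  | 0, _, _, _ => fun j => j.elim0
  | _ + 1, _, .abs A B, ts =>
      Fin.cases A (ABdry.argTy (B.sub (single (ts 0))) (fun j => ts j.succ))

/-- The metavariables that occur in a boundary. -/
def Bdry.mv {n : ℕ} : {c : Cls} → Bdry S c n → Set AnyMVar
  | _, .ty => ∅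
  | _, .tm A => A.mv
  | _, .eqTy A B => A.mv ∪ B.mv
  | _, .eqTm s t A => s.mv ∪ t.mv ∪ A.mv

/-- The metavariables that occur in an abstracted boundary. -/
def ABdry.mv : {c : Cls} → {k n : ℕ} → ABdry S c k n → Set AnyMVar
  | _, _, _, .base B => B.mv
  | _, _, _, .abs A B => A.mv ∪ B.mv

/-! ### Contexts and rules -/

/-- An entry `M : 𝓑` of a metavariable context; `𝓑` is closed. -/
structure Decl (S : Signature.{u}) where
  c : Cls
  k : ℕ
  mvar : MVar c k
  bdry : ABdry S c k 0

/-- The declared metavariable. -/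
def Decl.key (d : Decl S) : AnyMVar := ⟨d.c, d.k, d.mvar⟩

/-- Metavariable contexts `[M₁ : 𝓑₁, …, Mₙ : 𝓑ₙ]`. -/
abbrev MCtx (S : Signature.{u}) : Type u := List (Decl S)

/-- The set `|Θ|`. -/
def MCtx.dom (Θ : MCtx S) : Set AnyMVar := {M | ∃ d ∈ Θ, d.key = M}

/-- Syntactic validity of a metavariable context: the metavariables are distinct, and each boundary
only mentions the preceding ones. -/
def MCtx.Valid (Θ : MCtx S) : Prop :=
  ∀ (Θ₁ Θ₂ : MCtx S) (d : Decl S), Θ = Θ₁ ++ d :: Θ₂ →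
    d.key ∉ MCtx.dom Θ₁ ∧ d.bdry.mv ⊆ MCtx.dom Θ₁

/-- Variable contexts `[a₁ : A₁, …, aₙ : Aₙ]`. -/
inductive Ctx (S : Signature.{u}) : ℕ → Type u where
  | nil : Ctx S 0
  | snoc {n : ℕ} (Γ : Ctx S n) (A : Ty S n) : Ctx S (n + 1)

/-- The type `Γ(a)`. -/
def Ctx.get : {n : ℕ} → Ctx S n → Fin n → Ty S n
  | 0, _ => fun x => x.elim0
  | _ + 1, .snoc Γ A => Fin.cases A.wk (fun x => (Γ.get x).wk)

/-- `I` is an instantiation of `Ξ` over a context whose metavariables are those of `Θ`. -/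
def Inst.Over {n : ℕ} (I : Inst S n) (Ξ Θ : MCtx S) : Prop :=
  ∀ d ∈ Ξ, (I d.mvar).mv ⊆ MCtx.dom Θ

/-- A raw rule `Ξ ⟹ 𝓑[e]`. -/
structure RawRule (S : Signature.{u}) where
  c : Cls
  prem : MCtx S
  bdry : Bdry S c 0
  head : Arg S c 0 0

/-- Syntactic validity of a raw rule. -/
def RawRule.Valid (R : RawRule S) : Prop :=
  R.prem.Valid ∧ R.bdry.mv ⊆ MCtx.dom R.prem ∧ R.head.mv ⊆ MCtx.dom R.prem

/-- The instance `I_*(𝓑[e])` of the conclusion. -/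
def RawRule.concl {n : ℕ} (R : RawRule S) (I : Inst S n) : AJdg S n :=
  .base ((R.bdry.inst I).plug (R.head.inst I))

/-- The conclusion `𝓑[e]` itself. -/
def RawRule.jdg (R : RawRule S) : AJdg S 0 := .base (R.bdry.plug R.head)

/-- A raw type theory: a family of raw rules, called the specific rules. -/
structure RawTT (S : Signature.{u}) where
  Ix : Type v
  rule : Ix → RawRule S
  valid : ∀ r, (rule r).Valid

/-- What may stand on the right of `⊢`: an abstracted judgement or an abstracted boundary. -/
inductive Stmt (S : Signature.{u}) (n : ℕ) : Type u where
  | jdg (J : AJdg S n)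
  | bdry {c : Cls} {k : ℕ} (B : ABdry S c k n)

/-- The deductive system of a raw type theory: `Der T Θ Γ X` says that `Θ; Γ ⊢ X` is derivable. In
a premise for the entry `M : 𝓑` of `Ξ`, the restriction of `I` to the entries before `M` acts on
`𝓑` in the same way as `I`, because `𝓑` mentions only those. -/
inductive Der (T : RawTT.{u, v} S) (Θ : MCtx S) : {n : ℕ} → Ctx S n → Stmt S n → Prop where
  -- variables, metavariables, abstraction
  | var {n : ℕ} {Γ : Ctx S n} (a : Fin n) : Der T Θ Γ (.jdg (.base (.hasTy (.var a) (Γ.get a))))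
  | mvar {n : ℕ} {Γ : Ctx S n} {c : Cls} {k : ℕ} {M : MVar c k} {B : ABdry S c k 0}
      (hM : ⟨c, k, M, B⟩ ∈ Θ) (ts : Fin k → Tm S n)
      (ht : ∀ j, Der T Θ Γ (.jdg (.base (.hasTy (ts j) ((B.wk0 n).argTy ts j)))))
      (hB : Der T Θ Γ (.bdry (.base ((B.wk0 n).app ts)))) :
      Der T Θ Γ (.jdg (.base (((B.wk0 n).app ts).plug (M.app ts))))
  | mvarCongr {n : ℕ} {Γ : Ctx S n} {c : Cls} {k : ℕ} {M : MVar c k} {B : ABdry S c k 0}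
      (hM : ⟨c, k, M, B⟩ ∈ Θ) (hc : c.isObj = true) (ss ts : Fin k → Tm S n)
      (hs : ∀ j, Der T Θ Γ (.jdg (.base (.hasTy (ss j) ((B.wk0 n).argTy ss j)))))
      (ht : ∀ j, Der T Θ Γ (.jdg (.base (.hasTy (ts j) ((B.wk0 n).argTy ts j)))))
      (he : ∀ j, Der T Θ Γ (.jdg (.base (.eqTm (ss j) (ts j) ((B.wk0 n).argTy ss j)))))
      (hC : ∀ C C' : Ty S n, ((B.wk0 n).app ss).objTy = some C →
        ((B.wk0 n).app ts).objTy = some C' → Der T Θ Γ (.jdg (.base (.eqTy C C')))) :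
      Der T Θ Γ (.jdg (.base (((B.wk0 n).app ss).plugEq hc (M.app ss) (M.app ts))))
  | abs {n : ℕ} {Γ : Ctx S n} {A : Ty S n} {J : AJdg S (n + 1)}
      (hA : Der T Θ Γ (.jdg (.base (.isTy A)))) (hJ : Der T Θ (Γ.snoc A) (.jdg J)) :
      Der T Θ Γ (.jdg (.abs A J))
  -- equality
  | tyRefl {n : ℕ} {Γ : Ctx S n} {A : Ty S n} (h : Der T Θ Γ (.jdg (.base (.isTy A)))) :
      Der T Θ Γ (.jdg (.base (.eqTy A A)))
  | tySym {n : ℕ} {Γ : Ctx S n} {A B : Ty S n} (h : Der T Θ Γ (.jdg (.base (.eqTy A B)))) :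
      Der T Θ Γ (.jdg (.base (.eqTy B A)))
  | tyTran {n : ℕ} {Γ : Ctx S n} {A B C : Ty S n} (h : Der T Θ Γ (.jdg (.base (.eqTy A B))))
      (h' : Der T Θ Γ (.jdg (.base (.eqTy B C)))) : Der T Θ Γ (.jdg (.base (.eqTy A C)))
  | tmRefl {n : ℕ} {Γ : Ctx S n} {t : Tm S n} {A : Ty S n}
      (h : Der T Θ Γ (.jdg (.base (.hasTy t A)))) : Der T Θ Γ (.jdg (.base (.eqTm t t A)))
  | tmSym {n : ℕ} {Γ : Ctx S n} {s t : Tm S n} {A : Ty S n}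
      (h : Der T Θ Γ (.jdg (.base (.eqTm s t A)))) : Der T Θ Γ (.jdg (.base (.eqTm t s A)))
  | tmTran {n : ℕ} {Γ : Ctx S n} {s t w : Tm S n} {A : Ty S n}
      (h : Der T Θ Γ (.jdg (.base (.eqTm s t A)))) (h' : Der T Θ Γ (.jdg (.base (.eqTm t w A)))) :
      Der T Θ Γ (.jdg (.base (.eqTm s w A)))
  | convTm {n : ℕ} {Γ : Ctx S n} {t : Tm S n} {A B : Ty S n}
      (h : Der T Θ Γ (.jdg (.base (.hasTy t A)))) (h' : Der T Θ Γ (.jdg (.base (.eqTy A B)))) :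
      Der T Θ Γ (.jdg (.base (.hasTy t B)))
  | convEq {n : ℕ} {Γ : Ctx S n} {s t : Tm S n} {A B : Ty S n}
      (h : Der T Θ Γ (.jdg (.base (.eqTm s t A)))) (h' : Der T Θ Γ (.jdg (.base (.eqTy A B)))) :
      Der T Θ Γ (.jdg (.base (.eqTm s t B)))
  -- boundaries
  | bdryTy {n : ℕ} {Γ : Ctx S n} : Der T Θ Γ (.bdry (.base .ty))
  | bdryTm {n : ℕ} {Γ : Ctx S n} {A : Ty S n} (hA : Der T Θ Γ (.jdg (.base (.isTy A)))) :
      Der T Θ Γ (.bdry (.base (.tm A)))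
  | bdryEqTy {n : ℕ} {Γ : Ctx S n} {A B : Ty S n} (hA : Der T Θ Γ (.jdg (.base (.isTy A))))
      (hB : Der T Θ Γ (.jdg (.base (.isTy B)))) : Der T Θ Γ (.bdry (.base (.eqTy A B)))
  | bdryEqTm {n : ℕ} {Γ : Ctx S n} {s t : Tm S n} {A : Ty S n}
      (hA : Der T Θ Γ (.jdg (.base (.isTy A)))) (hs : Der T Θ Γ (.jdg (.base (.hasTy s A))))
      (ht : Der T Θ Γ (.jdg (.base (.hasTy t A)))) : Der T Θ Γ (.bdry (.base (.eqTm s t A)))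
  | bdryAbs {n : ℕ} {Γ : Ctx S n} {A : Ty S n} {c : Cls} {k : ℕ} {B : ABdry S c k (n + 1)}
      (hA : Der T Θ Γ (.jdg (.base (.isTy A)))) (hB : Der T Θ (Γ.snoc A) (.bdry B)) :
      Der T Θ Γ (.bdry (.abs A B))
  -- instances of the specific rules, and congruence rules for the specific object rules
  | rule {n : ℕ} {Γ : Ctx S n} (r : T.Ix) (I : Inst S n)
      (hI : ∀ d ∈ (T.rule r).prem, Der T Θ Γ (.jdg ((d.bdry.inst I).plug (I d.mvar))))
      (hB : Der T Θ Γ (.bdry (.base ((T.rule r).bdry.inst I)))) :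
      Der T Θ Γ (.jdg ((T.rule r).concl I))
  | congr {n : ℕ} {Γ : Ctx S n} (r : T.Ix) (hr : (T.rule r).c.isObj = true) (I J : Inst S n)
      (hI : ∀ d ∈ (T.rule r).prem, Der T Θ Γ (.jdg ((d.bdry.inst I).plug (I d.mvar))))
      (hJ : ∀ d ∈ (T.rule r).prem, Der T Θ Γ (.jdg ((d.bdry.inst J).plug (J d.mvar))))
      (he : ∀ d ∈ (T.rule r).prem, ∀ hd : d.c.isObj = true,
        Der T Θ Γ (.jdg ((d.bdry.inst I).plugEq hd (I d.mvar) (J d.mvar))))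
      (hC : ∀ C : Ty S 0, (T.rule r).bdry.objTy = some C →
        Der T Θ Γ (.jdg (.base (.eqTy (C.inst I) (C.inst J))))) :
      Der T Θ Γ (.jdg (.base (((T.rule r).bdry.inst I).plugEq hr
        ((T.rule r).head.inst I) ((T.rule r).head.inst J))))

/-- `⊢ Θ mctx`. -/
inductive WfMCtx (T : RawTT.{u, v} S) : MCtx S → Prop where
  | nil : WfMCtx T []
  | snoc {Θ : MCtx S} {d : Decl S} (hΘ : WfMCtx T Θ) (hd : Der T Θ .nil (.bdry d.bdry))
      (hn : d.key ∉ MCtx.dom Θ) : WfMCtx T (Θ ++ [d])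

/-- `Θ ⊢ Γ vctx`; this includes `⊢ Θ mctx`. -/
inductive WfCtx (T : RawTT.{u, v} S) (Θ : MCtx S) : {n : ℕ} → Ctx S n → Prop where
  | nil (hΘ : WfMCtx T Θ) : WfCtx T Θ .nil
  | snoc {n : ℕ} {Γ : Ctx S n} {A : Ty S n} (hΓ : WfCtx T Θ Γ)
      (hA : Der T Θ Γ (.jdg (.base (.isTy A)))) : WfCtx T Θ (Γ.snoc A)

/-- `I` is a derivable instantiation of `Ξ` over `Θ; Γ`. -/
def InstDer (T : RawTT.{u, v} S) (Θ : MCtx S) {n : ℕ} (Γ : Ctx S n) (Ξ : MCtx S)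
    (I : Inst S n) : Prop :=
  ∀ d ∈ Ξ, Der T Θ Γ (.jdg ((d.bdry.inst I).plug (I d.mvar)))

/-- A raw rule is derivable when it is derivable as a judgement. -/
def RawRule.Derivable (T : RawTT.{u, v} S) (R : RawRule S) : Prop :=
  Der T R.prem .nil (.jdg R.jdg)

/-- A raw rule is finitary when its premises and its conclusion boundary are well formed. -/
def RawRule.Finitary (T : RawTT.{u, v} S) (R : RawRule S) : Prop :=
  WfMCtx T R.prem ∧ Der T R.prem .nil (.bdry (.base R.bdry))

/-- Data of a symbol rule `M₁ : 𝓑₁, …, Mₙ : 𝓑ₙ ⟹ 𝓑[s(M̂₁, …, M̂ₙ)]` for the symbol `s` of class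
`c`. -/
structure SymRule (S : Signature.{u}) (s : S.Sym) (c : Cls) where
  M : (i : Fin (S.nargs s)) → MVar (S.argCls s i) (S.argBinds s i)
  premBdry : (i : Fin (S.nargs s)) → ABdry S (S.argCls s i) (S.argBinds s i) 0
  bdry : Bdry S c 0

/-- The symbol rule as a raw rule. -/
def SymRule.toRaw {s : S.Sym} {c : Cls} (d : SymRule S s c) (hs : S.cls s = c) : RawRule S where
  c := c
  prem := List.ofFn (fun i => ⟨S.argCls s i, S.argBinds s i, d.M i, d.premBdry i⟩)
  bdry := d.bdry
  head := .sym s hs (fun i => (d.M i).gen)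

/-- `d` is the rule for the symbol `s` in `T`. -/
def RawTT.HasSymRule (T : RawTT.{u, v} S) {s : S.Sym} {c : Cls} (hs : S.cls s = c)
    (d : SymRule S s c) : Prop :=
  ∃ r, T.rule r = d.toRaw hs

/-- A finitary type theory: every specific rule is finitary. -/
def RawTT.Finitary (T : RawTT.{u, v} S) : Prop := ∀ r, (T.rule r).Finitary T

/-- A standard type theory: a finitary type theory in which every specific object rule is a symbol
rule, and every symbol has precisely one rule. -/
def RawTT.Standard (T : RawTT.{u, v} S) : Prop :=
  T.Finitary ∧
  (∀ r, (T.rule r).c.isObj = true →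
    ∃ (s : S.Sym) (c : Cls) (hs : S.cls s = c) (d : SymRule S s c), T.rule r = d.toRaw hs) ∧
  ∀ s : S.Sym, ∃! r, ∃ d : SymRule S s (S.cls s), T.rule r = d.toRaw rfl

/-- `A` is the natural type of the closed term `s(e₁, …, eₙ)`: it is `⟨M₁ ↦ e₁, …, Mₙ ↦ eₙ⟩_* B` if
the rule for `s` is `M₁ : 𝓑₁, …, Mₙ : 𝓑ₙ ⟹ s(M̂₁, …, M̂ₙ) : B`. -/
def RawTT.IsNatTy (T : RawTT.{u, v} S) (s : S.Sym) (hs : S.cls s = .tm)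
    (e : (i : Fin (S.nargs s)) → Arg S (S.argCls s i) (S.argBinds s i) 0) (A : Ty S 0) : Prop :=
  ∃ (d : SymRule S s .tm) (B : Ty S 0) (I : Inst S 0), T.HasSymRule hs d ∧ d.bdry = .tm B ∧
    (∀ i, I (d.M i) = e i) ∧ B.inst I = A

/-! ### Computation and extensionality rules -/

/-- A rule is deterministic when a judgement is an instance of its conclusion in at most one way. -/
def RawRule.Deterministic (R : RawRule S) : Prop :=
  ∀ (Θ : MCtx S) (n : ℕ) (I J : Inst S n), I.Over R.prem Θ → J.Over R.prem Θ →
    R.concl I = R.concl J → ∀ d ∈ R.prem, I d.mvar = J d.mvar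

/-- The equational residue of an instantiation `I` of `Ξ` over `Θ` and the empty context: `Θ`
followed by the instances of the equality entries of `Ξ`. -/
def residue (Θ Ξ : MCtx S) (I : Inst S 0) : MCtx S :=
  Θ ++ (Ξ.filter (fun d => !d.c.isObj)).map (fun d => ⟨d.c, d.k, d.mvar, d.bdry.inst I⟩)

/-- The residual instantiation: `I` on object metavariables and the generic application on equality
metavariables. -/
def Inst.residual (I : Inst S 0) : Inst S 0 :=
  fun c _ M => if c.isObj = true then I M else M.gen

/-- Object-invertible rules. -/
def RawRule.ObjInvertible (T : RawTT.{u, v} S) (R : RawRule S) : Prop :=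
  R.Derivable T ∧
  ∀ (Θ : MCtx S) (I : Inst S 0), WfMCtx T Θ → Disjoint (MCtx.dom R.prem) (MCtx.dom Θ) →
    I.Over R.prem Θ → Der T Θ .nil (.jdg (R.concl I)) →
    InstDer T (residue Θ R.prem I) .nil R.prem I.residual

/-- An equality rule `Ξ ⟹ 𝓑[lhs ≡ rhs]`, with `𝓑` an object boundary thesis of class `c`. -/
structure EqRule (S : Signature.{u}) (c : Cls) where
  obj : c.isObj = true
  prem : MCtx S
  bdry : Bdry S c 0
  lhs : Arg S c 0 0
  rhs : Arg S c 0 0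

/-- The dummy head of class `c.eqOf`. -/
def dummyOf : (c : Cls) → Arg S c.eqOf 0 0
  | .ty => .dummyTy
  | .tm => .dummyTm
  | .eqTy => .dummyTy
  | .eqTm => .dummyTm

/-- An equality rule as a raw rule. -/
def EqRule.toRaw {c : Cls} (R : EqRule S c) : RawRule S where
  c := c.eqOf
  prem := R.prem
  bdry := R.bdry.eqBdry R.obj R.lhs R.rhs
  head := dummyOf c

/-- Computation rules. A type computation rule is a derivable finitary rule `Ξ ⟹ A ≡ B` such that
`Ξ ⟹ A type` is deterministic and object-invertible. A term computation rule is a derivable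
finitary rule `Ξ ⟹ u ≡ v : A` such that `u` is a symbol application and `Ξ ⟹ u : C` is
deterministic and object-invertible, where `C` is the natural type of `u`. -/
def IsCompRule (T : RawTT.{u, v} S) : {c : Cls} → EqRule S c → Prop
  | .ty, R => R.toRaw.Derivable T ∧ R.toRaw.Finitary T ∧
      RawRule.Deterministic ⟨.ty, R.prem, .ty, R.lhs⟩ ∧
      RawRule.ObjInvertible T ⟨.ty, R.prem, .ty, R.lhs⟩
  | .tm, R => R.toRaw.Derivable T ∧ R.toRaw.Finitary T ∧
      ∃ s hs e, R.lhs = .sym s hs e ∧ ∃ C : Ty S 0, T.IsNatTy s hs e C ∧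
        RawRule.Deterministic ⟨.tm, R.prem, .tm C, R.lhs⟩ ∧
        RawRule.ObjInvertible T ⟨.tm, R.prem, .tm C, R.lhs⟩
  | .eqTy, _ => False
  | .eqTm, _ => False

/-- Data of a rule `Ξ, s : (□ : P), t : (□ : P), Φ ⟹ s ≡ t : P`. -/
structure ExtRule (S : Signature.{u}) where
  prem : MCtx S
  ty : Ty S 0
  s : MVar .tm 0
  t : MVar .tm 0
  post : MCtx S

/-- Such a rule as a raw rule. -/
def ExtRule.toRaw (R : ExtRule S) : RawRule S where
  c := .eqTm
  prem := R.prem ++ [⟨.tm, 0, R.s, .base (.tm R.ty)⟩, ⟨.tm, 0, R.t, .base (.tm R.ty)⟩] ++ R.post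
  bdry := .eqTm R.s.gen R.t.gen R.ty
  head := .dummyTm

/-- Extensionality rules: `Φ` has only equality premises, and `Ξ ⟹ P type` is deterministic and
object-invertible. -/
def IsExtRule (T : RawTT.{u, v} S) (R : ExtRule S) : Prop :=
  R.toRaw.Derivable T ∧ R.toRaw.Finitary T ∧ (∀ d ∈ R.post, d.c.isObj = false) ∧
  RawRule.Deterministic ⟨.ty, R.prem, .ty, R.ty⟩ ∧
  RawRule.ObjInvertible T ⟨.ty, R.prem, .ty, R.ty⟩

/-! ### The algorithm -/

/-- A choice of principal arguments, for symbols and for metavariables (which the algorithm treats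
as symbols that take term arguments). -/
structure Principal (S : Signature.{u}) where
  sym : (s : S.Sym) → Set (Fin (S.nargs s))
  mvar : ⦃c : Cls⦄ → ⦃k : ℕ⦄ → MVar c k → Set (Fin k)

/-- `I` is an instantiation of `Ξ` over a context with metavariables `Θ`, and `I_* p = e`. -/
def Matches (Θ Ξ : MCtx S) {c : Cls} {n : ℕ} (p : Arg S c 0 0) (e : Arg S c 0 n)
    (I : Inst S n) : Prop :=
  I.Over Ξ Θ ∧ p.inst I = e

/-- The names of the relations that make up the algorithm: normalization, normalization of
principal arguments, use of a computation rule, general comparison, type-directed (extensional)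
comparison, comparison of normalized expressions. -/
inductive Mode where
  | norm | normP | normC | sim | simE | simN

/-- The algorithm, with computation rules `C`, extensionality rules `E` and principal arguments `P`.
`Alg T C E P Θ m Γ 𝓑 e e'` stands for `Θ; Γ ⊢ 𝓑[e R e']`, where `R` is the relation named by `m`;
for example `𝓑 = (□ : A)` and `m = simE` gives `Θ; Γ ⊢ e ∼ₑ e' : A`. -/
inductive Alg (T : RawTT.{u, v} S) (C : (c : Cls) → Set (EqRule S c)) (E : Set (ExtRule S))
    (P : Principal S) (Θ : MCtx S) :
    Mode → {n : ℕ} → Ctx S n → {c : Cls} → {k : ℕ} → ABdry S c k n → Arg S c k n → Arg S c k n →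
    Prop where
  -- use of a computation rule
  | normCRule {n : ℕ} {Γ : Ctx S n} {c : Cls} {B : Bdry S c n} {e : Arg S c 0 n}
      (R : EqRule S c) (hR : R ∈ C c) (I : Inst S n) (hI : Matches Θ R.prem R.lhs e I)
      (hprem : ∀ (c' : Cls) (hc' : c'.isObj = true) (k : ℕ) (M : MVar c'.eqOf k)
        (B' : ABdry S c' k 0) (a a' : Arg S c' k 0),
        ⟨c'.eqOf, k, M, B'.eqBdry hc' a a'⟩ ∈ R.prem →
        Alg T C E P Θ .sim Γ (B'.inst I) (a.inst I) (a'.inst I)) :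
      Alg T C E P Θ .normC Γ (.base B) e (R.rhs.inst I)
  -- normalization of principal arguments
  | normPSym {n : ℕ} {Γ : Ctx S n} {c : Cls} {B : Bdry S c n} {s : S.Sym} (hs : S.cls s = c)
      (d : SymRule S s c) (hd : T.HasSymRule hs d)
      (e e' : (i : Fin (S.nargs s)) → Arg S (S.argCls s i) (S.argBinds s i) n)
      (I : Inst S n) (hI : ∀ i, I (d.M i) = e i)
      (hp : ∀ i ∈ P.sym s, Alg T C E P Θ .norm Γ ((d.premBdry i).inst I) (e i) (e' i))
      (hn : ∀ i ∉ P.sym s, e i = e' i) :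
      Alg T C E P Θ .normP Γ (.base B) (.sym s hs e) (.sym s hs e')
  | normPMVar {n : ℕ} {Γ : Ctx S n} {c : Cls} {k : ℕ} {B : Bdry S c n} (hc : c.isObj = true)
      (M : MVar c k) (D : ABdry S c k 0) (hM : ⟨c, k, M, D⟩ ∈ Θ) (ts ts' : Fin k → Tm S n)
      (hp : ∀ j ∈ P.mvar M,
        Alg T C E P Θ .norm Γ (.base (.tm ((D.wk0 n).argTy ts j))) (ts j) (ts' j))
      (hn : ∀ j ∉ P.mvar M, ts j = ts' j) :
      Alg T C E P Θ .normP Γ (.base B) (.mvar hc M ts) (.mvar hc M ts')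
  -- normalization
  | normStep {n : ℕ} {Γ : Ctx S n} {c : Cls} {B : Bdry S c n} {e e' e'' e''' : Arg S c 0 n}
      (h : Alg T C E P Θ .normP Γ (.base B) e e') (h' : Alg T C E P Θ .normC Γ (.base B) e' e'')
      (h'' : Alg T C E P Θ .norm Γ (.base B) e'' e''') :
      Alg T C E P Θ .norm Γ (.base B) e e'''
  | normStop {n : ℕ} {Γ : Ctx S n} {c : Cls} {B : Bdry S c n} {e e' : Arg S c 0 n}
      (h : Alg T C E P Θ .normP Γ (.base B) e e')
      (hno : ∀ R ∈ C c, ¬ ∃ I : Inst S n, Matches Θ R.prem R.lhs e' I) :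
      Alg T C E P Θ .norm Γ (.base B) e e'
  | normAbs {n : ℕ} {Γ : Ctx S n} {A : Ty S n} {c : Cls} {k : ℕ} {B : ABdry S c k (n + 1)}
      {e e' : Arg S c k (n + 1)} (h : Alg T C E P Θ .norm (Γ.snoc A) B e e') :
      Alg T C E P Θ .norm Γ (.abs A B) (.abs e) (.abs e')
  | normVar {n : ℕ} {Γ : Ctx S n} (a : Fin n) (A : Ty S n) :
      Alg T C E P Θ .norm Γ (.base (.tm A)) (.var a) (.var a)
  | normDummyTy {n : ℕ} {Γ : Ctx S n} (B : Bdry S .eqTy n) :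
      Alg T C E P Θ .norm Γ (.base B) .dummyTy .dummyTy
  | normDummyTm {n : ℕ} {Γ : Ctx S n} (B : Bdry S .eqTm n) :
      Alg T C E P Θ .norm Γ (.base B) .dummyTm .dummyTm
  -- general comparison
  | simTm {n : ℕ} {Γ : Ctx S n} {A A' : Ty S n} {u v : Tm S n}
      (hA : Alg T C E P Θ .norm Γ (.base .ty) A A')
      (h : Alg T C E P Θ .simE Γ (.base (.tm A')) u v) :
      Alg T C E P Θ .sim Γ (.base (.tm A)) u v
  | simTy {n : ℕ} {Γ : Ctx S n} {A A' B B' : Ty S n}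
      (hA : Alg T C E P Θ .norm Γ (.base .ty) A A') (hB : Alg T C E P Θ .norm Γ (.base .ty) B B')
      (h : Alg T C E P Θ .simN Γ (.base .ty) A' B') :
      Alg T C E P Θ .sim Γ (.base .ty) A B
  | simAbs {n : ℕ} {Γ : Ctx S n} {A : Ty S n} {c : Cls} {k : ℕ} {B : ABdry S c k (n + 1)}
      {e e' : Arg S c k (n + 1)} (h : Alg T C E P Θ .sim (Γ.snoc A) B e e') :
      Alg T C E P Θ .sim Γ (.abs A B) (.abs e) (.abs e')
  -- type-directed comparison; here `I` is the instantiation of `Ξ` that matches the type, extended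
  -- by `s ↦ u` and `t ↦ v`
  | simExt {n : ℕ} {Γ : Ctx S n} {A : Ty S n} {u v : Tm S n} (R : ExtRule S) (hR : R ∈ E)
      (I : Inst S n) (hI : Matches Θ R.prem R.ty A I) (hu : I R.s = u) (hv : I R.t = v)
      (hprem : ∀ (c : Cls) (hc : c.isObj = true) (k : ℕ) (M : MVar c.eqOf k)
        (B : ABdry S c k 0) (a a' : Arg S c k 0), ⟨c.eqOf, k, M, B.eqBdry hc a a'⟩ ∈ R.prem →
        Alg T C E P Θ .sim Γ (B.inst I) (a.inst I) (a'.inst I))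
      (hpost : ∀ (c : Cls) (hc : c.isObj = true) (k : ℕ) (M : MVar c.eqOf k)
        (B : ABdry S c k 0) (a a' : Arg S c k 0), ⟨c.eqOf, k, M, B.eqBdry hc a a'⟩ ∈ R.post →
        Alg T C E P Θ .sim Γ (B.inst I) (a.inst I) (a'.inst I)) :
      Alg T C E P Θ .simE Γ (.base (.tm A)) u v
  | simENorm {n : ℕ} {Γ : Ctx S n} {A : Ty S n} {u u' v v' : Tm S n}
      (hno : ∀ R ∈ E, ¬ ∃ I : Inst S n, Matches Θ R.prem R.ty A I)
      (hu : Alg T C E P Θ .norm Γ (.base (.tm A)) u u')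
      (hv : Alg T C E P Θ .norm Γ (.base (.tm A)) v v')
      (h : Alg T C E P Θ .simN Γ (.base (.tm A)) u' v') :
      Alg T C E P Θ .simE Γ (.base (.tm A)) u v
  -- comparison of normalized expressions
  | simNVar {n : ℕ} {Γ : Ctx S n} (a : Fin n) (A : Ty S n) :
      Alg T C E P Θ .simN Γ (.base (.tm A)) (.var a) (.var a)
  | simNSym {n : ℕ} {Γ : Ctx S n} {c : Cls} {B : Bdry S c n} {s : S.Sym} (hs : S.cls s = c)
      (d : SymRule S s c) (hd : T.HasSymRule hs d)
      (e e' : (i : Fin (S.nargs s)) → Arg S (S.argCls s i) (S.argBinds s i) n)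
      (I : Inst S n) (hI : ∀ i, I (d.M i) = e i)
      (hp : ∀ i ∈ P.sym s, (S.argCls s i).isObj = true →
        Alg T C E P Θ .simN Γ ((d.premBdry i).inst I) (e i) (e' i))
      (hn : ∀ i ∉ P.sym s, (S.argCls s i).isObj = true →
        Alg T C E P Θ .sim Γ ((d.premBdry i).inst I) (e i) (e' i)) :
      Alg T C E P Θ .simN Γ (.base B) (.sym s hs e) (.sym s hs e')
  | simNMVar {n : ℕ} {Γ : Ctx S n} {c : Cls} {k : ℕ} {B : Bdry S c n} (hc : c.isObj = true)
      (M : MVar c k) (D : ABdry S c k 0) (hM : ⟨c, k, M, D⟩ ∈ Θ) (ts ts' : Fin k → Tm S n)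
      (hp : ∀ j ∈ P.mvar M,
        Alg T C E P Θ .simN Γ (.base (.tm ((D.wk0 n).argTy ts j))) (ts j) (ts' j))
      (hn : ∀ j ∉ P.mvar M,
        Alg T C E P Θ .sim Γ (.base (.tm ((D.wk0 n).argTy ts j))) (ts j) (ts' j)) :
      Alg T C E P Θ .simN Γ (.base B) (.mvar hc M ts) (.mvar hc M ts')
  | simNAbs {n : ℕ} {Γ : Ctx S n} {A : Ty S n} {c : Cls} {k : ℕ} {B : ABdry S c k (n + 1)}
      {e e' : Arg S c k (n + 1)} (h : Alg T C E P Θ .simN (Γ.snoc A) B e e') :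
      Alg T C E P Θ .simN Γ (.abs A B) (.abs e) (.abs e')

end FTT

namespace FTT

variable {S : Signature.{u}}

/-! ### Renaming and substitution -/

/-! The proof is a simultaneous induction over all relations of the algorithm: normalization turns a
well-typed expression into an equal one, and a comparison of two well-typed expressions yields their
equation.

Symbols are handled by inversion. In a standard theory a judgement about `S(e)` can only arise from
the rule for `S` followed by conversions, so the arguments are derivable at the instantiated
boundaries of the premises (`Der.sym_inv`). If the arguments are equal, the congruence rule gives
the equation. The boundary of an argument depends on the earlier arguments, which is why equal
instantiations have to act equally on derivable judgements (`Der.instEq`), derivability has to pass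
from an instantiation to an equal one (`InstEq.instDer`), and comparisons are used in the order of
the premises (`InstDer.instEq_of`).

The heart of the matter is the use of a computation or extensionality rule. Matching produces an
instantiation `I`; the rule applies only once `I` is derivable. Object-invertibility gives this over
the empty variable context, over metavariables disjoint from those of the rule, and relative to a
residue in which the equality premises are assumed as metavariables. The first two restrictions are
removed by a coding: variables become fresh metavariables, the metavariables of `Θ` are renamed, and
an opening instantiation undoes both. The residue is discharged inside derivations. Each use of an
equality metavariable by the metavariable rule comes with a derivation of the instantiated equation
boundary, so both sides of the equation are well typed at that place, and the induction hypothesis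
for the corresponding check supplies the equation (`Der.of_residue`,
`RawRule.ObjInvertible.instDer`). Thus no equality premise needs to be known to have a well-formed
boundary in advance.

This dictates the form of the induction hypothesis. Equality metavariables are used under binders
and at arbitrary arguments, whereas the check was run once, in the original context. Soundness is
therefore stated for all substitution instances in well-formed contexts and, for general comparison,
for all applications to terms (`SimAppSound`); the algorithm itself need not be stable under
substitution. -/

theorem liftRen_comp {l m n : ℕ} (ρ : Fin l → Fin m) (τ : Fin m → Fin n) (x : Fin (l + 1)) :
    liftRen τ (liftRen ρ x) = liftRen (fun y => τ (ρ y)) x := by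
  cases x using Fin.cases <;> rfl

theorem Arg.ren_ren {c : Cls} {k l m n : ℕ} (e : Arg S c k l) (ρ : Fin l → Fin m)
    (τ : Fin m → Fin n) : (e.ren ρ).ren τ = e.ren (fun x => τ (ρ x)) := by
  induction e generalizing m n with
  | var => rfl
  | sym s hs args ih => simp only [Arg.ren, ih]
  | mvar hc M ts ih => simp only [Arg.ren, ih]
  | dummyTy => rfl
  | dummyTm => rfl
  | abs e ih => simp only [Arg.ren, ih, liftRen_comp]

theorem Arg.ren_sub {c : Cls} {k l m n : ℕ} (e : Arg S c k l) (ρ : Fin l → Fin m)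
    (σ : Fin m → Tm S n) : (e.ren ρ).sub σ = e.sub (fun x => σ (ρ x)) := by
  induction e generalizing m n with
  | var => rfl
  | sym s hs args ih => simp only [Arg.ren, Arg.sub, ih]
  | mvar hc M ts ih => simp only [Arg.ren, Arg.sub, ih]
  | dummyTy => rfl
  | dummyTm => rfl
  | abs e ih =>
    simp only [Arg.ren, Arg.sub, ih]
    congr 2; funext x; cases x using Fin.cases <;> rfl

theorem Arg.wk_ren {c : Cls} {k l m : ℕ} (e : Arg S c k l) (ρ : Fin l → Fin m) :
    e.wk.ren (liftRen ρ) = (e.ren ρ).wk := by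
  simp only [Arg.wk, Arg.ren_ren]; rfl

theorem Arg.sub_ren {c : Cls} {k l m n : ℕ} (e : Arg S c k l) (σ : Fin l → Tm S m)
    (ρ : Fin m → Fin n) : (e.sub σ).ren ρ = e.sub (fun x => (σ x).ren ρ) := by
  induction e generalizing m n with
  | var => rfl
  | sym s hs args ih => simp only [Arg.ren, Arg.sub, ih]
  | mvar hc M ts ih => simp only [Arg.ren, Arg.sub, ih]
  | dummyTy => rfl
  | dummyTm => rfl
  | abs e ih =>
    simp only [Arg.ren, Arg.sub, ih]
    congr 2; funext x
    cases x using Fin.cases with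
    | zero => rfl
    | succ y => exact Arg.wk_ren _ _

/-- The binder case needs `liftSub` to commute with weakening, which follows from the two mixed laws
`Arg.ren_sub` and `Arg.sub_ren`; hence the order of the composition laws. -/
theorem Arg.sub_sub {c : Cls} {k l m n : ℕ} (e : Arg S c k l) (σ : Fin l → Tm S m)
    (τ : Fin m → Tm S n) : (e.sub σ).sub τ = e.sub (fun x => (σ x).sub τ) := by
  induction e generalizing m n with
  | var => rfl
  | sym s hs args ih => simp only [Arg.sub, ih]
  | mvar hc M ts ih => simp only [Arg.sub, ih]
  | dummyTy => rfl
  | dummyTm => rfl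
  | abs e ih =>
    simp only [Arg.sub, ih]
    congr 2; funext x
    cases x using Fin.cases with
    | zero => rfl
    | succ y =>
      change (σ y).wk.sub _ = ((σ y).sub τ).wk
      simp only [Arg.wk, Arg.ren_sub, Arg.sub_ren]; rfl

theorem liftSub_var {n : ℕ} : liftSub (Arg.var : Fin n → Tm S n) = Arg.var := by
  funext x; cases x using Fin.cases <;> rfl

theorem Arg.sub_var {c : Cls} {k l : ℕ} (e : Arg S c k l) : e.sub Arg.var = e := by
  induction e with
  | var => rfl
  | sym s hs args ih => simp only [Arg.sub, ih]
  | mvar hc M ts ih => simp only [Arg.sub, ih]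
  | dummyTy => rfl
  | dummyTm => rfl
  | abs e ih => simp only [Arg.sub, liftSub_var, ih]

theorem Arg.ren_eq_sub {c : Cls} {k l m : ℕ} (e : Arg S c k l) (ρ : Fin l → Fin m) :
    e.ren ρ = e.sub (fun x => .var (ρ x)) := by
  rw [← Arg.ren_sub e ρ Arg.var, Arg.sub_var]

theorem Arg.abs_body {c : Cls} {k n : ℕ} (e : Arg S c (k + 1) n) : e = .abs e.body := by
  cases e; rfl

theorem Arg.body_ren {c : Cls} {k l m : ℕ} (e : Arg S c (k + 1) l) (ρ : Fin l → Fin m) :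
    (e.ren ρ).body = e.body.ren (liftRen ρ) := by
  cases e; rfl

theorem Arg.body_sub {c : Cls} {k l m : ℕ} (e : Arg S c (k + 1) l) (σ : Fin l → Tm S m) :
    (e.sub σ).body = e.body.sub (liftSub σ) := by
  cases e; rfl

/-- The extension of a substitution by a term for the last variable. -/
def consSub {l n : ℕ} (t : Tm S n) (σ : Fin l → Tm S n) : Fin (l + 1) → Tm S n := Fin.cases t σ

theorem consSub_eta {l n : ℕ} (σ : Fin (l + 1) → Tm S n) :
    consSub (σ 0) (fun x => σ x.succ) = σ := by
  funext x; cases x using Fin.cases <;> rfl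

theorem Arg.wk_sub_consSub {c : Cls} {k l n : ℕ} (e : Arg S c k l) (t : Tm S n)
    (σ : Fin l → Tm S n) : e.wk.sub (consSub t σ) = e.sub σ := by
  simp only [Arg.wk, Arg.ren_sub]; rfl

theorem Arg.wk_sub_single {c : Cls} {k l : ℕ} (e : Arg S c k l) (t : Tm S l) :
    e.wk.sub (single t) = e :=
  (Arg.wk_sub_consSub e t Arg.var).trans e.sub_var

/-- Instantiating the bound variable after a substitution under the binder is one simultaneous
substitution. This lets inductions on the number of binders absorb the arguments one by one into a
general substitution. -/
theorem Arg.liftSub_sub_single {c : Cls} {k l n : ℕ} (e : Arg S c k (l + 1)) (t : Tm S n)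
    (σ : Fin l → Tm S n) : (e.sub (liftSub σ)).sub (single t) = e.sub (consSub t σ) := by
  rw [Arg.sub_sub]; congr 1; funext x
  cases x using Fin.cases with
  | zero => rfl
  | succ y => exact Arg.wk_sub_single _ _

theorem Arg.app_sub {c : Cls} {k l n : ℕ} (e : Arg S c k l) (ts : Fin k → Tm S l)
    (σ : Fin l → Tm S n) : (e.app ts).sub σ = (e.sub σ).app (fun j => (ts j).sub σ) := by
  induction k generalizing l n with
  | zero => rfl
  | succ k ih =>
    simp only [Arg.app, ih, Arg.body_sub, Arg.sub_sub]
    congr 2; funext x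
    cases x using Fin.cases with
    | zero => rfl
    | succ y => exact (Arg.wk_sub_single _ _).symm

theorem Arg.app_ren {c : Cls} {k l n : ℕ} (e : Arg S c k l) (ts : Fin k → Tm S l)
    (ρ : Fin l → Fin n) : (e.app ts).ren ρ = (e.ren ρ).app (fun j => (ts j).ren ρ) := by
  simp only [Arg.ren_eq_sub, Arg.app_sub]

/-! ### Instantiations -/

/-- Renaming of variables in an instantiation. -/
def Inst.ren {m n : ℕ} (I : Inst S m) (ρ : Fin m → Fin n) : Inst S n := fun _ _ M => (I M).ren ρ

/-- Substitution in an instantiation. -/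
def Inst.sub {m n : ℕ} (I : Inst S m) (σ : Fin m → Tm S n) : Inst S n := fun _ _ M => (I M).sub σ

/-- The action of an instantiation on an instantiation. -/
def Inst.act {m n : ℕ} (I : Inst S m) (K : Inst S n) (σ : Fin m → Tm S n) : Inst S n :=
  fun _ _ M => (I M).act K σ

/-- The identity instantiation. -/
def Inst.id {n : ℕ} : Inst S n := fun _ _ M => M.gen

theorem Inst.wk_sub_single {n : ℕ} (I : Inst S n) (t : Tm S n) : I.wk.sub (single t) = I := by
  funext c k M; exact Arg.wk_sub_single _ _

theorem Arg.act_ren {c : Cls} {k l m n : ℕ} (e : Arg S c k l) (I : Inst S m) (σ : Fin l → Tm S m)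
    (ρ : Fin m → Fin n) : (e.act I σ).ren ρ = e.act (I.ren ρ) (fun x => (σ x).ren ρ) := by
  induction e generalizing m n with
  | var => rfl
  | sym s hs args ih => simp only [Arg.ren, Arg.act, ih]
  | mvar hc M ts ih => simp only [Arg.act, Arg.app_ren, ih]; rfl
  | dummyTy => rfl
  | dummyTm => rfl
  | abs e ih =>
    simp only [Arg.ren, Arg.act, ih]
    congr 2
    · funext c k M; exact Arg.wk_ren _ _
    · funext x
      cases x using Fin.cases with
      | zero => rfl
      | succ y => exact Arg.wk_ren _ _

theorem Arg.ren_act {c : Cls} {k l m n : ℕ} (e : Arg S c k l) (ρ : Fin l → Fin m) (I : Inst S n)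
    (σ : Fin m → Tm S n) : (e.ren ρ).act I σ = e.act I (fun x => σ (ρ x)) := by
  induction e generalizing m n with
  | var => rfl
  | sym s hs args ih => simp only [Arg.ren, Arg.act, ih]
  | mvar hc M ts ih => simp only [Arg.ren, Arg.act, ih]
  | dummyTy => rfl
  | dummyTm => rfl
  | abs e ih =>
    simp only [Arg.ren, Arg.act, ih]
    congr 2; funext x; cases x using Fin.cases <;> rfl

theorem Arg.wk_act {c : Cls} {k l m : ℕ} (e : Arg S c k l) (I : Inst S m) (σ : Fin l → Tm S m) :
    e.wk.act I.wk (liftSub σ) = (e.act I σ).wk := by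
  simp only [Arg.wk, Arg.ren_act, Arg.act_ren]; rfl

theorem Arg.act_sub {c : Cls} {k l m n : ℕ} (e : Arg S c k l) (I : Inst S m) (σ : Fin l → Tm S m)
    (τ : Fin m → Tm S n) : (e.act I σ).sub τ = e.act (I.sub τ) (fun x => (σ x).sub τ) := by
  induction e generalizing m n with
  | var => rfl
  | sym s hs args ih => simp only [Arg.sub, Arg.act, ih]
  | mvar hc M ts ih => simp only [Arg.act, Arg.app_sub, ih]; rfl
  | dummyTy => rfl
  | dummyTm => rfl
  | abs e ih =>
    simp only [Arg.sub, Arg.act, ih]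
    have h : ∀ {c : Cls} {k : ℕ} (a : Arg S c k m), a.wk.sub (liftSub τ) = (a.sub τ).wk := by
      intro c k a; simp only [Arg.wk, Arg.ren_sub, Arg.sub_ren]; rfl
    congr 2
    · funext c k M; exact h _
    · funext x
      cases x using Fin.cases with
      | zero => rfl
      | succ y => exact h _

theorem Arg.sub_act {c : Cls} {k l m n : ℕ} (e : Arg S c k l) (τ : Fin l → Tm S m) (I : Inst S n)
    (σ : Fin m → Tm S n) : (e.sub τ).act I σ = e.act I (fun x => (τ x).act I σ) := by
  induction e generalizing m n with
  | var => rfl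
  | sym s hs args ih => simp only [Arg.sub, Arg.act, ih]
  | mvar hc M ts ih => simp only [Arg.sub, Arg.act, ih]
  | dummyTy => rfl
  | dummyTm => rfl
  | abs e ih =>
    simp only [Arg.sub, Arg.act, ih]
    congr 2; funext x
    cases x using Fin.cases with
    | zero => rfl
    | succ y => exact Arg.wk_act _ _ _

theorem Arg.liftAct_sub_single {c : Cls} {k l n : ℕ} (e : Arg S c k (l + 1)) (I : Inst S n)
    (t : Tm S n) (σ : Fin l → Tm S n) :
    (e.act I.wk (liftSub σ)).sub (single t) = e.act I (consSub t σ) := by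
  rw [Arg.act_sub, Inst.wk_sub_single]; congr 1; funext x
  cases x using Fin.cases with
  | zero => rfl
  | succ y => exact Arg.wk_sub_single _ _

theorem Arg.body_act {c : Cls} {k l m : ℕ} (e : Arg S c (k + 1) l) (I : Inst S m)
    (σ : Fin l → Tm S m) : (e.act I σ).body = e.body.act I.wk (liftSub σ) := by
  cases e; rfl

theorem Arg.app_act {c : Cls} {k l n : ℕ} (e : Arg S c k l) (ts : Fin k → Tm S l) (I : Inst S n)
    (σ : Fin l → Tm S n) : (e.app ts).act I σ = (e.act I σ).app (fun j => (ts j).act I σ) := by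
  induction k generalizing l n with
  | zero => rfl
  | succ k ih =>
    simp only [Arg.app, ih, Arg.body_act, Arg.liftAct_sub_single, Arg.sub_act]
    congr 2; funext x; cases x using Fin.cases <;> rfl

/-- Substitution and instantiation meet in the case of a metavariable: `K` acts on an applied
argument `(I M).app ts`, and `Arg.app_act` distributes it over the application. -/
theorem Arg.act_act {c : Cls} {k l m n : ℕ} (e : Arg S c k l) (I : Inst S m) (τ : Fin l → Tm S m)
    (K : Inst S n) (σ : Fin m → Tm S n) :
    (e.act I τ).act K σ = e.act (I.act K σ) (fun x => (τ x).act K σ) := by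
  induction e generalizing m n with
  | var => rfl
  | sym s hs args ih => simp only [Arg.act, ih]
  | mvar hc M ts ih => simp only [Arg.act, Arg.app_act, ih]; rfl
  | dummyTy => rfl
  | dummyTm => rfl
  | abs e ih =>
    simp only [Arg.act, ih]
    congr 2
    · funext c k M; exact Arg.wk_act _ _ _
    · funext x
      cases x using Fin.cases with
      | zero => rfl
      | succ y => exact Arg.wk_act _ _ _

/-! ### Generic applications -/

/-- Symbols and metavariable applications have object classes, so the dummy is the only expression
left in an equality class. Heads of equality judgements therefore never have to be tracked. -/
instance Arg.subsingleton_eqTy {k n : ℕ} : Subsingleton (Arg S .eqTy k n) := by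
  induction k generalizing n with
  | zero =>
    have h : ∀ e : Arg S .eqTy 0 n, e = .dummyTy := by
      intro e
      cases e with
      | sym s hs => have := S.cls_obj s; rw [hs] at this; cases this
      | mvar hc => cases hc
      | dummyTy => rfl
    exact ⟨fun a b => (h a).trans (h b).symm⟩
  | succ k ih => exact ⟨fun a b => by rw [a.abs_body, b.abs_body, Subsingleton.elim a.body]⟩

instance Arg.subsingleton_eqTm {k n : ℕ} : Subsingleton (Arg S .eqTm k n) := by
  induction k generalizing n with
  | zero =>
    have h : ∀ e : Arg S .eqTm 0 n, e = .dummyTm := by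
      intro e
      cases e with
      | sym s hs => have := S.cls_obj s; rw [hs] at this; cases this
      | mvar hc => cases hc
      | dummyTm => rfl
    exact ⟨fun a b => (h a).trans (h b).symm⟩
  | succ k ih => exact ⟨fun a b => by rw [a.abs_body, b.abs_body, Subsingleton.elim a.body]⟩

theorem Arg.eq_of_not_isObj {c : Cls} (hc : c.isObj = false) {k n : ℕ} (e e' : Arg S c k n) :
    e = e' := by
  cases c
  · cases hc
  · cases hc
  · exact Subsingleton.elim _ _
  · exact Subsingleton.elim _ _

theorem MVar.app_eq {c : Cls} (hc : c.isObj = true) {k n : ℕ} (M : MVar c k)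
    (ts : Fin k → Tm S n) : M.app ts = .mvar hc M ts := by
  cases c
  · rfl
  · rfl
  · cases hc
  · cases hc

theorem MVar.app_act {c : Cls} {k l n : ℕ} (M : MVar c k) (ts : Fin k → Tm S l) (K : Inst S n)
    (σ : Fin l → Tm S n) : (M.app ts).act K σ = (K M).app (fun j => (ts j).act K σ) := by
  cases hc : c.isObj
  · exact Arg.eq_of_not_isObj hc _ _
  · rw [MVar.app_eq hc]; rfl

/-- Simultaneous extension of a substitution under `k` binders. -/
def extSub {n : ℕ} : {l : ℕ} → (k : ℕ) → (Fin l → Tm S n) → (Fin k → Tm S n) →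
    Fin (scope l k) → Tm S n
  | _, 0, σ, _ => σ
  | _, k + 1, σ, ts => extSub k (consSub (ts 0) σ) (fun j => ts j.succ)

theorem extSub_wkVar {l n : ℕ} (k : ℕ) (σ : Fin l → Tm S n) (ts : Fin k → Tm S n) (x : Fin l) :
    extSub k σ ts (wkVar k x) = σ x := by
  induction k generalizing l with
  | zero => rfl
  | succ k ih => exact ih _ _ _

theorem extSub_boundVar {l n : ℕ} (k : ℕ) (σ : Fin l → Tm S n) (ts : Fin k → Tm S n) (i : Fin k) :
    extSub k σ ts (boundVar k i) = ts i := by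
  induction k generalizing l with
  | zero => exact i.elim0
  | succ k ih =>
    cases i using Fin.cases with
    | zero => exact extSub_wkVar _ _ _ _
    | succ j => exact ih _ _ _

theorem absN_sub_app {c : Cls} {l n : ℕ} (k : ℕ) (e : Arg S c 0 (scope l k))
    (σ : Fin l → Tm S n) (ts : Fin k → Tm S n) :
    ((absN k e).sub σ).app ts = e.sub (extSub k σ ts) := by
  induction k generalizing l with
  | zero => rfl
  | succ k ih =>
    simp only [absN, Arg.sub, Arg.app, Arg.body, Arg.liftSub_sub_single]
    exact ih _ _ _

theorem MVar.app_sub {c : Cls} {k l n : ℕ} (M : MVar c k) (ts : Fin k → Tm S l)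
    (σ : Fin l → Tm S n) : (M.app ts).sub σ = M.app (fun j => (ts j).sub σ) := by
  cases c <;> rfl

theorem MVar.gen_app {c : Cls} {k n : ℕ} (M : MVar c k) (ts : Fin k → Tm S n) :
    M.gen.app ts = M.app ts := by
  rw [← Arg.sub_var M.gen, MVar.gen, absN_sub_app, MVar.app_sub]
  congr 1; funext j; exact extSub_boundVar _ _ _ _

/-- The η-law for abstractions. It identifies the action on a generic application, which
re-abstracts an applied argument, with that argument. -/
theorem Arg.absN_app {c : Cls} {k n : ℕ} (e : Arg S c k n) :
    absN k ((e.ren (wkVar k)).app (fun i => .var (boundVar k i))) = e := by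
  induction k generalizing n with
  | zero =>
    simp only [absN, Arg.app, Arg.ren_eq_sub]; exact e.sub_var
  | succ k ih =>
    conv_rhs => rw [e.abs_body, ← ih e.body]
    simp only [absN, Arg.app, Arg.body_ren, Arg.ren_sub]
    congr 3
    rw [Arg.ren_eq_sub]
    congr 1; funext x; cases x using Fin.cases <;> rfl

/-- The extension of a substitution under `k` binders. -/
def liftSubN : {l n : ℕ} → (k : ℕ) → (Fin l → Tm S n) → Fin (scope l k) → Tm S (scope n k)
  | _, _, 0, σ => σ
  | _, _, k + 1, σ => liftSubN k (liftSub σ)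

theorem liftSubN_wkVar {l n : ℕ} (k : ℕ) (σ : Fin l → Tm S n) (x : Fin l) :
    liftSubN k σ (wkVar k x) = (σ x).ren (wkVar k) := by
  induction k generalizing l n with
  | zero => exact ((Arg.ren_eq_sub _ _).trans (Arg.sub_var _)).symm
  | succ k ih =>
    refine (ih _ _).trans ?_
    change ((σ x).ren Fin.succ).ren _ = _
    rw [Arg.ren_ren]; rfl

theorem liftSubN_boundVar {l n : ℕ} (k : ℕ) (σ : Fin l → Tm S n) (i : Fin k) :
    liftSubN k σ (boundVar k i) = .var (boundVar k i) := by
  induction k generalizing l n with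
  | zero => exact i.elim0
  | succ k ih =>
    cases i using Fin.cases with
    | zero => exact liftSubN_wkVar _ _ _
    | succ j => exact ih _ _

theorem absN_act {c : Cls} {l n : ℕ} (k : ℕ) (e : Arg S c 0 (scope l k)) (K : Inst S n)
    (σ : Fin l → Tm S n) :
    (absN k e).act K σ = absN k (e.act (K.ren (wkVar k)) (liftSubN k σ)) := by
  induction k generalizing l n with
  | zero =>
    have : K.ren (wkVar 0) = K := by
      funext c k M; exact (Arg.ren_eq_sub _ _).trans (Arg.sub_var _)
    rw [this]; rfl
  | succ k ih =>
    have h : K.wk.ren (wkVar k) = K.ren (wkVar (k + 1)) := by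
      funext c k M; exact Arg.ren_ren _ _ _
    refine (congrArg Arg.abs (ih (l := l + 1) e K.wk (liftSub σ))).trans ?_
    exact congrArg (fun I => Arg.abs (absN k (Arg.act (l := scope (l + 1) k) e I
      (liftSubN k (liftSub σ))))) h

/-- Together with `Arg.act_id` this makes generic applications the units of the action, and
`Inst.id` the neutral instantiation. -/
theorem MVar.gen_act {c : Cls} {k l n : ℕ} (M : MVar c k) (K : Inst S n) (σ : Fin l → Tm S n) :
    (M.gen : Arg S c k l).act K σ = K M := by
  rw [MVar.gen, absN_act, MVar.app_act]
  conv_rhs => rw [← Arg.absN_app (K M)]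
  congr 2
  funext i; exact liftSubN_boundVar _ _ _

theorem absN_sub {c : Cls} {l n : ℕ} (k : ℕ) (e : Arg S c 0 (scope l k)) (σ : Fin l → Tm S n) :
    (absN k e).sub σ = absN k (e.sub (liftSubN k σ)) := by
  induction k generalizing l n with
  | zero => rfl
  | succ k ih =>
    exact congrArg Arg.abs (ih (l := l + 1) e (liftSub σ))

theorem MVar.gen_sub {c : Cls} {k l n : ℕ} (M : MVar c k) (σ : Fin l → Tm S n) :
    (M.gen : Arg S c k l).sub σ = M.gen := by
  rw [MVar.gen, absN_sub, MVar.app_sub, MVar.gen]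
  congr 2; funext i; exact liftSubN_boundVar _ _ _

theorem MVar.gen_ren {c : Cls} {k l n : ℕ} (M : MVar c k) (ρ : Fin l → Fin n) :
    (M.gen : Arg S c k l).ren ρ = M.gen := by
  rw [Arg.ren_eq_sub, MVar.gen_sub]

theorem Inst.id_ren {l n : ℕ} (ρ : Fin l → Fin n) : (Inst.id : Inst S l).ren ρ = Inst.id := by
  funext c k M; exact M.gen_ren ρ

theorem Arg.act_id {c : Cls} {k l n : ℕ} (e : Arg S c k l) (σ : Fin l → Tm S n) :
    e.act Inst.id σ = e.sub σ := by
  induction e generalizing n with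
  | var => rfl
  | sym s hs args ih => simp only [Arg.sub, Arg.act, ih]
  | mvar hc M ts ih =>
    simp only [Arg.act, Arg.sub, Inst.id, MVar.gen_app, MVar.app_eq hc]
    congr 1; funext j; exact ih _ _
  | dummyTy => rfl
  | dummyTm => rfl
  | abs e ih =>
    simp only [Arg.sub, Arg.act]
    rw [← ih]
    congr 2
    exact Inst.id_ren _

/-- Instantiations are total assignments; their values away from the metavariables that occur must
be shown not to matter. -/
theorem Arg.act_congr_mv {c : Cls} {k l n : ℕ} (e : Arg S c k l) (I J : Inst S n)
    (σ : Fin l → Tm S n)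
    (h : ∀ ⦃c : Cls⦄ ⦃k : ℕ⦄ (M : MVar c k), ⟨c, k, M⟩ ∈ e.mv → I M = J M) :
    e.act I σ = e.act J σ := by
  induction e generalizing n with
  | var => rfl
  | sym s hs args ih =>
    simp only [Arg.act]
    congr 1; funext i
    exact ih i I J σ fun c k M hM => h M (Set.mem_iUnion.2 ⟨i, hM⟩)
  | mvar hc M ts ih =>
    simp only [Arg.act]
    rw [h M (Or.inl rfl)]
    congr 1; funext i
    exact ih i I J σ fun c k M hM => h M (Or.inr (Set.mem_iUnion.2 ⟨i, hM⟩))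
  | dummyTy => rfl
  | dummyTm => rfl
  | abs e ih =>
    simp only [Arg.act]
    rw [ih I.wk J.wk (liftSub σ) fun c k M hM => congrArg Arg.wk (h M hM)]

/-! ### Metavariables of expressions -/

theorem Arg.mv_ren {c : Cls} {k l n : ℕ} (e : Arg S c k l) (ρ : Fin l → Fin n) :
    (e.ren ρ).mv = e.mv := by
  induction e generalizing n with
  | var => rfl
  | sym s hs args ih => simp only [Arg.ren, Arg.mv, ih]
  | mvar hc M ts ih => simp only [Arg.ren, Arg.mv, ih]
  | dummyTy => rfl
  | dummyTm => rfl
  | abs e ih => exact ih _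

theorem Arg.mv_body {c : Cls} {k n : ℕ} (e : Arg S c (k + 1) n) : e.body.mv = e.mv := by
  cases e; rfl

theorem Arg.mv_sub_subset {c : Cls} {k l n : ℕ} (e : Arg S c k l) (σ : Fin l → Tm S n)
    {D : Set AnyMVar} (he : e.mv ⊆ D) (hσ : ∀ x, (σ x).mv ⊆ D) : (e.sub σ).mv ⊆ D := by
  induction e generalizing n with
  | var x => exact hσ x
  | sym s hs args ih =>
    exact Set.iUnion_subset fun i => ih i σ ((Set.subset_iUnion _ i).trans he) hσ
  | mvar hc M ts ih =>
    refine Set.union_subset (Set.subset_union_left.trans he) (Set.iUnion_subset fun i => ?_)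
    exact ih i σ ((Set.subset_iUnion (fun j => (ts j).mv) i).trans
      (Set.subset_union_right.trans he)) hσ
  | dummyTy => exact Set.empty_subset _
  | dummyTm => exact Set.empty_subset _
  | abs e ih =>
    refine ih (liftSub σ) he fun x => ?_
    cases x using Fin.cases with
    | zero => exact Set.empty_subset _
    | succ y => exact (Arg.mv_ren (σ y) _).subset.trans (hσ y)

theorem Arg.mv_app_subset {c : Cls} {k n : ℕ} (e : Arg S c k n) (ts : Fin k → Tm S n)
    {D : Set AnyMVar} (he : e.mv ⊆ D) (ht : ∀ j, (ts j).mv ⊆ D) : (e.app ts).mv ⊆ D := by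
  induction k with
  | zero => exact he
  | succ k ih =>
    refine ih _ _ (Arg.mv_sub_subset _ _ (e.mv_body.subset.trans he) fun x => ?_) fun j => ht _
    cases x using Fin.cases with
    | zero => exact ht 0
    | succ y => exact Set.empty_subset _

theorem Arg.mv_act_subset {c : Cls} {k l n : ℕ} (e : Arg S c k l) (I : Inst S n)
    (σ : Fin l → Tm S n) {D : Set AnyMVar}
    (hI : ∀ ⦃c : Cls⦄ ⦃k : ℕ⦄ (M : MVar c k), ⟨c, k, M⟩ ∈ e.mv → (I M).mv ⊆ D)
    (hσ : ∀ x, (σ x).mv ⊆ D) : (e.act I σ).mv ⊆ D := by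
  induction e generalizing n with
  | var x => exact hσ x
  | sym s hs args ih =>
    exact Set.iUnion_subset fun i =>
      ih i I σ (fun c k M hM => hI M (Set.mem_iUnion.2 ⟨i, hM⟩)) hσ
  | mvar hc M ts ih =>
    refine Arg.mv_app_subset _ _ (hI M (Or.inl rfl)) fun i => ?_
    exact ih i I σ (fun c k M hM => hI M (Or.inr (Set.mem_iUnion.2 ⟨i, hM⟩))) hσ
  | dummyTy => exact Set.empty_subset _
  | dummyTm => exact Set.empty_subset _
  | abs e ih =>
    refine ih I.wk (liftSub σ) (fun c k M hM => (Arg.mv_ren _ _).subset.trans (hI M hM))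
      fun x => ?_
    cases x using Fin.cases with
    | zero => exact Set.empty_subset _
    | succ y => exact (Arg.mv_ren (σ y) _).subset.trans (hσ y)

theorem mv_absN {c : Cls} {n : ℕ} (k : ℕ) (e : Arg S c 0 (scope n k)) : (absN k e).mv = e.mv := by
  induction k generalizing n with
  | zero => rfl
  | succ k ih => exact ih _

theorem MVar.mv_gen_subset {c : Cls} {k n : ℕ} (M : MVar c k) :
    (M.gen : Arg S c k n).mv ⊆ {⟨c, k, M⟩} := by
  rw [MVar.gen, mv_absN]
  cases c
  · exact Set.union_subset subset_rfl (Set.iUnion_subset fun i => Set.empty_subset _)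
  · exact Set.union_subset subset_rfl (Set.iUnion_subset fun i => Set.empty_subset _)
  · exact Set.empty_subset _
  · exact Set.empty_subset _

theorem Arg.mv_eq_empty {c : Cls} (hc : c.isObj = false) {k n : ℕ} (e : Arg S c k n) :
    e.mv = ∅ := by
  induction e with
  | var => cases hc
  | sym s hs => rw [← hs, S.cls_obj] at hc; cases hc
  | mvar hc' => rw [hc'] at hc; cases hc
  | dummyTy => rfl
  | dummyTm => rfl
  | abs e ih => exact ih hc

/-! ### Calculus of instantiations -/

theorem Inst.id_act {l n : ℕ} (K : Inst S n) (σ : Fin l → Tm S n) :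
    (Inst.id : Inst S l).act K σ = K := by
  funext c k M; exact M.gen_act K σ

theorem Inst.act_id {l n : ℕ} (K : Inst S l) (σ : Fin l → Tm S n) :
    K.act Inst.id σ = K.sub σ := by
  funext c k M; exact Arg.act_id _ _

theorem Arg.ren_eq_act {c : Cls} {k l m : ℕ} (e : Arg S c k l) (ρ : Fin l → Fin m) :
    e.ren ρ = e.act Inst.id (fun x => .var (ρ x)) := by
  rw [Arg.act_id, Arg.ren_eq_sub]

theorem Arg.act_id_var {c : Cls} {k l : ℕ} (e : Arg S c k l) : e.act Inst.id Arg.var = e :=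
  (Arg.act_id _ _).trans e.sub_var

theorem Inst.ren_eq_act {l n : ℕ} (K : Inst S l) (ρ : Fin l → Fin n) :
    K.ren ρ = K.act Inst.id (fun x => .var (ρ x)) := by
  funext c k M; exact Arg.ren_eq_act _ _

theorem Inst.act_act {l m n : ℕ} (I : Inst S l) (J : Inst S m) (τ : Fin l → Tm S m)
    (K : Inst S n) (σ : Fin m → Tm S n) :
    (I.act J τ).act K σ = I.act (J.act K σ) (fun x => (τ x).act K σ) := by
  funext c k M; exact Arg.act_act _ _ _ _ _

theorem Inst.act_ren {l m n : ℕ} (I : Inst S l) (J : Inst S m) (τ : Fin l → Tm S m)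
    (ρ : Fin m → Fin n) :
    (I.act J τ).ren ρ = I.act (J.ren ρ) (fun x => (τ x).ren ρ) := by
  funext c k M; exact Arg.act_ren _ _ _ _

theorem Inst.ren_ren {l m n : ℕ} (I : Inst S l) (ρ : Fin l → Fin m) (τ : Fin m → Fin n) :
    (I.ren ρ).ren τ = I.ren (fun x => τ (ρ x)) := by
  funext c k M; exact Arg.ren_ren _ _ _

theorem Inst.ren_id {n : ℕ} (I : Inst S n) : I.ren (fun x => x) = I := by
  funext c k M; exact (Arg.ren_eq_sub _ _).trans (Arg.sub_var _)

theorem Inst.wk_act {l n : ℕ} (I : Inst S l) (K : Inst S n) (σ : Fin l → Tm S n) :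
    I.wk.act K.wk (liftSub σ) = (I.act K σ).wk := by
  funext c k M; exact Arg.wk_act _ _ _

theorem liftSub_act {l m n : ℕ} (τ : Fin l → Tm S m) (K : Inst S n) (σ : Fin m → Tm S n) :
    (fun x => (liftSub τ x).act K.wk (liftSub σ)) = liftSub (fun x => (τ x).act K σ) := by
  funext x
  cases x using Fin.cases with
  | zero => rfl
  | succ y => exact Arg.wk_act _ _ _

theorem Inst.id_wk {n : ℕ} : (Inst.id : Inst S n).wk = Inst.id := Inst.id_ren _

theorem liftSub_var_comp {l n : ℕ} (ρ : Fin l → Fin n) :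
    liftSub (fun x => (.var (ρ x) : Tm S n)) = fun x => .var (liftRen ρ x) := by
  funext x; cases x using Fin.cases <;> rfl

theorem elim0_eq {α : Type*} (f g : Fin 0 → α) : f = g := funext fun i => i.elim0

/-! ### Boundaries and judgements -/

theorem Bdry.ren_eq_act {c : Cls} {l m : ℕ} (B : Bdry S c l) (ρ : Fin l → Fin m) :
    B.ren ρ = B.act Inst.id (fun x => .var (ρ x)) := by
  cases B <;> simp only [Bdry.ren, Bdry.act, Arg.ren_eq_act]

theorem Bdry.sub_eq_act {c : Cls} {l m : ℕ} (B : Bdry S c l) (σ : Fin l → Tm S m) :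
    B.sub σ = B.act Inst.id σ := by
  cases B <;> simp only [Bdry.sub, Bdry.act, Arg.act_id]

theorem Bdry.act_act {c : Cls} {l m n : ℕ} (B : Bdry S c l) (I : Inst S m) (τ : Fin l → Tm S m)
    (K : Inst S n) (σ : Fin m → Tm S n) :
    (B.act I τ).act K σ = B.act (I.act K σ) (fun x => (τ x).act K σ) := by
  cases B <;> simp only [Bdry.act, Arg.act_act]

theorem Bdry.act_id_var {c : Cls} {n : ℕ} (B : Bdry S c n) : B.act Inst.id Arg.var = B := by
  cases B <;> simp only [Bdry.act, Arg.act_id_var]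

theorem ABdry.ren_eq_act {c : Cls} {k l m : ℕ} (B : ABdry S c k l) (ρ : Fin l → Fin m) :
    B.ren ρ = B.act Inst.id (fun x => .var (ρ x)) := by
  induction B generalizing m with
  | base B => simp only [ABdry.ren, ABdry.act, Bdry.ren_eq_act]
  | abs A B ih =>
    simp only [ABdry.ren, ABdry.act, Arg.ren_eq_act, ih, Inst.id_wk, liftSub_var_comp]

theorem ABdry.sub_eq_act {c : Cls} {k l m : ℕ} (B : ABdry S c k l) (σ : Fin l → Tm S m) :
    B.sub σ = B.act Inst.id σ := by
  induction B generalizing m with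
  | base B => simp only [ABdry.sub, ABdry.act, Bdry.sub_eq_act]
  | abs A B ih => simp only [ABdry.sub, ABdry.act, Arg.act_id, ih, Inst.id_wk]

theorem ABdry.act_act {c : Cls} {k l m n : ℕ} (B : ABdry S c k l) (I : Inst S m)
    (τ : Fin l → Tm S m) (K : Inst S n) (σ : Fin m → Tm S n) :
    (B.act I τ).act K σ = B.act (I.act K σ) (fun x => (τ x).act K σ) := by
  induction B generalizing m n with
  | base B => simp only [ABdry.act, Bdry.act_act]
  | abs A B ih => simp only [ABdry.act, Arg.act_act, ih, Inst.wk_act, liftSub_act]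

theorem ABdry.act_id_var {c : Cls} {k n : ℕ} (B : ABdry S c k n) :
    B.act Inst.id Arg.var = B := by
  induction B with
  | base B => simp only [ABdry.act, Bdry.act_id_var]
  | abs A B ih => simp only [ABdry.act, Arg.act_id_var, Inst.id_wk, liftSub_var, ih]

theorem Arg.inst_act {c : Cls} {k m n : ℕ} (e : Arg S c k 0) (I : Inst S m) (K : Inst S n)
    (σ : Fin m → Tm S n) : (e.inst I).act K σ = e.inst (I.act K σ) := by
  rw [Arg.inst, Arg.act_act]; exact congrArg _ (elim0_eq _ _)

theorem Bdry.inst_act {c : Cls} {m n : ℕ} (B : Bdry S c 0) (I : Inst S m) (K : Inst S n)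
    (σ : Fin m → Tm S n) : (B.inst I).act K σ = B.inst (I.act K σ) := by
  rw [Bdry.inst, Bdry.act_act]; exact congrArg _ (elim0_eq _ _)

theorem ABdry.inst_act {c : Cls} {k m n : ℕ} (B : ABdry S c k 0) (I : Inst S m) (K : Inst S n)
    (σ : Fin m → Tm S n) : (B.inst I).act K σ = B.inst (I.act K σ) := by
  rw [ABdry.inst, ABdry.act_act]; exact congrArg _ (elim0_eq _ _)

theorem ABdry.inst_id {c : Cls} {k : ℕ} (B : ABdry S c k 0) : B.inst Inst.id = B := by
  rw [ABdry.inst, elim0_eq (fun i => i.elim0) Arg.var, ABdry.act_id_var]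

theorem ABdry.wk0_eq_inst {c : Cls} {k n : ℕ} (B : ABdry S c k 0) :
    B.wk0 n = B.inst Inst.id := by
  rw [ABdry.wk0, ABdry.ren_eq_act]; exact congrArg _ (elim0_eq _ _)

theorem ABdry.wk0_act {c : Cls} {k m n : ℕ} (B : ABdry S c k 0) (K : Inst S n)
    (σ : Fin m → Tm S n) : (B.wk0 m).act K σ = B.inst K := by
  rw [ABdry.wk0_eq_inst, ABdry.inst_act, Inst.id_act]

/-- Substitution of `t` for the last variable after the action under a binder. -/
theorem ABdry.liftAct_sub_single {c : Cls} {k l n : ℕ} (B : ABdry S c k (l + 1)) (I : Inst S n)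
    (t : Tm S n) (σ : Fin l → Tm S n) :
    (B.act I.wk (liftSub σ)).sub (single t) = B.act I (consSub t σ) := by
  rw [ABdry.sub_eq_act, ABdry.act_act, Inst.act_id, Inst.wk_sub_single]
  congr 1; funext x
  rw [Arg.act_id]
  cases x using Fin.cases with
  | zero => rfl
  | succ y => exact Arg.wk_sub_single _ _

theorem ABdry.sub_single_act {c : Cls} {k l n : ℕ} (B : ABdry S c k (l + 1)) (t : Tm S l)
    (K : Inst S n) (σ : Fin l → Tm S n) :
    (B.sub (single t)).act K σ = B.act K (consSub (t.act K σ) σ) := by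
  rw [ABdry.sub_eq_act, ABdry.act_act, Inst.id_act]
  congr 1; funext x; cases x using Fin.cases <;> rfl

theorem ABdry.app_act {c : Cls} {k l n : ℕ} (B : ABdry S c k l) (ts : Fin k → Tm S l)
    (K : Inst S n) (σ : Fin l → Tm S n) :
    (B.app ts).act K σ = (B.act K σ).app (fun j => (ts j).act K σ) := by
  induction k generalizing l n with
  | zero => cases B; rfl
  | succ k ih =>
    cases B
    simp only [ABdry.app, ABdry.act, ih, ABdry.liftAct_sub_single, ABdry.sub_single_act]

theorem ABdry.argTy_act {c : Cls} {k l n : ℕ} (B : ABdry S c k l) (ts : Fin k → Tm S l)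
    (K : Inst S n) (σ : Fin l → Tm S n) (j : Fin k) :
    (B.argTy ts j).act K σ = (B.act K σ).argTy (fun j => (ts j).act K σ) j := by
  induction k generalizing l n with
  | zero => exact j.elim0
  | succ k ih =>
    cases B
    cases j using Fin.cases with
    | zero => rfl
    | succ j =>
      simp only [ABdry.argTy, ABdry.act, ABdry.liftAct_sub_single, Fin.cases_succ, ih,
        ABdry.sub_single_act]

theorem Bdry.objTy_act {c : Cls} {l n : ℕ} (B : Bdry S c l) (K : Inst S n) (σ : Fin l → Tm S n) :
    (B.act K σ).objTy = B.objTy.map (fun A => A.act K σ) := by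
  cases B <;> rfl

/-- The action of an instantiation on a judgement thesis. -/
def Jdg.act {l n : ℕ} : Jdg S l → Inst S n → (Fin l → Tm S n) → Jdg S n
  | .isTy A, I, σ => .isTy (A.act I σ)
  | .hasTy t A, I, σ => .hasTy (t.act I σ) (A.act I σ)
  | .eqTy A B, I, σ => .eqTy (A.act I σ) (B.act I σ)
  | .eqTm s t A, I, σ => .eqTm (s.act I σ) (t.act I σ) (A.act I σ)

/-- The action of an instantiation on an abstracted judgement. -/
def AJdg.act : {l : ℕ} → AJdg S l → {n : ℕ} → Inst S n → (Fin l → Tm S n) → AJdg S n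
  | _, .base J, _, I, σ => .base (J.act I σ)
  | _, .abs A J, _, I, σ => .abs (A.act I σ) (J.act I.wk (liftSub σ))

/-- The action of an instantiation on an abstracted judgement or boundary. -/
def Stmt.act {l n : ℕ} : Stmt S l → Inst S n → (Fin l → Tm S n) → Stmt S n
  | .jdg J, I, σ => .jdg (J.act I σ)
  | .bdry B, I, σ => .bdry (B.act I σ)

theorem Bdry.plug_act {c : Cls} {l n : ℕ} (B : Bdry S c l) (e : Arg S c 0 l) (K : Inst S n)
    (σ : Fin l → Tm S n) : (B.plug e).act K σ = (B.act K σ).plug (e.act K σ) := by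
  cases B <;> rfl

theorem ABdry.plug_act {c : Cls} {k l n : ℕ} (B : ABdry S c k l) (e : Arg S c k l) (K : Inst S n)
    (σ : Fin l → Tm S n) : (B.plug e).act K σ = (B.act K σ).plug (e.act K σ) := by
  induction B generalizing n with
  | base B => simp only [ABdry.plug, AJdg.act, ABdry.act, Bdry.plug_act]
  | abs A B ih => simp only [ABdry.plug, AJdg.act, ABdry.act, ih, Arg.body_act]

theorem Bdry.plugEq_act {c : Cls} (hc : c.isObj = true) {l n : ℕ} (B : Bdry S c l)
    (e e' : Arg S c 0 l) (K : Inst S n) (σ : Fin l → Tm S n) :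
    (B.plugEq hc e e').act K σ = (B.act K σ).plugEq hc (e.act K σ) (e'.act K σ) := by
  cases B
  · rfl
  · rfl
  · cases hc
  · cases hc

theorem ABdry.plugEq_act {c : Cls} (hc : c.isObj = true) {k l n : ℕ} (B : ABdry S c k l)
    (e e' : Arg S c k l) (K : Inst S n) (σ : Fin l → Tm S n) :
    (B.plugEq hc e e').act K σ = (B.act K σ).plugEq hc (e.act K σ) (e'.act K σ) := by
  induction B generalizing n with
  | base B => simp only [ABdry.plugEq, AJdg.act, ABdry.act, Bdry.plugEq_act]
  | abs A B ih => simp only [ABdry.plugEq, AJdg.act, ABdry.act, ih, Arg.body_act]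

theorem Bdry.eqBdry_act {c : Cls} (hc : c.isObj = true) {l n : ℕ} (B : Bdry S c l)
    (e e' : Arg S c 0 l) (K : Inst S n) (σ : Fin l → Tm S n) :
    (B.eqBdry hc e e').act K σ = (B.act K σ).eqBdry hc (e.act K σ) (e'.act K σ) := by
  cases B
  · rfl
  · rfl
  · cases hc
  · cases hc

theorem ABdry.eqBdry_act {c : Cls} (hc : c.isObj = true) {k l n : ℕ} (B : ABdry S c k l)
    (e e' : Arg S c k l) (K : Inst S n) (σ : Fin l → Tm S n) :
    (B.eqBdry hc e e').act K σ = (B.act K σ).eqBdry hc (e.act K σ) (e'.act K σ) := by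
  induction B generalizing n with
  | base B => simp only [ABdry.eqBdry, ABdry.act, Bdry.eqBdry_act]
  | abs A B ih => simp only [ABdry.eqBdry, ABdry.act, ih, Arg.body_act]

theorem RawRule.concl_act (R : RawRule S) {m n : ℕ} (I : Inst S m) (K : Inst S n)
    (σ : Fin m → Tm S n) : (R.concl I).act K σ = R.concl (I.act K σ) := by
  simp only [RawRule.concl, AJdg.act, Bdry.plug_act, Bdry.inst_act, Arg.inst_act]

theorem ABdry.eqBdry_app {c : Cls} (hc : c.isObj = true) {k n : ℕ} (B : ABdry S c k n)
    (e e' : Arg S c k n) (ts : Fin k → Tm S n) :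
    (B.eqBdry hc e e').app ts = (B.app ts).eqBdry hc (e.app ts) (e'.app ts) := by
  induction k generalizing n with
  | zero => cases B; rfl
  | succ k ih =>
    cases B with
    | abs A B =>
      simp only [ABdry.eqBdry, ABdry.app, Arg.app]
      rw [← ih, ABdry.sub_eq_act, ABdry.eqBdry_act, ← ABdry.sub_eq_act, Arg.act_id, Arg.act_id]

/-! ### Admissibility of actions -/

/-- The action of an instantiation on derivations, for actions that belong to a class `R` which is
stable under binders and sends variables and metavariables to derivable entities. -/
theorem Der.act_of {T : RawTT.{u, v} S} {Θ Θ' : MCtx S}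
    (R : ∀ {l n : ℕ}, Ctx S l → Ctx S n → Inst S n → (Fin l → Tm S n) → Prop)
    (hlift : ∀ {l n : ℕ} {Γ : Ctx S l} {Δ : Ctx S n} {K : Inst S n} {σ : Fin l → Tm S n}
      {A : Ty S l}, R Γ Δ K σ → Der T Θ' Δ (.jdg (.base (.isTy (A.act K σ)))) →
      R (Γ.snoc A) (Δ.snoc (A.act K σ)) K.wk (liftSub σ))
    (hvar : ∀ {l n : ℕ} {Γ : Ctx S l} {Δ : Ctx S n} {K : Inst S n} {σ : Fin l → Tm S n},
      R Γ Δ K σ → ∀ a, Der T Θ' Δ (.jdg (.base (.hasTy (σ a) ((Γ.get a).act K σ)))))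
    (hmvar : ∀ {l n : ℕ} {Γ : Ctx S l} {Δ : Ctx S n} {K : Inst S n} {σ : Fin l → Tm S n},
      R Γ Δ K σ → ∀ d ∈ Θ, ∀ ts : Fin d.k → Tm S n,
      (∀ j, Der T Θ' Δ (.jdg (.base (.hasTy (ts j) ((d.bdry.inst K).argTy ts j))))) →
      Der T Θ' Δ (.bdry (.base ((d.bdry.inst K).app ts))) →
      Der T Θ' Δ (.jdg (.base (((d.bdry.inst K).app ts).plug ((K d.mvar).app ts)))))
    (hcongr : ∀ {l n : ℕ} {Γ : Ctx S l} {Δ : Ctx S n} {K : Inst S n} {σ : Fin l → Tm S n},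
      R Γ Δ K σ → ∀ d ∈ Θ, ∀ (hd : d.c.isObj = true) (ss ts : Fin d.k → Tm S n),
      (∀ j, Der T Θ' Δ (.jdg (.base (.hasTy (ss j) ((d.bdry.inst K).argTy ss j))))) →
      (∀ j, Der T Θ' Δ (.jdg (.base (.hasTy (ts j) ((d.bdry.inst K).argTy ts j))))) →
      (∀ j, Der T Θ' Δ (.jdg (.base (.eqTm (ss j) (ts j) ((d.bdry.inst K).argTy ss j))))) →
      (∀ C C' : Ty S n, ((d.bdry.inst K).app ss).objTy = some C →
        ((d.bdry.inst K).app ts).objTy = some C' → Der T Θ' Δ (.jdg (.base (.eqTy C C')))) →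
      Der T Θ' Δ (.jdg (.base (((d.bdry.inst K).app ss).plugEq hd
        ((K d.mvar).app ss) ((K d.mvar).app ts)))))
    {l : ℕ} {Γ : Ctx S l} {X : Stmt S l} (h : Der T Θ Γ X) {n : ℕ} {Δ : Ctx S n} {K : Inst S n}
    {σ : Fin l → Tm S n} (hR : R Γ Δ K σ) : Der T Θ' Δ (X.act K σ) := by
  -- One induction serves for renaming, for renaming of metavariables combined with substitution,
  -- for instantiation and for the opening of a residue. They differ only in what is known about
  -- variables and metavariables; the target context varies because binders extend it.
  induction h generalizing n with
  | var a => exact hvar hR a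
  | mvar hM ts ht hB ih ihB =>
    have h1 := ihB hR
    simp only [Stmt.act, ABdry.act, ABdry.app_act, ABdry.wk0_act] at h1
    have h2 := fun j => ih j hR
    simp only [Stmt.act, AJdg.act, Jdg.act, ABdry.argTy_act, ABdry.wk0_act] at h2
    simp only [Stmt.act, AJdg.act, Bdry.plug_act, ABdry.app_act, ABdry.wk0_act, MVar.app_act]
    exact hmvar hR _ hM _ h2 h1
  | mvarCongr hM hc ss ts hs ht he hC ihs iht ihe ihC =>
    have h1 := fun j => ihs j hR
    have h2 := fun j => iht j hR
    have h3 := fun j => ihe j hR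
    simp only [Stmt.act, AJdg.act, Jdg.act, ABdry.argTy_act, ABdry.wk0_act] at h1 h2 h3
    simp only [Stmt.act, AJdg.act, Bdry.plugEq_act, ABdry.app_act, ABdry.wk0_act, MVar.app_act]
    refine hcongr hR _ hM hc _ _ h1 h2 h3 fun C C' hC1 hC2 => ?_
    rw [← ABdry.wk0_act _ K σ, ← ABdry.app_act, Bdry.objTy_act, Option.map_eq_some_iff] at hC1 hC2
    obtain ⟨C, hC1, rfl⟩ := hC1
    obtain ⟨C', hC2, rfl⟩ := hC2
    exact ihC C C' hC1 hC2 hR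
  | abs hA hJ ihA ihJ => exact .abs (ihA hR) (ihJ (hlift hR (ihA hR)))
  | tyRefl h ih => exact .tyRefl (ih hR)
  | tySym h ih => exact .tySym (ih hR)
  | tyTran h h' ih ih' => exact .tyTran (ih hR) (ih' hR)
  | tmRefl h ih => exact .tmRefl (ih hR)
  | tmSym h ih => exact .tmSym (ih hR)
  | tmTran h h' ih ih' => exact .tmTran (ih hR) (ih' hR)
  | convTm h h' ih ih' => exact .convTm (ih hR) (ih' hR)
  | convEq h h' ih ih' => exact .convEq (ih hR) (ih' hR)
  | bdryTy => exact .bdryTy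
  | bdryTm hA ih => exact .bdryTm (ih hR)
  | bdryEqTy hA hB ih ih' => exact .bdryEqTy (ih hR) (ih' hR)
  | bdryEqTm hA hs ht ih ih' ih'' => exact .bdryEqTm (ih hR) (ih' hR) (ih'' hR)
  | bdryAbs hA hB ihA ihB => exact .bdryAbs (ihA hR) (ihB (hlift hR (ihA hR)))
  -- A specific rule contains no variables, so acting on its instance at `I` gives its instance at
  -- the composite `I.act K σ`; nothing about the class `R` is needed.
  | rule r I hI hB ih ihB =>
    have h1 := fun d hd => ih d hd hR
    have h2 := ihB hR
    simp only [Stmt.act, ABdry.plug_act, ABdry.inst_act] at h1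
    simp only [Stmt.act, ABdry.act, Bdry.inst_act] at h2
    simp only [Stmt.act, RawRule.concl_act]
    exact .rule r (I.act K σ) h1 h2
  | congr r hr I J hI hJ he hC ihI ihJ ihe ihC =>
    have h1 := fun d hd => ihI d hd hR
    have h2 := fun d hd => ihJ d hd hR
    have h3 := fun d hd hd' => ihe d hd hd' hR
    have h4 := fun C hC => ihC C hC hR
    simp only [Stmt.act, ABdry.plug_act, ABdry.plugEq_act, ABdry.inst_act] at h1 h2 h3
    simp only [Stmt.act, AJdg.act, Jdg.act, Arg.inst_act] at h4
    simp only [Stmt.act, AJdg.act, Bdry.plugEq_act, Bdry.inst_act, Arg.inst_act]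
    exact .congr r hr _ _ h1 h2 h3 h4

theorem Stmt.act_id_var {n : ℕ} (X : Stmt S n) : X.act Inst.id Arg.var = X := by
  have hJ : ∀ {n : ℕ} (J : AJdg S n), J.act Inst.id Arg.var = J := by
    intro n J
    induction J with
    | base J => cases J <;> simp only [AJdg.act, Jdg.act, Arg.act_id_var]
    | abs A J ih => simp only [AJdg.act, Arg.act_id_var, Inst.id_wk, liftSub_var, ih]
  cases X with
  | jdg J => simp only [Stmt.act, hJ]
  | bdry B => simp only [Stmt.act, ABdry.act_id_var]

theorem Arg.wk_act_consSub {c : Cls} {k l n : ℕ} (e : Arg S c k l) (I : Inst S n) (t : Tm S n)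
    (σ : Fin l → Tm S n) : e.wk.act I (consSub t σ) = e.act I σ :=
  Arg.ren_act _ _ _ _

/-! ### Renaming and substitution in derivations -/

/-- `ρ` is a renaming of the variables of `Γ` by variables of `Δ` of the same types. -/
def RenTyped {l n : ℕ} (Γ : Ctx S l) (Δ : Ctx S n) (ρ : Fin l → Fin n) : Prop :=
  ∀ a, Δ.get (ρ a) = (Γ.get a).ren ρ

theorem RenTyped.id {n : ℕ} (Γ : Ctx S n) : RenTyped Γ Γ (fun x => x) := fun _ =>
  ((Arg.ren_eq_sub _ _).trans (Arg.sub_var _)).symm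

theorem RenTyped.succ {l n : ℕ} {Γ : Ctx S l} {Δ : Ctx S n} {ρ : Fin l → Fin n}
    (h : RenTyped Γ Δ ρ) (A : Ty S n) : RenTyped Γ (Δ.snoc A) (fun x => (ρ x).succ) := fun a => by
  change (Δ.get (ρ a)).wk = _
  rw [h a, Arg.wk, Arg.ren_ren]

theorem RenTyped.lift {l n : ℕ} {Γ : Ctx S l} {Δ : Ctx S n} {ρ : Fin l → Fin n}
    (h : RenTyped Γ Δ ρ) (A : Ty S l) :
    RenTyped (Γ.snoc A) (Δ.snoc (A.ren ρ)) (liftRen ρ) := fun a => by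
  cases a using Fin.cases with
  | zero => exact (Arg.wk_ren _ _).symm
  | succ y =>
    change (Δ.get (ρ y)).wk = (Γ.get y).wk.ren _
    rw [h y, Arg.wk_ren]

theorem Der.mvar_id {T : RawTT.{u, v} S} {Θ : MCtx S} {n : ℕ} {Δ : Ctx S n} {d : Decl S}
    (hd : d ∈ Θ) {ts : Fin d.k → Tm S n}
    (ht : ∀ j, Der T Θ Δ (.jdg (.base (.hasTy (ts j) ((d.bdry.inst Inst.id).argTy ts j)))))
    (hB : Der T Θ Δ (.bdry (.base ((d.bdry.inst Inst.id).app ts)))) :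
    Der T Θ Δ (.jdg (.base (((d.bdry.inst Inst.id).app ts).plug (d.mvar.app ts)))) := by
  simp only [← ABdry.wk0_eq_inst] at ht hB ⊢
  exact .mvar hd ts ht hB

theorem Der.mvarCongr_id {T : RawTT.{u, v} S} {Θ : MCtx S} {n : ℕ} {Δ : Ctx S n} {d : Decl S}
    (hd : d ∈ Θ) (hc : d.c.isObj = true) {ss ts : Fin d.k → Tm S n}
    (hs : ∀ j, Der T Θ Δ (.jdg (.base (.hasTy (ss j) ((d.bdry.inst Inst.id).argTy ss j)))))
    (ht : ∀ j, Der T Θ Δ (.jdg (.base (.hasTy (ts j) ((d.bdry.inst Inst.id).argTy ts j)))))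
    (he : ∀ j, Der T Θ Δ
      (.jdg (.base (.eqTm (ss j) (ts j) ((d.bdry.inst Inst.id).argTy ss j)))))
    (hC : ∀ C C' : Ty S n, ((d.bdry.inst Inst.id).app ss).objTy = some C →
      ((d.bdry.inst Inst.id).app ts).objTy = some C' → Der T Θ Δ (.jdg (.base (.eqTy C C')))) :
    Der T Θ Δ (.jdg (.base (((d.bdry.inst Inst.id).app ss).plugEq hc
      (d.mvar.app ss) (d.mvar.app ts)))) := by
  simp only [← ABdry.wk0_eq_inst] at hs ht he hC ⊢
  exact .mvarCongr hd hc ss ts hs ht he hC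

/-- Renaming has to precede substitution: carrying a substitution under a binder weakens its terms,
and their typing derivations with them. -/
theorem Der.ren {T : RawTT.{u, v} S} {Θ : MCtx S} {l n : ℕ} {Γ : Ctx S l} {Δ : Ctx S n}
    {ρ : Fin l → Fin n} {X : Stmt S l} (h : Der T Θ Γ X) (hρ : RenTyped Γ Δ ρ) :
    Der T Θ Δ (X.act Inst.id (fun x => .var (ρ x))) := by
  refine Der.act_of (Θ' := Θ) (fun {l n} Γ Δ K σ => K = Inst.id ∧
    ∃ ρ : Fin l → Fin n, RenTyped Γ Δ ρ ∧ σ = fun x => .var (ρ x)) ?_ ?_ ?_ ?_ h ⟨rfl, ρ, hρ, rfl⟩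
  · rintro l n Γ Δ _ _ A ⟨rfl, ρ, hρ, rfl⟩ -
    refine ⟨Inst.id_wk, liftRen ρ, ?_, liftSub_var_comp ρ⟩
    rw [← Arg.ren_eq_act]; exact hρ.lift A
  · rintro l n Γ Δ _ _ ⟨rfl, ρ, hρ, rfl⟩ a
    rw [← Arg.ren_eq_act, ← hρ a]
    exact .var _
  · rintro l n Γ Δ _ _ ⟨rfl, ρ, hρ, rfl⟩ d hd ts ht hB
    rw [Inst.id, MVar.gen_app]
    exact Der.mvar_id hd ht hB
  · rintro l n Γ Δ _ _ ⟨rfl, ρ, hρ, rfl⟩ d hd hc ss ts hs ht he hC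
    rw [Inst.id, MVar.gen_app, MVar.gen_app]
    exact Der.mvarCongr_id hd hc hs ht he hC

theorem Der.wk {T : RawTT.{u, v} S} {Θ : MCtx S} {n : ℕ} {Γ : Ctx S n} {X : Stmt S n}
    (h : Der T Θ Γ X) (A : Ty S n) :
    Der T Θ (Γ.snoc A) (X.act Inst.id (fun x => .var x.succ)) :=
  h.ren ((RenTyped.id Γ).succ A)

/-- `σ` sends the variables of `Γ` to terms over `Θ; Δ` of the types prescribed by `Γ`, on which
`K` acts. -/
def SubTyped (T : RawTT.{u, v} S) (Θ : MCtx S) {l n : ℕ} (Γ : Ctx S l) (Δ : Ctx S n)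
    (K : Inst S n) (σ : Fin l → Tm S n) : Prop :=
  ∀ a, Der T Θ Δ (.jdg (.base (.hasTy (σ a) ((Γ.get a).act K σ))))

section

variable {T : RawTT.{u, v} S} {Θ Θ' Ξ : MCtx S} {l n : ℕ} {Γ : Ctx S l} {Δ : Ctx S n}

theorem Der.wk_hasTy {t : Tm S n} {A : Ty S n} (h : Der T Θ Δ (.jdg (.base (.hasTy t A))))
    (B : Ty S n) : Der T Θ (Δ.snoc B) (.jdg (.base (.hasTy t.wk A.wk))) := by
  have := h.wk B
  simp only [Stmt.act, AJdg.act, Jdg.act, ← Arg.ren_eq_act] at this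
  exact this

theorem Der.wk_eqTm {s t : Tm S n} {A : Ty S n} (h : Der T Θ Δ (.jdg (.base (.eqTm s t A))))
    (B : Ty S n) : Der T Θ (Δ.snoc B) (.jdg (.base (.eqTm s.wk t.wk A.wk))) := by
  have := h.wk B
  simp only [Stmt.act, AJdg.act, Jdg.act, ← Arg.ren_eq_act] at this
  exact this

theorem Der.wk_eqTy {A A' : Ty S n} (h : Der T Θ Δ (.jdg (.base (.eqTy A A'))))
    (B : Ty S n) : Der T Θ (Δ.snoc B) (.jdg (.base (.eqTy A.wk A'.wk))) := by
  have := h.wk B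
  simp only [Stmt.act, AJdg.act, Jdg.act, ← Arg.ren_eq_act] at this
  exact this

/-- The new variable may be declared with a type `B` other than the image of `A`, provided that it
can be converted to it. This is needed when two actions send `A` to types that are equal but not
identical. -/
theorem SubTyped.lift_of {K : Inst S n} {σ : Fin l → Tm S n} (h : SubTyped T Θ Γ Δ K σ)
    {A : Ty S l} {B : Ty S n}
    (hB : Der T Θ (Δ.snoc B) (.jdg (.base (.hasTy (.var 0) (A.act K σ).wk)))) :
    SubTyped T Θ (Γ.snoc A) (Δ.snoc B) K.wk (liftSub σ) := fun a => by
  cases a using Fin.cases with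
  | zero =>
    change Der T Θ _ (.jdg (.base (.hasTy (.var 0) (A.wk.act K.wk (liftSub σ)))))
    rw [Arg.wk_act]; exact hB
  | succ y =>
    change Der T Θ _ (.jdg (.base (.hasTy (σ y).wk ((Γ.get y).wk.act K.wk (liftSub σ)))))
    rw [Arg.wk_act]; exact (h y).wk_hasTy _

theorem SubTyped.lift {K : Inst S n} {σ : Fin l → Tm S n} (h : SubTyped T Θ Γ Δ K σ)
    (A : Ty S l) : SubTyped T Θ (Γ.snoc A) (Δ.snoc (A.act K σ)) K.wk (liftSub σ) :=
  h.lift_of (.var 0)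

theorem SubTyped.cons {K : Inst S n} {σ : Fin l → Tm S n} (h : SubTyped T Θ Γ Δ K σ)
    {A : Ty S l} {t : Tm S n} (ht : Der T Θ Δ (.jdg (.base (.hasTy t (A.act K σ))))) :
    SubTyped T Θ (Γ.snoc A) Δ K (consSub t σ) := fun a => by
  cases a using Fin.cases with
  | zero =>
    change Der T Θ _ (.jdg (.base (.hasTy t (A.wk.act K (consSub t σ)))))
    rw [Arg.wk_act_consSub]; exact ht
  | succ y =>
    change Der T Θ _ (.jdg (.base (.hasTy (σ y) ((Γ.get y).wk.act K (consSub t σ)))))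
    rw [Arg.wk_act_consSub]; exact h y

theorem SubTyped.id : SubTyped T Θ Δ Δ Inst.id Arg.var := fun a => by
  rw [Arg.act_id_var]; exact .var a

theorem SubTyped.nil {K : Inst S n} (σ : Fin 0 → Tm S n) : SubTyped T Θ .nil Δ K σ :=
  fun a => a.elim0

/-- The instantiation that renames metavariables. -/
def renInst (r : ⦃c : Cls⦄ → ⦃k : ℕ⦄ → MVar c k → MVar c k) {n : ℕ} : Inst S n :=
  fun _ _ M => (r M).gen

theorem renInst_ren (r : ⦃c : Cls⦄ → ⦃k : ℕ⦄ → MVar c k → MVar c k) {m n : ℕ} (ρ : Fin m → Fin n) :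
    (renInst r : Inst S m).ren ρ = renInst r := by
  funext c k M; exact MVar.gen_ren _ _

theorem renInst_wk (r : ⦃c : Cls⦄ → ⦃k : ℕ⦄ → MVar c k → MVar c k) {n : ℕ} :
    (renInst r : Inst S n).wk = renInst r := renInst_ren _ _

/-- Renaming of metavariables in a declaration. -/
def Decl.rename (r : ⦃c : Cls⦄ → ⦃k : ℕ⦄ → MVar c k → MVar c k) (d : Decl S) : Decl S :=
  ⟨d.c, d.k, r d.mvar, d.bdry.inst (renInst r)⟩

theorem renInst_act (r : ⦃c : Cls⦄ → ⦃k : ℕ⦄ → MVar c k → MVar c k) {l n : ℕ} (K : Inst S n)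
    (σ : Fin l → Tm S n) : (renInst r : Inst S l).act K σ = fun _ _ M => K (r M) := by
  funext c k M; exact MVar.gen_act _ _ _

theorem Decl.rename_inst_id (r : ⦃c : Cls⦄ → ⦃k : ℕ⦄ → MVar c k → MVar c k) (d : Decl S) {n : ℕ} :
    ((d.rename r).bdry.inst Inst.id : ABdry S d.c d.k n) = d.bdry.inst (renInst r) :=
  (ABdry.inst_act _ _ _ _).trans (congrArg _ (renInst_act r _ _))

/-- Renaming of metavariables together with substitution. -/
theorem Der.rename {X : Stmt S l} (h : Der T Θ Γ X)
    {r : ⦃c : Cls⦄ → ⦃k : ℕ⦄ → MVar c k → MVar c k} (hr : ∀ d ∈ Θ, d.rename r ∈ Θ')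
    {σ : Fin l → Tm S n} (hσ : SubTyped T Θ' Γ Δ (renInst r) σ) :
    Der T Θ' Δ (X.act (renInst r) σ) := by
  refine Der.act_of (Θ' := Θ') (fun {l n} Γ Δ K σ => K = renInst r ∧ SubTyped T Θ' Γ Δ K σ)
    ?_ ?_ ?_ ?_ h ⟨rfl, hσ⟩
  · rintro l n Γ Δ _ σ A ⟨rfl, hσ⟩ -
    exact ⟨renInst_wk r, hσ.lift A⟩
  · rintro l n Γ Δ _ σ ⟨rfl, hσ⟩ a
    exact hσ a
  · rintro l n Γ Δ _ σ ⟨rfl, hσ⟩ d hd ts ht hB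
    rw [renInst, MVar.gen_app]
    rw [← Decl.rename_inst_id] at ht hB ⊢
    exact Der.mvar_id (hr d hd) ht hB
  · rintro l n Γ Δ _ σ ⟨rfl, hσ⟩ d hd hc ss ts hs ht he hC
    rw [renInst, MVar.gen_app, MVar.gen_app]
    rw [← Decl.rename_inst_id] at hs ht he hC ⊢
    exact Der.mvarCongr_id (hr d hd) hc hs ht he hC

theorem Der.sub {X : Stmt S l} (h : Der T Θ Γ X) {σ : Fin l → Tm S n}
    (hσ : SubTyped T Θ Γ Δ Inst.id σ) : Der T Θ Δ (X.act Inst.id σ) := by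
  refine Der.rename (r := fun _ _ M => M) h (fun d hd => ?_) hσ
  have : d.rename (fun _ _ M => M) = d := by
    unfold Decl.rename
    have h : d.bdry.inst (renInst fun _ _ M => M) = d.bdry := ABdry.inst_id _
    rw [h]
  rw [this]; exact hd

theorem Der.mono {X : Stmt S n} (h : Der T Θ Δ X) (hΘ : Θ ⊆ Θ') : Der T Θ' Δ X := by
  have := Der.rename (r := fun _ _ M => M) (Θ' := Θ') (Δ := Δ) h (fun d hd => by
    have : d.rename (fun _ _ M => M) = d := by
      unfold Decl.rename
      have h : d.bdry.inst (renInst fun _ _ M => M) = d.bdry := ABdry.inst_id _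
      rw [h]
    rw [this]; exact hΘ hd) (σ := Arg.var) SubTyped.id
  rw [← X.act_id_var]; exact this

/-! ### Elimination of abstractions by application to terms. -/

theorem Der.abs_inv {A : Ty S n} {J : AJdg S (n + 1)} (h : Der T Θ Δ (.jdg (.abs A J))) :
    Der T Θ Δ (.jdg (.base (.isTy A))) ∧ Der T Θ (Δ.snoc A) (.jdg J) := by
  cases h with
  | abs hA hJ => exact ⟨hA, hJ⟩

theorem Der.bdryAbs_inv {c : Cls} {k : ℕ} {A : Ty S n} {B : ABdry S c k (n + 1)}
    (h : Der T Θ Δ (.bdry (.abs A B))) :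
    Der T Θ Δ (.jdg (.base (.isTy A))) ∧ Der T Θ (Δ.snoc A) (.bdry B) := by
  cases h with
  | bdryAbs hA hB => exact ⟨hA, hB⟩

/-- Terms `ts` of the types required by the abstractions of `B`. -/
def ArgsTyped (T : RawTT.{u, v} S) (Θ : MCtx S) {n : ℕ} (Δ : Ctx S n) {c : Cls} {k : ℕ}
    (B : ABdry S c k n) (ts us : Fin k → Tm S n) : Prop :=
  ∀ j, Der T Θ Δ (.jdg (.base (.hasTy (us j) (B.argTy ts j))))

/-- Terms that are equal at the types required by the abstractions of `B`. -/
def ArgsEq (T : RawTT.{u, v} S) (Θ : MCtx S) {n : ℕ} (Δ : Ctx S n) {c : Cls} {k : ℕ}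
    (B : ABdry S c k n) (ts us : Fin k → Tm S n) : Prop :=
  ∀ j, Der T Θ Δ (.jdg (.base (.eqTm (ts j) (us j) (B.argTy ts j))))

theorem argsTyped_abs {c : Cls} {k : ℕ} {A : Ty S l} {B : ABdry S c k (l + 1)} {K : Inst S n}
    {σ : Fin l → Tm S n} {ts us : Fin (k + 1) → Tm S n} :
    ArgsTyped T Θ Δ ((ABdry.abs A B).act K σ) ts us ↔
      Der T Θ Δ (.jdg (.base (.hasTy (us 0) (A.act K σ)))) ∧
      ArgsTyped T Θ Δ (B.act K (consSub (ts 0) σ)) (fun j => ts j.succ) (fun j => us j.succ) := by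
  rw [ArgsTyped, Fin.forall_fin_succ]
  simp only [ABdry.act, ABdry.argTy, Fin.cases_zero, Fin.cases_succ, ABdry.liftAct_sub_single]
  rfl

theorem argsEq_abs {c : Cls} {k : ℕ} {A : Ty S l} {B : ABdry S c k (l + 1)} {K : Inst S n}
    {σ : Fin l → Tm S n} {ts us : Fin (k + 1) → Tm S n} :
    ArgsEq T Θ Δ ((ABdry.abs A B).act K σ) ts us ↔
      Der T Θ Δ (.jdg (.base (.eqTm (ts 0) (us 0) (A.act K σ)))) ∧
      ArgsEq T Θ Δ (B.act K (consSub (ts 0) σ)) (fun j => ts j.succ) (fun j => us j.succ) := by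
  rw [ArgsEq, Fin.forall_fin_succ]
  simp only [ABdry.act, ABdry.argTy, Fin.cases_zero, Fin.cases_succ, ABdry.liftAct_sub_single]
  rfl

theorem ABdry.abs_app {c : Cls} {k : ℕ} (A : Ty S l) (B : ABdry S c k (l + 1)) (K : Inst S n)
    (σ : Fin l → Tm S n) (ts : Fin (k + 1) → Tm S n) :
    ((ABdry.abs A B).act K σ).app ts = (B.act K (consSub (ts 0) σ)).app (fun j => ts j.succ) := by
  simp only [ABdry.act, ABdry.app, ABdry.liftAct_sub_single]

theorem Arg.succ_app {c : Cls} {k : ℕ} (e : Arg S c (k + 1) l) (K : Inst S n)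
    (σ : Fin l → Tm S n) (ts : Fin (k + 1) → Tm S n) :
    (e.act K σ).app ts = (e.body.act K (consSub (ts 0) σ)).app (fun j => ts j.succ) := by
  simp only [Arg.app, Arg.body_act, Arg.liftAct_sub_single]

/-- The substitution is there for the induction: each step removes the outermost binder and adds the
first term to `σ`. The statement of interest is the one for the identity substitution. -/
theorem Der.plug_app_sub {c : Cls} {k : ℕ} {B : ABdry S c k l} {e : Arg S c k l}
    (h : Der T Θ Γ (.jdg (B.plug e))) {σ : Fin l → Tm S n} (hσ : SubTyped T Θ Γ Δ Inst.id σ)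
    {ts : Fin k → Tm S n} (ht : ArgsTyped T Θ Δ (B.act Inst.id σ) ts ts) :
    Der T Θ Δ (.jdg (.base (((B.act Inst.id σ).app ts).plug ((e.act Inst.id σ).app ts)))) := by
  induction B with
  | base B =>
    have := h.sub hσ
    simp only [Stmt.act, ABdry.plug_act] at this
    exact this
  | abs A B ih =>
    rw [ABdry.abs_app, Arg.succ_app]
    rw [argsTyped_abs] at ht
    exact ih (Der.abs_inv h).2 (hσ.cons ht.1) ht.2

theorem Der.bdry_app_sub {c : Cls} {k : ℕ} {B : ABdry S c k l}
    (h : Der T Θ Γ (.bdry B)) {σ : Fin l → Tm S n} (hσ : SubTyped T Θ Γ Δ Inst.id σ)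
    {ts : Fin k → Tm S n} (ht : ArgsTyped T Θ Δ (B.act Inst.id σ) ts ts) :
    Der T Θ Δ (.bdry (.base ((B.act Inst.id σ).app ts))) := by
  induction B with
  | base B => exact h.sub hσ
  | abs A B ih =>
    rw [ABdry.abs_app]
    rw [argsTyped_abs] at ht
    exact ih (Der.bdryAbs_inv h).2 (hσ.cons ht.1) ht.2

theorem Der.plug_app {c : Cls} {k : ℕ} {B : ABdry S c k n} {e : Arg S c k n}
    (h : Der T Θ Δ (.jdg (B.plug e))) {ts : Fin k → Tm S n} (ht : ArgsTyped T Θ Δ B ts ts) :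
    Der T Θ Δ (.jdg (.base ((B.app ts).plug (e.app ts)))) := by
  have := Der.plug_app_sub h SubTyped.id (ts := ts) (by rw [ABdry.act_id_var]; exact ht)
  rw [ABdry.act_id_var, Arg.act_id_var] at this
  exact this

theorem Der.bdry_app {c : Cls} {k : ℕ} {B : ABdry S c k n} (h : Der T Θ Δ (.bdry B))
    {ts : Fin k → Tm S n} (ht : ArgsTyped T Θ Δ B ts ts) :
    Der T Θ Δ (.bdry (.base (B.app ts))) := by
  have := Der.bdry_app_sub h SubTyped.id (ts := ts) (by rw [ABdry.act_id_var]; exact ht)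
  rw [ABdry.act_id_var] at this
  exact this

/-! ### Equations as filled equation boundaries. -/

theorem Bdry.eqBdry_plug {c : Cls} (hc : c.isObj = true) (B : Bdry S c n) (e e' : Arg S c 0 n)
    (a : Arg S c.eqOf 0 n) : (B.eqBdry hc e e').plug a = B.plugEq hc e e' := by
  cases B
  · rfl
  · rfl
  · cases hc
  · cases hc

theorem ABdry.eqBdry_plug {c : Cls} (hc : c.isObj = true) {k : ℕ} (B : ABdry S c k n)
    (e e' : Arg S c k n) (a : Arg S c.eqOf k n) :
    (B.eqBdry hc e e').plug a = B.plugEq hc e e' := by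
  induction B with
  | base B => simp only [ABdry.eqBdry, ABdry.plug, ABdry.plugEq, Bdry.eqBdry_plug]
  | abs A B ih => simp only [ABdry.eqBdry, ABdry.plug, ABdry.plugEq, ih]

theorem ABdry.eqBdry_argTy {c : Cls} (hc : c.isObj = true) {k : ℕ} (B : ABdry S c k n)
    (e e' : Arg S c k n) (ts : Fin k → Tm S n) :
    (B.eqBdry hc e e').argTy ts = B.argTy ts := by
  induction k generalizing n with
  | zero => exact elim0_eq _ _
  | succ k ih =>
    cases B with
    | abs A B =>
      simp only [ABdry.eqBdry, ABdry.argTy, ABdry.sub_eq_act, ABdry.eqBdry_act, ih]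

theorem Der.plugEq_app {c : Cls} (hc : c.isObj = true) {k : ℕ} {B : ABdry S c k n}
    {e e' : Arg S c k n} (h : Der T Θ Δ (.jdg (B.plugEq hc e e'))) {ts : Fin k → Tm S n}
    (ht : ArgsTyped T Θ Δ B ts ts) :
    Der T Θ Δ (.jdg (.base ((B.app ts).plugEq hc (e.app ts) (e'.app ts)))) := by
  -- An equation is its equation boundary filled with any head whatsoever. With some head at hand
  -- the claim becomes an instance of `Der.plug_app`.
  have a : Arg S c.eqOf k n := by
    have : ∀ (k n : ℕ), Nonempty (Arg S c.eqOf k n) := by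
      intro k
      induction k with
      | zero => exact fun n => ⟨(dummyOf c).ren (fun i => i.elim0)⟩
      | succ k ih => exact fun n => (ih (n + 1)).map .abs
    exact (this k n).some
  rw [← ABdry.eqBdry_plug hc _ _ _ a] at h
  have := h.plug_app (ts := ts) (fun j => by rw [ABdry.eqBdry_argTy]; exact ht j)
  rwa [ABdry.eqBdry_app, Bdry.eqBdry_plug] at this

end

/-! ### Equal actions -/

/-- The actions of `(K, σ)` and `(K', σ')` on an abstracted object judgement are equal. -/
def AJdg.EqDer (T : RawTT.{u, v} S) (Θ : MCtx S) : {l : ℕ} → AJdg S l → {n : ℕ} → Ctx S n →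
    Inst S n → (Fin l → Tm S n) → Inst S n → (Fin l → Tm S n) → Prop
  | _, .base (.isTy A), _, Δ, K, σ, K', σ' =>
      Der T Θ Δ (.jdg (.base (.eqTy (A.act K σ) (A.act K' σ'))))
  | _, .base (.hasTy t A), _, Δ, K, σ, K', σ' =>
      Der T Θ Δ (.jdg (.base (.eqTm (t.act K σ) (t.act K' σ') (A.act K σ))))
  | _, .base (.eqTy _ _), _, _, _, _, _, _ => True
  | _, .base (.eqTm _ _ _), _, _, _, _, _, _ => True
  | _, .abs A J, _, Δ, K, σ, K', σ' => Der T Θ Δ (.jdg (.base (.isTy (A.act K σ)))) ∧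
      J.EqDer T Θ (Δ.snoc (A.act K σ)) K.wk (liftSub σ) K'.wk (liftSub σ')

/-- The types of object boundaries `B` and `B'` are equal. -/
def BdryEq (T : RawTT.{u, v} S) (Θ : MCtx S) {n : ℕ} (Δ : Ctx S n) {c : Cls} (B B' : Bdry S c n) :
    Prop :=
  ∀ A A' : Ty S n, B.objTy = some A → B'.objTy = some A' →
    Der T Θ Δ (.jdg (.base (.eqTy A A')))

/-- The actions of `(K, σ)` and `(K', σ')` on an abstracted object judgement or on an object
boundary thesis are equal. -/
def Stmt.EqDer (T : RawTT.{u, v} S) (Θ : MCtx S) {l : ℕ} : Stmt S l → {n : ℕ} → Ctx S n →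
    Inst S n → (Fin l → Tm S n) → Inst S n → (Fin l → Tm S n) → Prop
  | .jdg J, _, Δ, K, σ, K', σ' => J.EqDer T Θ Δ K σ K' σ'
  | .bdry (.base B), _, Δ, K, σ, K', σ' => BdryEq T Θ Δ (B.act K σ) (B.act K' σ')
  | .bdry (.abs _ _), _, _, _, _, _, _ => True

theorem AJdg.EqDer.plugEq {T : RawTT.{u, v} S} {Θ : MCtx S} {c : Cls} (hc : c.isObj = true)
    {k l n : ℕ} {B : ABdry S c k l} {e : Arg S c k l} {Δ : Ctx S n} {K K' : Inst S n}
    {σ σ' : Fin l → Tm S n} (h : (B.plug e).EqDer T Θ Δ K σ K' σ') :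
    Der T Θ Δ (.jdg ((B.act K σ).plugEq hc (e.act K σ) (e.act K' σ'))) := by
  induction B generalizing n with
  | base B =>
    cases B
    · exact h
    · exact h
    · cases hc
    · cases hc
  | abs A B ih =>
    simp only [ABdry.act, ABdry.plugEq, Arg.body_act]
    exact .abs h.1 (ih hc h.2)

theorem AJdg.EqDer.of_bdry {T : RawTT.{u, v} S} {Θ : MCtx S} {c : Cls}
    {l n : ℕ} {B : Bdry S c l} {e : Arg S c 0 l} {Δ : Ctx S n} {K K' : Inst S n}
    {σ σ' : Fin l → Tm S n} (h : ∀ hc : c.isObj = true, Der T Θ Δ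
      (.jdg (.base ((B.act K σ).plugEq hc (e.act K σ) (e.act K' σ'))))) :
    (AJdg.base (B.plug e)).EqDer T Θ Δ K σ K' σ' := by
  cases B
  · exact h rfl
  · exact h rfl
  · trivial
  · trivial

theorem AJdg.eqDer_plugEq {T : RawTT.{u, v} S} {Θ : MCtx S} {c : Cls} (hc : c.isObj = true)
    {l n : ℕ} (B : Bdry S c l) (e e' : Arg S c 0 l) (Δ : Ctx S n) (K K' : Inst S n)
    (σ σ' : Fin l → Tm S n) : (AJdg.base (B.plugEq hc e e')).EqDer T Θ Δ K σ K' σ' := by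
  cases B
  · trivial
  · trivial
  · cases hc
  · cases hc

/-- Equality of actions on derivable object judgements, for pairs of actions that belong to a
class `R` which is stable under binders and treats variables and metavariables in this way. -/
theorem Der.actEq_of {T : RawTT.{u, v} S} {Θ Θ' : MCtx S}
    (R : ∀ {l n : ℕ}, Ctx S l → Ctx S n → Inst S n → (Fin l → Tm S n) → Inst S n →
      (Fin l → Tm S n) → Prop)
    (hleft : ∀ {l n : ℕ} {Γ : Ctx S l} {Δ : Ctx S n} {K K' : Inst S n} {σ σ' : Fin l → Tm S n},
      R Γ Δ K σ K' σ' → ∀ X, Der T Θ Γ X → Der T Θ' Δ (X.act K σ))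
    (hright : ∀ {l n : ℕ} {Γ : Ctx S l} {Δ : Ctx S n} {K K' : Inst S n} {σ σ' : Fin l → Tm S n},
      R Γ Δ K σ K' σ' → ∀ X, Der T Θ Γ X → Der T Θ' Δ (X.act K' σ'))
    (hlift : ∀ {l n : ℕ} {Γ : Ctx S l} {Δ : Ctx S n} {K K' : Inst S n} {σ σ' : Fin l → Tm S n}
      {A : Ty S l}, R Γ Δ K σ K' σ' →
      Der T Θ' Δ (.jdg (.base (.eqTy (A.act K σ) (A.act K' σ')))) →
      R (Γ.snoc A) (Δ.snoc (A.act K σ)) K.wk (liftSub σ) K'.wk (liftSub σ'))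
    (hvar : ∀ {l n : ℕ} {Γ : Ctx S l} {Δ : Ctx S n} {K K' : Inst S n} {σ σ' : Fin l → Tm S n},
      R Γ Δ K σ K' σ' → ∀ a,
      Der T Θ' Δ (.jdg (.base (.eqTm (σ a) (σ' a) ((Γ.get a).act K σ)))))
    (hmvar : ∀ {l n : ℕ} {Γ : Ctx S l} {Δ : Ctx S n} {K K' : Inst S n} {σ σ' : Fin l → Tm S n},
      R Γ Δ K σ K' σ' → ∀ d ∈ Θ, ∀ (hd : d.c.isObj = true) (ss ts : Fin d.k → Tm S n),
      ArgsTyped T Θ' Δ (d.bdry.inst K) ss ss → ArgsTyped T Θ' Δ (d.bdry.inst K') ts ts →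
      ArgsEq T Θ' Δ (d.bdry.inst K) ss ts →
      BdryEq T Θ' Δ ((d.bdry.inst K).app ss) ((d.bdry.inst K').app ts) →
      Der T Θ' Δ (.jdg (.base (((d.bdry.inst K).app ss).plugEq hd
        ((K d.mvar).app ss) ((K' d.mvar).app ts)))))
    {l : ℕ} {Γ : Ctx S l} {X : Stmt S l} (h : Der T Θ Γ X) {n : ℕ} {Δ : Ctx S n} {K K' : Inst S n}
    {σ σ' : Fin l → Tm S n} (hR : R Γ Δ K σ K' σ') : X.EqDer T Θ' Δ K σ K' σ' := by
  -- Only object judgements and the types of object boundaries carry a claim. The two separate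
  -- actions on the premises come from `hleft` and `hright`, not from the induction.
  induction h generalizing n with
  | var a => exact hvar hR a
  | mvar hM ts ht hB ih ihB =>
    refine AJdg.EqDer.of_bdry fun hc => ?_
    have h1 := fun j => hleft hR _ (ht j)
    have h2 := fun j => hright hR _ (ht j)
    have h3 := fun j => ih j hR
    have h4 := ihB hR
    simp only [Stmt.act, AJdg.act, Jdg.act, Stmt.EqDer, AJdg.EqDer, ABdry.argTy_act,
      ABdry.wk0_act, ABdry.app_act] at h1 h2 h3 h4
    simp only [ABdry.app_act, ABdry.wk0_act, MVar.app_act]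
    exact hmvar hR _ hM hc _ _ h1 h2 h3 h4
  | mvarCongr hM hc ss ts hs ht he hC ihs iht ihe ihC => exact AJdg.eqDer_plugEq _ _ _ _ _ _ _ _ _
  | abs hA hJ ihA ihJ => exact ⟨hleft hR _ hA, ihJ (hlift hR (ihA hR))⟩
  | tyRefl h ih => trivial
  | tySym h ih => trivial
  | tyTran h h' ih ih' => trivial
  | tmRefl h ih => trivial
  | tmSym h ih => trivial
  | tmTran h h' ih ih' => trivial
  -- The induction hypothesis is an equation at the old type; the left action on the type equation
  -- moves it to the new one.
  | convTm h h' ih ih' => exact .convEq (ih hR) (hleft hR _ h')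
  | convEq h h' ih ih' => trivial
  | bdryTy => intro A A' hA; cases hA
  | bdryTm hA ih =>
    rintro _ _ h h'
    cases h; cases h'
    exact ih hR
  | bdryEqTy hA hB ih ih' => intro A A' hA; cases hA
  | bdryEqTm hA hs ht ih ih' ih'' => intro A A' hA; cases hA
  | bdryAbs hA hB ihA ihB => trivial
  | rule r I hI hB ih ihB =>
    refine AJdg.EqDer.of_bdry fun hc => ?_
    have h1 := fun d hd => hleft hR _ (hI d hd)
    have h2 := fun d hd => hright hR _ (hI d hd)
    have h3 := fun d hd hd' => AJdg.EqDer.plugEq hd' (ih d hd hR)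
    have h4 := ihB hR
    simp only [Stmt.act, ABdry.plug_act, ABdry.inst_act] at h1 h2 h3
    simp only [Bdry.inst_act, Arg.inst_act]
    -- The congruence rule also asks that the types of its two sides be equal. This is the induction
    -- hypothesis for the boundary premise, and the reason for including boundaries in `Stmt.EqDer`.
    refine .congr r hc _ _ h1 h2 h3 fun C hC => h4 _ _ ?_ ?_ <;>
      simp only [Bdry.inst, Bdry.objTy_act, hC, Option.map_some] <;>
      exact congrArg some (Arg.inst_act _ _ _ _)
  | congr r hr I J hI hJ he hC ihI ihJ ihe ihC => exact AJdg.eqDer_plugEq _ _ _ _ _ _ _ _ _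

section

variable {T : RawTT.{u, v} S} {Θ Θ' Ξ : MCtx S} {l n : ℕ} {Γ : Ctx S l} {Δ : Ctx S n}

/-! ### Equal substitutions and instantiations of derivations -/

/-- `(K, σ)` and `(K', σ')` send the variables of `Γ` to equal terms. -/
structure SubEq (T : RawTT.{u, v} S) (Θ : MCtx S) {l n : ℕ} (Γ : Ctx S l) (Δ : Ctx S n)
    (K : Inst S n) (σ : Fin l → Tm S n) (K' : Inst S n) (σ' : Fin l → Tm S n) : Prop where
  left : SubTyped T Θ Γ Δ K σ
  right : SubTyped T Θ Γ Δ K' σ'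
  eq : ∀ a, Der T Θ Δ (.jdg (.base (.eqTm (σ a) (σ' a) ((Γ.get a).act K σ))))

theorem SubEq.refl {K : Inst S n} {σ : Fin l → Tm S n} (h : SubTyped T Θ Γ Δ K σ) :
    SubEq T Θ Γ Δ K σ K σ :=
  ⟨h, h, fun a => .tmRefl (h a)⟩

theorem SubEq.lift {K K' : Inst S n} {σ σ' : Fin l → Tm S n} (h : SubEq T Θ Γ Δ K σ K' σ')
    {A : Ty S l} (hA : Der T Θ Δ (.jdg (.base (.eqTy (A.act K σ) (A.act K' σ'))))) :
    SubEq T Θ (Γ.snoc A) (Δ.snoc (A.act K σ)) K.wk (liftSub σ) K'.wk (liftSub σ') where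
  left := h.left.lift A
  -- The target context is extended by the left image of `A`; the new variable receives the right
  -- image by conversion.
  right := h.right.lift_of (.convTm (.var 0) (hA.wk_eqTy _))
  eq a := by
    cases a using Fin.cases with
    | zero => exact .tmRefl (h.left.lift A 0)
    | succ y =>
      change Der T Θ _ (.jdg (.base (.eqTm (σ y).wk (σ' y).wk
        ((Γ.get y).wk.act K.wk (liftSub σ)))))
      rw [Arg.wk_act]; exact (h.eq y).wk_eqTm _

theorem SubEq.cons {K K' : Inst S n} {σ σ' : Fin l → Tm S n} (h : SubEq T Θ Γ Δ K σ K' σ')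
    {A : Ty S l} {s t : Tm S n} (hs : Der T Θ Δ (.jdg (.base (.hasTy s (A.act K σ)))))
    (ht : Der T Θ Δ (.jdg (.base (.hasTy t (A.act K' σ')))))
    (he : Der T Θ Δ (.jdg (.base (.eqTm s t (A.act K σ))))) :
    SubEq T Θ (Γ.snoc A) Δ K (consSub s σ) K' (consSub t σ') where
  left := h.left.cons hs
  right := h.right.cons ht
  eq a := by
    cases a using Fin.cases with
    | zero =>
      change Der T Θ _ (.jdg (.base (.eqTm s t (A.wk.act K (consSub s σ)))))
      rw [Arg.wk_act_consSub]; exact he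
    | succ y =>
      change Der T Θ _ (.jdg (.base (.eqTm (σ y) (σ' y) ((Γ.get y).wk.act K (consSub s σ)))))
      rw [Arg.wk_act_consSub]; exact h.eq y

/-- With the metavariables fixed, their case is the metavariable congruence rule itself. Equality of
instantiations comes later, since there a metavariable is replaced by an arbitrary argument, into
which equal terms are then substituted. -/
theorem Der.subEq {X : Stmt S l} (h : Der T Θ Γ X) {σ σ' : Fin l → Tm S n}
    (hσ : SubEq T Θ Γ Δ Inst.id σ Inst.id σ') : X.EqDer T Θ Δ Inst.id σ Inst.id σ' := by
  refine Der.actEq_of (Θ' := Θ) (fun {l n} Γ Δ K σ K' σ' => K = Inst.id ∧ K' = Inst.id ∧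
    SubEq T Θ Γ Δ K σ K' σ') ?_ ?_ ?_ ?_ ?_ h ⟨rfl, rfl, hσ⟩
  · rintro l n Γ Δ _ _ σ σ' ⟨rfl, rfl, hσ⟩ X hX
    exact hX.sub hσ.left
  · rintro l n Γ Δ _ _ σ σ' ⟨rfl, rfl, hσ⟩ X hX
    exact hX.sub hσ.right
  · rintro l n Γ Δ _ _ σ σ' A ⟨rfl, rfl, hσ⟩ hA
    exact ⟨Inst.id_wk, Inst.id_wk, hσ.lift hA⟩
  · rintro l n Γ Δ _ _ σ σ' ⟨rfl, rfl, hσ⟩ a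
    exact hσ.eq a
  · rintro l n Γ Δ _ _ σ σ' ⟨rfl, rfl, hσ⟩ d hd hc ss ts hs ht he hC
    rw [Inst.id, MVar.gen_app, MVar.gen_app]
    exact Der.mvarCongr_id hd hc hs ht he hC

theorem Der.app_congr_sub {c : Cls} (hc : c.isObj = true) {k : ℕ} {B : ABdry S c k l}
    {e : Arg S c k l} (h : Der T Θ Γ (.jdg (B.plug e))) {σ σ' : Fin l → Tm S n}
    (hσ : SubEq T Θ Γ Δ Inst.id σ Inst.id σ') {ss ts : Fin k → Tm S n}
    (hs : ArgsTyped T Θ Δ (B.act Inst.id σ) ss ss) (ht : ArgsTyped T Θ Δ (B.act Inst.id σ') ts ts)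
    (he : ArgsEq T Θ Δ (B.act Inst.id σ) ss ts) :
    Der T Θ Δ (.jdg (.base (((B.act Inst.id σ).app ss).plugEq hc ((e.act Inst.id σ).app ss)
      ((e.act Inst.id σ').app ts)))) := by
  induction B with
  | base B => exact AJdg.EqDer.plugEq (B := .base B) hc (h.subEq hσ)
  | abs A B ih =>
    rw [ABdry.abs_app, Arg.succ_app, Arg.succ_app]
    rw [argsTyped_abs] at hs ht
    rw [argsEq_abs] at he
    exact ih hc (Der.abs_inv h).2 (hσ.cons hs.1 ht.1 he.1) hs.2 ht.2 he.2

theorem Der.app_congr {c : Cls} (hc : c.isObj = true) {k : ℕ} {B : ABdry S c k n}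
    {e : Arg S c k n} (h : Der T Θ Δ (.jdg (B.plug e))) {ss ts : Fin k → Tm S n}
    (hs : ArgsTyped T Θ Δ B ss ss) (ht : ArgsTyped T Θ Δ B ts ts) (he : ArgsEq T Θ Δ B ss ts) :
    Der T Θ Δ (.jdg (.base ((B.app ss).plugEq hc (e.app ss) (e.app ts)))) := by
  have := Der.app_congr_sub hc h (SubEq.refl SubTyped.id) (ss := ss) (ts := ts)
  simp only [ABdry.act_id_var, Arg.act_id_var] at this
  exact this hs ht he

theorem Der.bdry_app_eq_sub {c : Cls} {k : ℕ} {B : ABdry S c k l}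
    (h : Der T Θ Γ (.bdry B)) {σ σ' : Fin l → Tm S n}
    (hσ : SubEq T Θ Γ Δ Inst.id σ Inst.id σ') {ss ts : Fin k → Tm S n}
    (hs : ArgsTyped T Θ Δ (B.act Inst.id σ) ss ss) (ht : ArgsTyped T Θ Δ (B.act Inst.id σ') ts ts)
    (he : ArgsEq T Θ Δ (B.act Inst.id σ) ss ts) :
    BdryEq T Θ Δ ((B.act Inst.id σ).app ss) ((B.act Inst.id σ').app ts) := by
  induction B with
  | base B => exact h.subEq hσ
  | abs A B ih =>
    rw [ABdry.abs_app, ABdry.abs_app]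
    rw [argsTyped_abs] at hs ht
    rw [argsEq_abs] at he
    exact ih (Der.bdryAbs_inv h).2 (hσ.cons hs.1 ht.1 he.1) hs.2 ht.2 he.2

theorem Der.bdry_app_eq {c : Cls} {k : ℕ} {B : ABdry S c k n}
    (h : Der T Θ Δ (.bdry B)) {ss ts : Fin k → Tm S n}
    (hs : ArgsTyped T Θ Δ B ss ss) (ht : ArgsTyped T Θ Δ B ts ts) (he : ArgsEq T Θ Δ B ss ts) :
    BdryEq T Θ Δ (B.app ss) (B.app ts) := by
  have := Der.bdry_app_eq_sub h (SubEq.refl SubTyped.id) (ss := ss) (ts := ts)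
  simp only [ABdry.act_id_var] at this
  exact this hs ht he

theorem InstDer.ren {K : Inst S l} (hK : InstDer T Θ Γ Ξ K) {ρ : Fin l → Fin n}
    (hρ : RenTyped Γ Δ ρ) : InstDer T Θ Δ Ξ (K.ren ρ) := fun d hd => by
  have := (hK d hd).ren hρ
  simp only [Stmt.act, ABdry.plug_act, ABdry.inst_act, ← Inst.ren_eq_act, ← Arg.ren_eq_act] at this
  exact this

theorem InstDer.wk {K : Inst S n} (hK : InstDer T Θ Δ Ξ K) (A : Ty S n) :
    InstDer T Θ (Δ.snoc A) Ξ K.wk :=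
  hK.ren ((RenTyped.id Δ).succ A)

/-- Admissibility of instantiation. -/
theorem Der.inst {X : Stmt S l} (h : Der T Ξ Γ X) {K : Inst S n} {σ : Fin l → Tm S n}
    (hK : InstDer T Θ Δ Ξ K) (hσ : SubTyped T Θ Γ Δ K σ) : Der T Θ Δ (X.act K σ) := by
  refine Der.act_of (Θ' := Θ) (fun {l n} Γ Δ K σ => InstDer T Θ Δ Ξ K ∧ SubTyped T Θ Γ Δ K σ)
    ?_ ?_ ?_ ?_ h ⟨hK, hσ⟩
  · rintro l n Γ Δ K σ A ⟨hK, hσ⟩ -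
    exact ⟨hK.wk _, hσ.lift A⟩
  · rintro l n Γ Δ K σ ⟨hK, hσ⟩ a
    exact hσ a
  · rintro l n Γ Δ K σ ⟨hK, hσ⟩ d hd ts ht hB
    -- The metavariable is replaced by a derivable abstraction, so its application becomes a
    -- substitution in the body.
    exact Der.plug_app (hK d hd) ht
  · rintro l n Γ Δ K σ ⟨hK, hσ⟩ d hd hc ss ts hs ht he hC
    exact Der.app_congr hc (hK d hd) hs ht he

theorem InstDer.bdry {c : Cls} {k : ℕ} {B : ABdry S c k 0} {K : Inst S n}
    (hK : InstDer T Θ Δ Ξ K) (h : Der T Ξ .nil (.bdry B)) : Der T Θ Δ (.bdry (B.inst K)) :=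
  h.inst hK (SubTyped.nil _)

/-! ### Boundaries -/

theorem BdryEq.symm {c : Cls} {B B' : Bdry S c n} (h : BdryEq T Θ Δ B B') : BdryEq T Θ Δ B' B :=
  fun A A' hA hA' => .tySym (h A' A hA' hA)

theorem BdryEq.trans {c : Cls} {B B' B'' : Bdry S c n} (h : BdryEq T Θ Δ B B')
    (h' : BdryEq T Θ Δ B' B'') : BdryEq T Θ Δ B B'' := fun A A'' hA hA'' => by
  cases B with
  | tm C =>
    cases B' with
    | tm C' => exact .tyTran (h A C' hA rfl) (h' C' A'' rfl hA'')
  | ty => cases hA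
  | eqTy => cases hA
  | eqTm => cases hA

/-! ### Conversion, reflexivity and transitivity, uniformly in the object class. -/

theorem Der.plug_conv {c : Cls} (hc : c.isObj = true) {B B' : Bdry S c n} {e : Arg S c 0 n}
    (h : Der T Θ Δ (.jdg (.base (B.plug e)))) (hB : BdryEq T Θ Δ B B') :
    Der T Θ Δ (.jdg (.base (B'.plug e))) := by
  cases B with
  | ty => cases B'; exact h
  | tm C => cases B'; exact .convTm h (hB _ _ rfl rfl)
  | eqTy => cases hc
  | eqTm => cases hc

theorem Der.plugEq_conv {c : Cls} (hc : c.isObj = true) {B B' : Bdry S c n} {e e' : Arg S c 0 n}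
    (h : Der T Θ Δ (.jdg (.base (B.plugEq hc e e')))) (hB : BdryEq T Θ Δ B B') :
    Der T Θ Δ (.jdg (.base (B'.plugEq hc e e'))) := by
  cases B with
  | ty => cases B'; exact h
  | tm C => cases B'; exact .convEq h (hB _ _ rfl rfl)
  | eqTy => cases hc
  | eqTm => cases hc

theorem Der.plugEq_refl {c : Cls} (hc : c.isObj = true) {B : Bdry S c n} {e : Arg S c 0 n}
    (h : Der T Θ Δ (.jdg (.base (B.plug e)))) :
    Der T Θ Δ (.jdg (.base (B.plugEq hc e e))) := by
  cases B with
  | ty => exact .tyRefl h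
  | tm C => exact .tmRefl h
  | eqTy => cases hc
  | eqTm => cases hc

theorem Der.plugEq_trans {c : Cls} (hc : c.isObj = true) {B : Bdry S c n} {e e' e'' : Arg S c 0 n}
    (h : Der T Θ Δ (.jdg (.base (B.plugEq hc e e'))))
    (h' : Der T Θ Δ (.jdg (.base (B.plugEq hc e' e'')))) :
    Der T Θ Δ (.jdg (.base (B.plugEq hc e e''))) := by
  cases B with
  | ty => exact .tyTran h h'
  | tm C => exact .tmTran h h'
  | eqTy => cases hc
  | eqTm => cases hc

/-! ### Presuppositions -/

/-- The presuppositions of a judgement are derivable. -/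
def AJdg.Presup (T : RawTT.{u, v} S) (Θ : MCtx S) : {n : ℕ} → Ctx S n → AJdg S n → Prop
  | _, _, .base (.isTy _) => True
  | _, Γ, .base (.hasTy _ A) => Der T Θ Γ (.jdg (.base (.isTy A)))
  | _, Γ, .base (.eqTy A B) =>
      Der T Θ Γ (.jdg (.base (.isTy A))) ∧ Der T Θ Γ (.jdg (.base (.isTy B)))
  | _, Γ, .base (.eqTm s t A) => Der T Θ Γ (.jdg (.base (.isTy A))) ∧
      Der T Θ Γ (.jdg (.base (.hasTy s A))) ∧ Der T Θ Γ (.jdg (.base (.hasTy t A)))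
  | _, Γ, .abs A J => Der T Θ Γ (.jdg (.base (.isTy A))) ∧ J.Presup T Θ (Γ.snoc A)

theorem AJdg.Presup.of_bdry {c : Cls} {B : Bdry S c n} (h : Der T Θ Δ (.bdry (.base B)))
    (e : Arg S c 0 n) : (AJdg.base (B.plug e)).Presup T Θ Δ := by
  cases B with
  | ty => trivial
  | tm A => cases h; assumption
  | eqTy A B => cases h; exact ⟨‹_›, ‹_›⟩
  | eqTm s t A => cases h; exact ⟨‹_›, ‹_›, ‹_›⟩

theorem AJdg.Presup.of_plugEq {c : Cls} (hc : c.isObj = true) {B : Bdry S c n} {e e' : Arg S c 0 n}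
    (h : Der T Θ Δ (.bdry (.base B))) (he : Der T Θ Δ (.jdg (.base (B.plug e))))
    (he' : Der T Θ Δ (.jdg (.base (B.plug e')))) :
    (AJdg.base (B.plugEq hc e e')).Presup T Θ Δ := by
  cases B with
  | ty => exact ⟨he, he'⟩
  | tm A => cases h; exact ⟨‹_›, he, he'⟩
  | eqTy A B => cases hc
  | eqTm s t A => cases hc

theorem WfCtx.mctx (h : WfCtx T Θ Δ) : WfMCtx T Θ := by
  induction h with
  | nil h => exact h
  | snoc _ _ ih => exact ih

theorem WfMCtx.bdry (h : WfMCtx T Θ) {d : Decl S} (hd : d ∈ Θ) :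
    Der T Θ .nil (.bdry d.bdry) := by
  induction h with
  | nil => cases hd
  | snoc hΘ hd' hn ih =>
    rcases List.mem_append.1 hd with h | h
    · exact (ih h).mono (List.subset_append_left _ _)
    · cases List.mem_singleton.1 h
      exact hd'.mono (List.subset_append_left _ _)

theorem WfMCtx.bdry_id (h : WfMCtx T Θ) {d : Decl S} (hd : d ∈ Θ) (Δ : Ctx S n) :
    Der T Θ Δ (.bdry (d.bdry.inst Inst.id)) :=
  (h.bdry hd).sub (SubTyped.nil _)

theorem WfCtx.get_isTy (h : WfCtx T Θ Δ) (a : Fin n) :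
    Der T Θ Δ (.jdg (.base (.isTy (Δ.get a)))) := by
  induction h with
  | nil => exact a.elim0
  | snoc hΓ hA ih =>
    rename_i A
    have hw : ∀ {m : ℕ} {Γ : Ctx S m} {B : Ty S m}, Der T Θ Γ (.jdg (.base (.isTy B))) →
        ∀ A, Der T Θ (Γ.snoc A) (.jdg (.base (.isTy B.wk))) := by
      intro m Γ B h A
      have := h.wk A
      simp only [Stmt.act, AJdg.act, Jdg.act, ← Arg.ren_eq_act] at this
      exact this
    cases a using Fin.cases with
    | zero => exact hw hA A
    | succ y => exact hw (ih y) A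

theorem Bdry.objTy_inst_eq {c : Cls} (B : Bdry S c 0) (I : Inst S n) :
    (B.inst I).objTy = B.objTy.map (fun A => A.inst I) := Bdry.objTy_act _ _ _

theorem BdryEq.of_inst {c : Cls} {B : Bdry S c 0} {I J : Inst S n}
    (h : ∀ C : Ty S 0, B.objTy = some C → Der T Θ Δ (.jdg (.base (.eqTy (C.inst I) (C.inst J))))) :
    BdryEq T Θ Δ (B.inst I) (B.inst J) := by
  intro A A' hA hA'
  rw [Bdry.objTy_inst_eq, Option.map_eq_some_iff] at hA hA'
  obtain ⟨C, hC, rfl⟩ := hA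
  obtain ⟨C', hC', rfl⟩ := hA'
  cases hC.symm.trans hC'
  exact h C hC

/-- Presuppositivity. -/
theorem Der.presup (hT : T.Finitary) {X : Stmt S n} (h : Der T Θ Δ X) (hΔ : WfCtx T Θ Δ) :
    ∀ J, X = .jdg J → J.Presup T Θ Δ := by
  induction h with
  | var a => rintro _ ⟨⟩; exact hΔ.get_isTy a
  | mvar hM ts ht hB ih ihB => rintro _ ⟨⟩; exact .of_bdry hB _
  | mvarCongr hM hc ss ts hs ht he hC ihs iht ihe ihC =>
    rintro _ ⟨⟩
    -- The right-hand side is first typed at its own type, that of `M(ts)`, and then converted to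
    -- the type of the left-hand side. The case of a specific rule below is alike; there
    -- finitariness provides the boundaries of the two conclusions.
    have hD := hΔ.mctx.bdry_id hM (n := _) (by assumption)
    rw [← ABdry.wk0_eq_inst] at hD
    have h1 := hD.bdry_app hs
    exact .of_plugEq hc h1 (.mvar hM _ hs h1)
      (Der.plug_conv hc (.mvar hM _ ht (hD.bdry_app ht)) (BdryEq.symm hC))
  | abs hA hJ ihA ihJ => rintro _ ⟨⟩; exact ⟨hA, ihJ (.snoc hΔ hA) _ rfl⟩
  | tyRefl h ih => rintro _ ⟨⟩; exact ⟨h, h⟩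
  | tySym h ih => rintro _ ⟨⟩; exact (ih hΔ _ rfl).symm
  | tyTran h h' ih ih' => rintro _ ⟨⟩; exact ⟨(ih hΔ _ rfl).1, (ih' hΔ _ rfl).2⟩
  | tmRefl h ih => rintro _ ⟨⟩; exact ⟨ih hΔ _ rfl, h, h⟩
  | tmSym h ih =>
    rintro _ ⟨⟩
    obtain ⟨h1, h2, h3⟩ := ih hΔ _ rfl
    exact ⟨h1, h3, h2⟩
  | tmTran h h' ih ih' =>
    rintro _ ⟨⟩
    obtain ⟨h1, h2, h3⟩ := ih hΔ _ rfl
    exact ⟨h1, h2, (ih' hΔ _ rfl).2.2⟩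
  | convTm h h' ih ih' => rintro _ ⟨⟩; exact (ih' hΔ _ rfl).2
  | convEq h h' ih ih' =>
    rintro _ ⟨⟩
    obtain ⟨h1, h2, h3⟩ := ih hΔ _ rfl
    exact ⟨(ih' hΔ _ rfl).2, .convTm h2 h', .convTm h3 h'⟩
  | bdryTy => rintro _ ⟨⟩
  | bdryTm hA ih => rintro _ ⟨⟩
  | bdryEqTy hA hB ih ih' => rintro _ ⟨⟩
  | bdryEqTm hA hs ht ih ih' ih'' => rintro _ ⟨⟩
  | bdryAbs hA hB ihA ihB => rintro _ ⟨⟩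
  | rule r I hI hB ih ihB => rintro _ ⟨⟩; exact .of_bdry hB _
  | congr r hr I J hI hJ he hC ihI ihJ ihe ihC =>
    rintro _ ⟨⟩
    have h1 := InstDer.bdry hI (hT r).2
    have h2 := InstDer.bdry hJ (hT r).2
    exact .of_plugEq hr h1 (.rule r I hI h1)
      (Der.plug_conv hr (.rule r J hJ h2) (BdryEq.symm (.of_inst hC)))

theorem Der.presup_eqTy (hT : T.Finitary) (hΔ : WfCtx T Θ Δ) {A B : Ty S n}
    (h : Der T Θ Δ (.jdg (.base (.eqTy A B)))) :
    Der T Θ Δ (.jdg (.base (.isTy A))) ∧ Der T Θ Δ (.jdg (.base (.isTy B))) :=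
  h.presup hT hΔ _ rfl

theorem Der.presup_eqTm (hT : T.Finitary) (hΔ : WfCtx T Θ Δ) {s t : Tm S n} {A : Ty S n}
    (h : Der T Θ Δ (.jdg (.base (.eqTm s t A)))) :
    Der T Θ Δ (.jdg (.base (.isTy A))) ∧
      Der T Θ Δ (.jdg (.base (.hasTy s A))) ∧ Der T Θ Δ (.jdg (.base (.hasTy t A))) :=
  h.presup hT hΔ _ rfl

theorem Der.presup_hasTy (hT : T.Finitary) (hΔ : WfCtx T Θ Δ) {t : Tm S n} {A : Ty S n}
    (h : Der T Θ Δ (.jdg (.base (.hasTy t A)))) : Der T Θ Δ (.jdg (.base (.isTy A))) :=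
  h.presup hT hΔ _ rfl

theorem Der.presup_plugEq (hT : T.Finitary) (hΔ : WfCtx T Θ Δ) {c : Cls} (hc : c.isObj = true)
    {k : ℕ} {B : ABdry S c k n} {e e' : Arg S c k n} (h : Der T Θ Δ (.jdg (B.plugEq hc e e'))) :
    Der T Θ Δ (.jdg (B.plug e)) ∧ Der T Θ Δ (.jdg (B.plug e')) := by
  induction B with
  | base B =>
    cases B with
    | ty => exact h.presup_eqTy hT hΔ
    | tm A => exact (h.presup_eqTm hT hΔ).2
    | eqTy => cases hc
    | eqTm => cases hc
  | abs A B ih =>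
    obtain ⟨hA, hJ⟩ := Der.abs_inv h
    obtain ⟨h1, h2⟩ := ih (.snoc hΔ hA) hc hJ
    exact ⟨.abs hA h1, .abs hA h2⟩

/-! ### Telescopes of arguments -/

/-- The types of the abstractions of `B` are derivable. -/
def ABdry.ArgTys (T : RawTT.{u, v} S) (Θ : MCtx S) {c : Cls} :
    {k n : ℕ} → Ctx S n → ABdry S c k n → Prop
  | _, _, _, .base _ => True
  | _, _, Γ, .abs A B => Der T Θ Γ (.jdg (.base (.isTy A))) ∧ B.ArgTys T Θ (Γ.snoc A)

theorem Der.argTys_of_plug {c : Cls} {k : ℕ} {B : ABdry S c k n} {e : Arg S c k n}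
    (h : Der T Θ Δ (.jdg (B.plug e))) : B.ArgTys T Θ Δ := by
  induction B with
  | base B => trivial
  | abs A B ih => exact ⟨(Der.abs_inv h).1, ih (Der.abs_inv h).2⟩

theorem Der.argTys_of_bdry {c : Cls} {k : ℕ} {B : ABdry S c k n}
    (h : Der T Θ Δ (.bdry B)) : B.ArgTys T Θ Δ := by
  induction B with
  | base B => trivial
  | abs A B ih => exact ⟨(Der.bdryAbs_inv h).1, ih (Der.bdryAbs_inv h).2⟩

/-- The terms `ts` are given at types that depend on `ss`. Each is converted to the type that
depends on `ts`, using the equality of the preceding terms. -/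
theorem ABdry.ArgTys.argsTyped_of_eq_sub {c : Cls} {k : ℕ} {B : ABdry S c k l}
    (h : B.ArgTys T Θ Γ) {σ σ' : Fin l → Tm S n}
    (hσ : SubEq T Θ Γ Δ Inst.id σ Inst.id σ') {ss ts : Fin k → Tm S n}
    (hs : ArgsTyped T Θ Δ (B.act Inst.id σ) ss ss) (ht : ArgsTyped T Θ Δ (B.act Inst.id σ) ss ts)
    (he : ArgsEq T Θ Δ (B.act Inst.id σ) ss ts) :
    ArgsTyped T Θ Δ (B.act Inst.id σ') ts ts := by
  induction B with
  | base B => exact fun j => j.elim0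
  | abs A B ih =>
    rw [argsTyped_abs] at hs ht ⊢
    rw [argsEq_abs] at he
    have ht' := Der.convTm ht.1 (h.1.subEq hσ)
    exact ⟨ht', ih h.2 (hσ.cons hs.1 ht' he.1) hs.2 ht.2 he.2⟩

theorem ABdry.ArgTys.argsTyped_of_eq {c : Cls} {k : ℕ} {B : ABdry S c k n}
    (h : B.ArgTys T Θ Δ) {ss ts : Fin k → Tm S n} (hs : ArgsTyped T Θ Δ B ss ss)
    (ht : ArgsTyped T Θ Δ B ss ts) (he : ArgsEq T Θ Δ B ss ts) : ArgsTyped T Θ Δ B ts ts := by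
  have := h.argsTyped_of_eq_sub (SubEq.refl SubTyped.id) (ss := ss) (ts := ts)
  simp only [ABdry.act_id_var] at this
  exact this hs ht he

/-- The assumed comparison of the `j`-th terms requires both at the type that depends on `ss`. The
right one reaches that type only after the preceding terms are known to be equal, so the comparisons
are used from left to right. -/
theorem ABdry.ArgTys.argsEq_of_sub {c : Cls} {k : ℕ} {B : ABdry S c k l}
    (h : B.ArgTys T Θ Γ) {σ σ' : Fin l → Tm S n}
    (hσ : SubEq T Θ Γ Δ Inst.id σ Inst.id σ') {ss ts : Fin k → Tm S n}
    (hs : ArgsTyped T Θ Δ (B.act Inst.id σ) ss ss) (ht : ArgsTyped T Θ Δ (B.act Inst.id σ') ts ts)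
    (he : ∀ j, Der T Θ Δ (.jdg (.base (.hasTy (ts j) ((B.act Inst.id σ).argTy ss j)))) →
      Der T Θ Δ (.jdg (.base (.eqTm (ss j) (ts j) ((B.act Inst.id σ).argTy ss j))))) :
    ArgsEq T Θ Δ (B.act Inst.id σ) ss ts := by
  induction B with
  | base B => exact fun j => j.elim0
  | abs A B ih =>
    rw [argsTyped_abs] at hs ht
    rw [argsEq_abs]
    rw [Fin.forall_fin_succ] at he
    simp only [ABdry.act, ABdry.argTy, Fin.cases_zero, Fin.cases_succ,
      ABdry.liftAct_sub_single] at he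
    have he0 := he.1 (.convTm ht.1 (.tySym (h.1.subEq hσ)))
    exact ⟨he0, ih h.2 (hσ.cons hs.1 ht.1 he0) hs.2 ht.2 he.2⟩

theorem ABdry.ArgTys.argsEq_of {c : Cls} {k : ℕ} {B : ABdry S c k n}
    (h : B.ArgTys T Θ Δ) {ss ts : Fin k → Tm S n}
    (hs : ArgsTyped T Θ Δ B ss ss) (ht : ArgsTyped T Θ Δ B ts ts)
    (he : ∀ j, Der T Θ Δ (.jdg (.base (.hasTy (ts j) (B.argTy ss j)))) →
      Der T Θ Δ (.jdg (.base (.eqTm (ss j) (ts j) (B.argTy ss j))))) :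
    ArgsEq T Θ Δ B ss ts := by
  have := h.argsEq_of_sub (SubEq.refl SubTyped.id) (ss := ss) (ts := ts)
  simp only [ABdry.act_id_var] at this
  exact this hs ht he

/-! ### Equal instantiations -/

/-- `K` and `K'` are equal on the object entries of `Ξ`. -/
def InstEq (T : RawTT.{u, v} S) (Θ : MCtx S) {n : ℕ} (Δ : Ctx S n) (Ξ : MCtx S)
    (K K' : Inst S n) : Prop :=
  ∀ d ∈ Ξ, ∀ hd : d.c.isObj = true,
    Der T Θ Δ (.jdg ((d.bdry.inst K).plugEq hd (K d.mvar) (K' d.mvar)))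

theorem InstEq.wk {K K' : Inst S n} (h : InstEq T Θ Δ Ξ K K') (A : Ty S n) :
    InstEq T Θ (Δ.snoc A) Ξ K.wk K'.wk := fun d hd hc => by
  have := (h d hd hc).wk A
  simp only [Stmt.act, ABdry.plugEq_act, ABdry.inst_act, ← Inst.ren_eq_act,
    ← Arg.ren_eq_act] at this
  exact this

/-- Two equal ways `(K, σ)` and `(K', σ')` to act on entities over `Ξ; Γ`. -/
structure ActEq (T : RawTT.{u, v} S) (Ξ Θ : MCtx S) {l n : ℕ} (Γ : Ctx S l) (Δ : Ctx S n)
    (K : Inst S n) (σ : Fin l → Tm S n) (K' : Inst S n) (σ' : Fin l → Tm S n) : Prop where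
  wf : WfCtx T Θ Δ
  left : InstDer T Θ Δ Ξ K
  right : InstDer T Θ Δ Ξ K'
  eq : InstEq T Θ Δ Ξ K K'
  sub : SubEq T Θ Γ Δ K σ K' σ'

theorem ActEq.lift (hT : T.Finitary) {K K' : Inst S n} {σ σ' : Fin l → Tm S n}
    (h : ActEq T Ξ Θ Γ Δ K σ K' σ') {A : Ty S l}
    (hA : Der T Θ Δ (.jdg (.base (.eqTy (A.act K σ) (A.act K' σ'))))) :
    ActEq T Ξ Θ (Γ.snoc A) (Δ.snoc (A.act K σ)) K.wk (liftSub σ) K'.wk (liftSub σ') :=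
  ⟨.snoc h.wf (hA.presup_eqTy hT h.wf).1, h.left.wk _, h.right.wk _, h.eq.wk _, h.sub.lift hA⟩

/-- Equal instantiations act equally on derivable object judgements. -/
theorem Der.instEq (hT : T.Finitary) {X : Stmt S l} (h : Der T Ξ Γ X) {K K' : Inst S n}
    {σ σ' : Fin l → Tm S n} (hK : ActEq T Ξ Θ Γ Δ K σ K' σ') : X.EqDer T Θ Δ K σ K' σ' := by
  refine Der.actEq_of (Θ' := Θ) (fun {l n} Γ Δ K σ K' σ' => ActEq T Ξ Θ Γ Δ K σ K' σ')
    ?_ ?_ ?_ ?_ ?_ h hK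
  · intro l n Γ Δ K K' σ σ' hK X hX
    exact hX.inst hK.left hK.sub.left
  · intro l n Γ Δ K K' σ σ' hK X hX
    exact hX.inst hK.right hK.sub.right
  · intro l n Γ Δ K K' σ σ' A hK hA
    exact hK.lift hT hA
  · intro l n Γ Δ K K' σ σ' hK a
    exact hK.sub.eq a
  · intro l n Γ Δ K K' σ σ' hK d hd hc ss ts hs _ he _
    have ht : ArgsTyped T Θ Δ (d.bdry.inst K) ts ts :=
      (hK.left d hd).argTys_of_plug.argsTyped_of_eq hs
        (fun j => ((he j).presup_eqTm hT hK.wf).2.2) he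
    -- First the arguments `K M` and `K' M` are exchanged at `ss`, then `ss` is exchanged for `ts`
    -- inside `K' M`. The second half needs `K' M` at the boundary formed with `K`, which is a
    -- presupposition of the equation between the two arguments.
    exact Der.plugEq_trans hc (Der.plugEq_app hc (hK.eq d hd hc) hs)
      (Der.app_congr hc ((hK.eq d hd hc).presup_plugEq hT hK.wf).2 hs ht he)

/-- Substitution of the variables for themselves, the last one retyped by conversion. -/
theorem Der.ctx_conv {A A' : Ty S n} (hA : Der T Θ Δ (.jdg (.base (.eqTy A' A))))
    {X : Stmt S (n + 1)} (h : Der T Θ (Δ.snoc A) X) : Der T Θ (Δ.snoc A') X := by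
  have := h.sub (σ := Arg.var) (Δ := Δ.snoc A') fun a => by
    rw [Arg.act_id_var]
    cases a using Fin.cases with
    | zero => exact .convTm (.var 0) (hA.wk_eqTy A')
    | succ y => exact .var y.succ
  rwa [Stmt.act_id_var] at this

/-- Equal actions produce equal boundaries. An object head is moved by conversion, an equation by
composing it with the equations of its two sides; under a binder the context has to be converted as
well. -/
theorem ActEq.plug_iff (hT : T.Finitary) {c : Cls} {k : ℕ} {B : ABdry S c k l}
    (h : Der T Ξ Γ (.bdry B)) {K K' : Inst S n} {σ σ' : Fin l → Tm S n}
    (hK : ActEq T Ξ Θ Γ Δ K σ K' σ') (e : Arg S c k n) :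
    Der T Θ Δ (.jdg ((B.act K σ).plug e)) ↔ Der T Θ Δ (.jdg ((B.act K' σ').plug e)) := by
  induction B generalizing n with
  | base B =>
    cases B with
    | ty => exact Iff.rfl
    | tm A =>
      cases h with
      | bdryTm hA =>
        have h1 := hA.instEq hT hK
        exact ⟨fun h => .convTm h h1, fun h => .convTm h (.tySym h1)⟩
    | eqTy A B =>
      cases h with
      | bdryEqTy hA hB =>
        have h1 := hA.instEq hT hK
        have h2 := hB.instEq hT hK
        exact ⟨fun h => .tyTran (.tySym h1) (.tyTran h h2),
          fun h => .tyTran h1 (.tyTran h (.tySym h2))⟩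
    | eqTm s t A =>
      cases h with
      | bdryEqTm hA hs ht =>
        have h1 := hA.instEq hT hK
        have h2 := hs.instEq hT hK
        have h3 := ht.instEq hT hK
        exact ⟨fun h => .convEq (.tmTran (.tmSym h2) (.tmTran h h3)) h1,
          fun h => .tmTran h2 (.tmTran (.convEq h (.tySym h1)) (.tmSym h3))⟩
  | abs A B ih =>
    obtain ⟨hA, hB⟩ := Der.bdryAbs_inv h
    have h1 := hA.instEq hT hK
    have h2 := ih hB (hK.lift hT h1) e.body
    obtain ⟨h3, h4⟩ := Der.presup_eqTy hT hK.wf h1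
    constructor
    · intro h
      exact .abs h4 (Der.ctx_conv (.tySym h1) (h2.1 (Der.abs_inv h).2))
    · intro h
      exact .abs h3 (h2.2 (Der.ctx_conv h1 (Der.abs_inv h).2))

theorem InstEq.actEq {K K' : Inst S n} (h : InstEq T Θ Δ Ξ K K') (hΔ : WfCtx T Θ Δ)
    (hK : InstDer T Θ Δ Ξ K) (hK' : InstDer T Θ Δ Ξ K') :
    ActEq T Ξ Θ .nil Δ K (fun i => i.elim0) K' (fun i => i.elim0) :=
  ⟨hΔ, hK, hK', h, SubTyped.nil _, SubTyped.nil _, fun a => a.elim0⟩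

/-- An instantiation that is equal to a derivable one is derivable. -/
theorem InstEq.instDer (hT : T.Finitary) (hΞ : WfMCtx T Ξ) (hΔ : WfCtx T Θ Δ) {K K' : Inst S n}
    (hK : InstDer T Θ Δ Ξ K) (h : InstEq T Θ Δ Ξ K K') : InstDer T Θ Δ Ξ K' := by
  induction hΞ with
  | nil => intro d hd; cases hd
  | @snoc Ξ d _ hd _ ih =>
    have hK' : InstDer T Θ Δ Ξ K := fun d' hd' => hK d' (List.mem_append_left _ hd')
    have h' : InstEq T Θ Δ Ξ K K' := fun d' hd' => h d' (List.mem_append_left _ hd')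
    intro d' hd'
    rcases List.mem_append.1 hd' with hd' | hd'
    · exact ih hK' h' d' hd'
    · cases List.mem_singleton.1 hd'
      refine (ActEq.plug_iff hT hd (h'.actEq hΔ hK' (ih hK' h')) _).1 ?_
      -- The boundary has been moved back to `K`. An equality entry has only one possible head
      -- there; an object entry is typed by the presuppositions of the given equation.
      cases hc : d.c.isObj
      · rw [Arg.eq_of_not_isObj hc (K' d.mvar) (K d.mvar)]
        exact hK d (List.mem_append_right _ (List.mem_singleton_self _))
      · exact ((h d (List.mem_append_right _ (List.mem_singleton_self _)) hc).presup_plugEq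
          hT hΔ).2

/-- Derivable instantiations are equal when their entries are equal as soon as they can be
compared. -/
theorem InstDer.instEq_of (hT : T.Finitary) (hΞ : WfMCtx T Ξ) (hΔ : WfCtx T Θ Δ) {K K' : Inst S n}
    (hK : InstDer T Θ Δ Ξ K) (hK' : InstDer T Θ Δ Ξ K')
    (h : ∀ d ∈ Ξ, ∀ hd : d.c.isObj = true,
      Der T Θ Δ (.jdg ((d.bdry.inst K).plug (K' d.mvar))) →
      Der T Θ Δ (.jdg ((d.bdry.inst K).plugEq hd (K d.mvar) (K' d.mvar)))) :
    InstEq T Θ Δ Ξ K K' := by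
  induction hΞ with
  | nil => intro d hd; cases hd
  | @snoc Ξ d _ hd _ ih =>
    have h1 : InstDer T Θ Δ Ξ K := fun d' hd' => hK d' (List.mem_append_left _ hd')
    have h2 : InstDer T Θ Δ Ξ K' := fun d' hd' => hK' d' (List.mem_append_left _ hd')
    have h3 := ih h1 h2 fun d' hd' => h d' (List.mem_append_left _ hd')
    intro d' hd' hc
    rcases List.mem_append.1 hd' with hd'' | hd''
    · exact h3 d' hd'' hc
    · cases List.mem_singleton.1 hd''
      -- The earlier entries are already equal, so the entry of `K'` can be moved to the boundary
      -- formed with `K`, where the comparison applies.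
      refine h d hd' hc ((ActEq.plug_iff hT hd (h3.actEq hΔ h1 h2) _).2 (hK' d hd'))

end

/-! ### Metavariables of derivable judgements -/

/-- The metavariables of a judgement thesis. -/
def Jdg.mv {n : ℕ} : Jdg S n → Set AnyMVar
  | .isTy A => A.mv
  | .hasTy t A => t.mv ∪ A.mv
  | .eqTy A B => A.mv ∪ B.mv
  | .eqTm s t A => s.mv ∪ t.mv ∪ A.mv

/-- The metavariables of an abstracted judgement. -/
def AJdg.mv : {n : ℕ} → AJdg S n → Set AnyMVar
  | _, .base J => J.mv
  | _, .abs A J => A.mv ∪ J.mv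

/-- The metavariables of an abstracted judgement or boundary. -/
def Stmt.mv {n : ℕ} : Stmt S n → Set AnyMVar
  | .jdg J => J.mv
  | .bdry B => B.mv

theorem Bdry.mv_plug_subset {c : Cls} {n : ℕ} {B : Bdry S c n} {e : Arg S c 0 n} {D : Set AnyMVar}
    (hB : B.mv ⊆ D) (he : e.mv ⊆ D) : (B.plug e).mv ⊆ D := by
  cases B with
  | ty => exact he
  | tm A => exact Set.union_subset he hB
  | eqTy A B => exact hB
  | eqTm s t A => exact hB

theorem Bdry.mv_plugEq_subset {c : Cls} (hc : c.isObj = true) {n : ℕ} {B : Bdry S c n}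
    {e e' : Arg S c 0 n} {D : Set AnyMVar} (hB : ∀ A, B.objTy = some A → A.mv ⊆ D)
    (he : e.mv ⊆ D) (he' : e'.mv ⊆ D) : (B.plugEq hc e e').mv ⊆ D := by
  cases B with
  | ty => exact Set.union_subset he he'
  | tm A => exact Set.union_subset (Set.union_subset he he') (hB A rfl)
  | eqTy A B => cases hc
  | eqTm s t A => cases hc

theorem ABdry.mv_head_subset {c : Cls} {k n : ℕ} (B : ABdry S c k n) {e : Arg S c k n}
    {D : Set AnyMVar} (h : (B.plug e).mv ⊆ D) : e.mv ⊆ D := by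
  cases hc : c.isObj
  · rw [Arg.mv_eq_empty hc]; exact Set.empty_subset _
  · induction B with
    | base B =>
      cases B with
      | ty => exact h
      | tm A => exact Set.subset_union_left.trans h
      | eqTy A B => cases hc
      | eqTm s t A => cases hc
    | abs A B ih => exact e.mv_body ▸ ih (Set.subset_union_right.trans h) hc

theorem MVar.mv_app_subset {c : Cls} {k n : ℕ} (M : MVar c k) (ts : Fin k → Tm S n)
    {D : Set AnyMVar} (hM : ⟨c, k, M⟩ ∈ D) (ht : ∀ j, (ts j).mv ⊆ D) : (M.app ts).mv ⊆ D := by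
  rw [← MVar.gen_app]
  exact Arg.mv_app_subset _ _ (M.mv_gen_subset.trans (Set.singleton_subset_iff.2 hM)) ht

theorem Arg.mv_inst_subset {c : Cls} {k n : ℕ} (e : Arg S c k 0) {I : Inst S n} {Ξ : MCtx S}
    {D : Set AnyMVar} (he : e.mv ⊆ MCtx.dom Ξ) (hI : ∀ d ∈ Ξ, (I d.mvar).mv ⊆ D) :
    (e.inst I).mv ⊆ D := by
  refine Arg.mv_act_subset _ _ _ (fun c k M hM => ?_) fun x => x.elim0
  obtain ⟨d, hd, hk⟩ := he hM
  cases hk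
  exact hI d hd

/-- Object-invertibility speaks of instantiations over `Θ`, while the terms met inside a derivation
are known only to be well typed. Specific rules are syntactically valid, so metavariables can enter
their heads only through the instantiation. -/
theorem Der.mv_subset {T : RawTT.{u, v} S} {Θ : MCtx S} {n : ℕ} {Γ : Ctx S n} {X : Stmt S n}
    (h : Der T Θ Γ X) (hΓ : ∀ a, (Γ.get a).mv ⊆ MCtx.dom Θ) : X.mv ⊆ MCtx.dom Θ := by
  have hlift : ∀ {n : ℕ} {Γ : Ctx S n} {A : Ty S n}, (∀ a, (Γ.get a).mv ⊆ MCtx.dom Θ) →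
      A.mv ⊆ MCtx.dom Θ → ∀ a, ((Γ.snoc A).get a).mv ⊆ MCtx.dom Θ := by
    intro n Γ A hΓ hA a
    cases a using Fin.cases with
    | zero => exact (Arg.mv_ren A _).subset.trans hA
    | succ y => exact (Arg.mv_ren (Γ.get y) _).subset.trans (hΓ y)
  induction h with
  | var a => exact Set.union_subset (Set.empty_subset _) (hΓ a)
  | mvar hM ts ht hB ih ihB =>
    exact Bdry.mv_plug_subset (ihB hΓ) (MVar.mv_app_subset _ _ ⟨_, hM, rfl⟩ fun j =>
      Set.subset_union_left.trans (ih j hΓ))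
  | @mvarCongr n _ c _ _ B hM hc ss ts hs ht he hC ihs iht ihe ihC =>
    refine Bdry.mv_plugEq_subset hc (fun A hA => ?_)
      (MVar.mv_app_subset _ _ ⟨_, hM, rfl⟩ fun j => Set.subset_union_left.trans (ihs j hΓ))
      (MVar.mv_app_subset _ _ ⟨_, hM, rfl⟩ fun j => Set.subset_union_left.trans (iht j hΓ))
    -- The premise on types is stated for both sides together; boundaries of the same class have a
    -- type either both or not at all.
    have h1 : ∃ A', ((B.wk0 n).app ts).objTy = some A' := by
      generalize (B.wk0 n).app ss = B1 at hA
      generalize (B.wk0 n).app ts = B2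
      cases B1 with
      | tm => cases B2; exact ⟨_, rfl⟩
      | ty => cases hA
      | eqTy => cases hA
      | eqTm => cases hA
    obtain ⟨A', hA'⟩ := h1
    exact Set.subset_union_left.trans (ihC A A' hA hA' hΓ)
  | abs hA hJ ihA ihJ => exact Set.union_subset (ihA hΓ) (ihJ (hlift hΓ (ihA hΓ)))
  | tyRefl h ih => exact Set.union_subset (ih hΓ) (ih hΓ)
  | tySym h ih =>
    have := ih hΓ
    simp only [Stmt.mv, AJdg.mv, Jdg.mv, Set.union_subset_iff] at this ⊢
    tauto
  | tyTran h h' ih ih' =>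
    have h1 := ih hΓ
    have h2 := ih' hΓ
    simp only [Stmt.mv, AJdg.mv, Jdg.mv, Set.union_subset_iff] at h1 h2 ⊢
    tauto
  | tmRefl h ih =>
    have := ih hΓ
    simp only [Stmt.mv, AJdg.mv, Jdg.mv, Set.union_subset_iff] at this ⊢
    tauto
  | tmSym h ih =>
    have := ih hΓ
    simp only [Stmt.mv, AJdg.mv, Jdg.mv, Set.union_subset_iff] at this ⊢
    tauto
  | tmTran h h' ih ih' =>
    have h1 := ih hΓ
    have h2 := ih' hΓ
    simp only [Stmt.mv, AJdg.mv, Jdg.mv, Set.union_subset_iff] at h1 h2 ⊢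
    tauto
  | convTm h h' ih ih' =>
    have h1 := ih hΓ
    have h2 := ih' hΓ
    simp only [Stmt.mv, AJdg.mv, Jdg.mv, Set.union_subset_iff] at h1 h2 ⊢
    tauto
  | convEq h h' ih ih' =>
    have h1 := ih hΓ
    have h2 := ih' hΓ
    simp only [Stmt.mv, AJdg.mv, Jdg.mv, Set.union_subset_iff] at h1 h2 ⊢
    tauto
  | bdryTy => exact Set.empty_subset _
  | bdryTm hA ih => exact ih hΓ
  | bdryEqTy hA hB ih ih' => exact Set.union_subset (ih hΓ) (ih' hΓ)
  | bdryEqTm hA hs ht ih ih' ih'' =>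
    have h1 := ih' hΓ
    have h2 := ih'' hΓ
    simp only [Stmt.mv, AJdg.mv, Jdg.mv, ABdry.mv, Bdry.mv, Set.union_subset_iff] at h1 h2 ⊢
    tauto
  | bdryAbs hA hB ihA ihB => exact Set.union_subset (ihA hΓ) (ihB (hlift hΓ (ihA hΓ)))
  | rule r I hI hB ih ihB =>
    exact Bdry.mv_plug_subset (ihB hΓ) (Arg.mv_inst_subset _ (T.valid r).2.2 fun d hd =>
      ABdry.mv_head_subset _ (ih d hd hΓ))
  | congr r hr I J hI hJ he hC ihI ihJ ihe ihC =>
    refine Bdry.mv_plugEq_subset hr (fun A hA => ?_)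
      (Arg.mv_inst_subset _ (T.valid r).2.2 fun d hd => ABdry.mv_head_subset _ (ihI d hd hΓ))
      (Arg.mv_inst_subset _ (T.valid r).2.2 fun d hd => ABdry.mv_head_subset _ (ihJ d hd hΓ))
    rw [Bdry.objTy_inst_eq, Option.map_eq_some_iff] at hA
    obtain ⟨C, hC1, rfl⟩ := hA
    exact Set.subset_union_left.trans (ihC C hC1 hΓ)

section

variable {T : RawTT.{u, v} S} {Θ Θ' Ξ : MCtx S} {l n : ℕ} {Γ : Ctx S l} {Δ : Ctx S n}

theorem WfCtx.mv_subset (h : WfCtx T Θ Δ) (a : Fin n) : (Δ.get a).mv ⊆ MCtx.dom Θ := by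
  induction h with
  | nil => exact a.elim0
  | snoc hΓ hA ih =>
    cases a using Fin.cases with
    | zero => exact (Arg.mv_ren _ _).subset.trans (hA.mv_subset ih)
    | succ y => exact (Arg.mv_ren _ _).subset.trans (ih y)

/-! ### Inversion -/

/-- This is confined to object classes because filling an equality boundary forgets the head. -/
theorem Bdry.plug_inj {c c' : Cls} (hc : c'.isObj = true) {B : Bdry S c n} {B' : Bdry S c' n}
    {e : Arg S c 0 n} {e' : Arg S c' 0 n} (h : B.plug e = B'.plug e') :
    c = c' ∧ HEq B B' ∧ HEq e e' := by
  cases B' with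
  | ty => cases B <;> cases h; exact ⟨rfl, HEq.rfl, HEq.rfl⟩
  | tm => cases B <;> cases h; exact ⟨rfl, HEq.rfl, HEq.rfl⟩
  | eqTy => cases hc
  | eqTm => cases hc

theorem Bdry.plugEq_ne_plug {c c' : Cls} (hc : c.isObj = true) (hc' : c'.isObj = true)
    {B : Bdry S c n} {B' : Bdry S c' n} {e e' : Arg S c 0 n} {a : Arg S c' 0 n} :
    B.plugEq hc e e' ≠ B'.plug a := by
  intro h
  cases B' with
  | ty => cases B <;> first | cases h | cases hc
  | tm => cases B <;> first | cases h | cases hc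
  | eqTy => cases hc'
  | eqTm => cases hc'

theorem Bdry.hasTy_inj {c' : Cls} (hc : c'.isObj = true) {A : Ty S n} {B' : Bdry S c' n}
    {t : Tm S n} {e' : Arg S c' 0 n} (h : Jdg.hasTy t A = B'.plug e') :
    .tm = c' ∧ HEq (Bdry.tm A) B' ∧ HEq t e' :=
  Bdry.plug_inj (B := .tm A) (e := t) hc h

theorem Bdry.eqTy_ne_plug {c : Cls} (hc : c.isObj = true) {B : Bdry S c n} {A A' : Ty S n}
    {a : Arg S c 0 n} : Jdg.eqTy A A' ≠ B.plug a :=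
  Bdry.plugEq_ne_plug (B := .ty) (e := A) (e' := A') rfl hc

theorem Bdry.eqTm_ne_plug {c : Cls} (hc : c.isObj = true) {B : Bdry S c n} {s t : Tm S n}
    {A : Ty S n} {a : Arg S c 0 n} : Jdg.eqTm s t A ≠ B.plug a :=
  Bdry.plugEq_ne_plug (B := .tm A) (e := s) (e' := t) rfl hc

theorem Stmt.base_inj {J J' : Jdg S n} (h : Stmt.jdg (.base J) = .jdg (.base J')) : J = J' := by
  cases h; rfl

theorem BdryEq.of_eqTy {A A' : Ty S n} (h : Der T Θ Δ (.jdg (.base (.eqTy A A')))) :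
    BdryEq T Θ Δ (.tm A) (.tm A') := by
  rintro _ _ ⟨⟩ ⟨⟩; exact h

theorem BdryEq.refl_of_bdry {c : Cls} {B : Bdry S c n} (h : Der T Θ Δ (.bdry (.base B))) :
    BdryEq T Θ Δ B B := by
  intro A A' hA hA'
  cases hA.symm.trans hA'
  cases B <;> cases hA
  cases h
  exact .tyRefl ‹_›

/-- A derivable object judgement about a symbol application arises from the rule for the symbol. -/
theorem Der.sym_inv' (hT : T.Standard) {X : Stmt S n} (h : Der T Θ Δ X) :
    ∀ {s : S.Sym} {c : Cls} (hs : S.cls s = c) (B : Bdry S c n)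
      (e : (i : Fin (S.nargs s)) → Arg S (S.argCls s i) (S.argBinds s i) n),
      X = .jdg (.base (B.plug (.sym s hs e))) →
      ∃ (d : SymRule S s c) (I : Inst S n), T.HasSymRule hs d ∧ (∀ i, I (d.M i) = e i) ∧
        InstDer T Θ Δ (d.toRaw hs).prem I ∧ BdryEq T Θ Δ (d.bdry.inst I) B := by
  induction h with
  | var a =>
    intro s c hs B e hX
    obtain ⟨rfl, -, he⟩ := Bdry.hasTy_inj (hs ▸ S.cls_obj s) (Stmt.base_inj hX)
    cases he
  | mvar hM ts ht hB ih ihB =>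
    intro s c hs B e hX
    have hc : c.isObj = true := hs ▸ S.cls_obj s
    obtain ⟨rfl, -, he⟩ := Bdry.plug_inj hc (Stmt.base_inj hX)
    rw [MVar.app_eq hc] at he
    cases he
  | mvarCongr hM hc ss ts hs ht he hC ihs iht ihe ihC =>
    intro s c hs B e hX
    exact absurd (Stmt.base_inj hX) (Bdry.plugEq_ne_plug hc (hs ▸ S.cls_obj s))
  | abs hA hJ ihA ihJ => intro s c hs B e hX; cases hX
  | tyRefl h ih =>
    intro s c hs B e hX
    exact absurd (Stmt.base_inj hX) (Bdry.eqTy_ne_plug (hs ▸ S.cls_obj s))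
  | tySym h ih =>
    intro s c hs B e hX
    exact absurd (Stmt.base_inj hX) (Bdry.eqTy_ne_plug (hs ▸ S.cls_obj s))
  | tyTran h h' ih ih' =>
    intro s c hs B e hX
    exact absurd (Stmt.base_inj hX) (Bdry.eqTy_ne_plug (hs ▸ S.cls_obj s))
  | tmRefl h ih =>
    intro s c hs B e hX
    exact absurd (Stmt.base_inj hX) (Bdry.eqTm_ne_plug (hs ▸ S.cls_obj s))
  | tmSym h ih =>
    intro s c hs B e hX
    exact absurd (Stmt.base_inj hX) (Bdry.eqTm_ne_plug (hs ▸ S.cls_obj s))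
  | tmTran h h' ih ih' =>
    intro s c hs B e hX
    exact absurd (Stmt.base_inj hX) (Bdry.eqTm_ne_plug (hs ▸ S.cls_obj s))
  -- Conversion keeps the term and its arguments; it only prolongs the chain of equalities from the
  -- natural type to the given one.
  | @convTm _ _ _ A _ h h' ih ih' =>
    intro s c hs B e hX
    obtain ⟨rfl, hB, he⟩ := Bdry.hasTy_inj (hs ▸ S.cls_obj s) (Stmt.base_inj hX)
    cases hB; cases he
    obtain ⟨d, I, h1, h2, h3, h4⟩ := ih hs (.tm A) e rfl
    exact ⟨d, I, h1, h2, h3, h4.trans (.of_eqTy h')⟩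
  | convEq h h' ih ih' =>
    intro s c hs B e hX
    exact absurd (Stmt.base_inj hX) (Bdry.eqTm_ne_plug (hs ▸ S.cls_obj s))
  | bdryTy => intro s c hs B e hX; cases hX
  | bdryTm hA ih => intro s c hs B e hX; cases hX
  | bdryEqTy hA hB ih ih' => intro s c hs B e hX; cases hX
  | bdryEqTm hA hs ht ih ih' ih'' => intro s c hs B e hX; cases hX
  | bdryAbs hA hB ihA ihB => intro s c hs B e hX; cases hX
  | rule r I hI hB ih ihB =>
    intro s c hs B e hX
    have hc : c.isObj = true := hs ▸ S.cls_obj s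
    have hX' := Bdry.plug_inj hc (Stmt.base_inj hX)
    -- In a standard theory the rule is a symbol rule. Its head is the symbol applied to generic
    -- applications, so comparing heads identifies the symbol and reads off `I` on the premises.
    obtain ⟨s', c', hs', d, hd⟩ := hT.2.1 r (hX'.1 ▸ hc)
    rw [hd] at hX' hI hB
    obtain ⟨h1, h2, h3⟩ := hX'
    change c' = c at h1
    subst h1
    have h3 := eq_of_heq h3
    have h2 := eq_of_heq h2
    simp only [SymRule.toRaw, Arg.inst, Arg.act, Arg.sym.injEq, MVar.gen_act] at h3
    obtain ⟨rfl, h3⟩ := h3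
    refine ⟨d, I, ⟨r, hd⟩, fun i => congrFun (eq_of_heq h3) i, hI, ?_⟩
    rw [← h2]
    exact .refl_of_bdry hB
  | congr r hr I J hI hJ he hC ihI ihJ ihe ihC =>
    intro s c hs B e hX
    exact absurd (Stmt.base_inj hX) (Bdry.plugEq_ne_plug hr (hs ▸ S.cls_obj s))

/-- Standardness makes the index of the rule for a symbol unique; injectivity turns this into
uniqueness of the data, so that natural types are well determined. -/
theorem SymRule.toRaw_injective {s : S.Sym} {c : Cls} (hs : S.cls s = c) :
    Function.Injective (fun d : SymRule S s c => d.toRaw hs) := by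
  rintro ⟨M, P, B⟩ ⟨M', P', B'⟩ h
  simp only [SymRule.toRaw, RawRule.mk.injEq, heq_eq_eq, true_and] at h
  obtain ⟨h1, rfl, -⟩ := h
  have h2 := fun i => congrFun (List.ofFn_injective h1) i
  simp only [Decl.mk.injEq, heq_eq_eq, true_and] at h2
  obtain rfl : M = M' := funext fun i => (h2 i).1
  obtain rfl : P = P' := funext fun i => (h2 i).2
  rfl

theorem RawTT.HasSymRule.unique (hT : T.Standard) {s : S.Sym} {c : Cls} {hs : S.cls s = c}
    {d d' : SymRule S s c} (h : T.HasSymRule hs d) (h' : T.HasSymRule hs d') : d = d' := by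
  subst hs
  obtain ⟨r, hr⟩ := h
  obtain ⟨r', hr'⟩ := h'
  obtain rfl := (hT.2.2 s).unique ⟨d, hr⟩ ⟨d', hr'⟩
  exact SymRule.toRaw_injective rfl (hr.symm.trans hr')

/-! ### Dependence of instantiations on the premises only. -/

theorem ABdry.act_congr_mv {c : Cls} {k : ℕ} (B : ABdry S c k l) (I J : Inst S n)
    (σ : Fin l → Tm S n)
    (h : ∀ ⦃c : Cls⦄ ⦃k : ℕ⦄ (M : MVar c k), ⟨c, k, M⟩ ∈ B.mv → I M = J M) :
    B.act I σ = B.act J σ := by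
  induction B generalizing n with
  | base B =>
    cases B with
    | ty => rfl
    | tm A => simp only [ABdry.act, Bdry.act, Arg.act_congr_mv A I J σ h]
    | eqTy A B =>
      simp only [ABdry.act, Bdry.act, Arg.act_congr_mv A I J σ fun c k M hM => h M (Or.inl hM),
        Arg.act_congr_mv B I J σ fun c k M hM => h M (Or.inr hM)]
    | eqTm s t A =>
      simp only [ABdry.act, Bdry.act,
        Arg.act_congr_mv s I J σ fun c k M hM => h M (Or.inl (Or.inl hM)),
        Arg.act_congr_mv t I J σ fun c k M hM => h M (Or.inl (Or.inr hM)),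
        Arg.act_congr_mv A I J σ fun c k M hM => h M (Or.inr hM)]
  | abs A B ih =>
    simp only [ABdry.act, Arg.act_congr_mv A I J σ fun c k M hM => h M (Or.inl hM)]
    rw [ih I.wk J.wk (liftSub σ) fun c k M hM => congrArg Arg.wk (h M (Or.inr hM))]

theorem ABdry.inst_congr {c : Cls} {k : ℕ} {B : ABdry S c k 0} {I J : Inst S n}
    (hB : B.mv ⊆ MCtx.dom Ξ) (h : ∀ d ∈ Ξ, I d.mvar = J d.mvar) : B.inst I = B.inst J := by
  refine ABdry.act_congr_mv _ _ _ _ fun c k M hM => ?_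
  obtain ⟨d, hd, hk⟩ := hB hM
  cases hk
  exact h d hd

theorem MCtx.Valid.mv_subset (h : Ξ.Valid) {d : Decl S} (hd : d ∈ Ξ) :
    d.bdry.mv ⊆ MCtx.dom Ξ := by
  obtain ⟨Ξ₁, Ξ₂, rfl⟩ := List.append_of_mem hd
  refine (h Ξ₁ Ξ₂ d rfl).2.trans ?_
  rintro M ⟨d', hd', rfl⟩
  exact ⟨d', List.mem_append_left _ hd', rfl⟩

theorem InstDer.congr (hΞ : Ξ.Valid) {I J : Inst S n} (h : ∀ d ∈ Ξ, I d.mvar = J d.mvar)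
    (hI : InstDer T Θ Δ Ξ I) : InstDer T Θ Δ Ξ J := fun d hd => by
  rw [← ABdry.inst_congr (hΞ.mv_subset hd) h, ← h d hd]
  exact hI d hd

theorem SymRule.forall_prem {s : S.Sym} {c : Cls} (d : SymRule S s c) (hs : S.cls s = c)
    {p : Decl S → Prop} :
    (∀ d' ∈ (d.toRaw hs).prem, p d') ↔
      ∀ i, p ⟨S.argCls s i, S.argBinds s i, d.M i, d.premBdry i⟩ := by
  simp only [SymRule.toRaw, List.forall_mem_ofFn_iff]

/-- Inversion for symbol applications. -/
theorem Der.sym_inv (hT : T.Standard) {s : S.Sym} {c : Cls} {hs : S.cls s = c} {B : Bdry S c n}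
    {e : (i : Fin (S.nargs s)) → Arg S (S.argCls s i) (S.argBinds s i) n}
    (h : Der T Θ Δ (.jdg (.base (B.plug (.sym s hs e))))) {d : SymRule S s c}
    (hd : T.HasSymRule hs d) {I : Inst S n} (hI : ∀ i, I (d.M i) = e i) :
    InstDer T Θ Δ (d.toRaw hs).prem I ∧ BdryEq T Θ Δ (d.bdry.inst I) B := by
  obtain ⟨d', I', hd', hI', h1, h2⟩ := Der.sym_inv' hT h hs B e rfl
  obtain rfl := hd.unique hT hd'
  obtain ⟨r, hr⟩ := hd
  have hv : (d.toRaw hs).Valid := hr ▸ T.valid r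
  have hII' : ∀ d' ∈ (d.toRaw hs).prem, I' d'.mvar = I d'.mvar :=
    (d.forall_prem hs).2 fun i => (hI' i).trans (hI i).symm
  refine ⟨h1.congr hv.1 hII', ?_⟩
  have : (ABdry.base d.bdry).inst I' = (ABdry.base d.bdry).inst I :=
    ABdry.inst_congr hv.2.1 hII'
  have : d.bdry.inst I' = d.bdry.inst I := by injection this
  exact this ▸ h2

/-! ### Inversion for applications of metavariables. -/

theorem WfMCtx.decl_unique (h : WfMCtx T Θ) {d d' : Decl S} (hd : d ∈ Θ) (hd' : d' ∈ Θ)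
    (hk : d.key = d'.key) : d = d' := by
  induction h with
  | nil => cases hd
  | snoc _ _ hn ih =>
    rcases List.mem_append.1 hd with h1 | h1 <;> rcases List.mem_append.1 hd' with h2 | h2
    · exact ih h1 h2
    · cases List.mem_singleton.1 h2
      exact absurd ⟨d, h1, hk⟩ hn
    · cases List.mem_singleton.1 h1
      exact absurd ⟨d', h2, hk.symm⟩ hn
    · rw [List.mem_singleton.1 h1, List.mem_singleton.1 h2]

/-- Specific object rules of a standard theory conclude with symbol applications, so `M(ts)` is
typed only by the metavariable rule followed by conversions. -/
theorem Der.mvar_inv' (hT : T.Standard) {X : Stmt S n} (h : Der T Θ Δ X) :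
    ∀ {c : Cls} {k : ℕ} (hc : c.isObj = true) (M : MVar c k) (ts : Fin k → Tm S n)
      (B : Bdry S c n), X = .jdg (.base (B.plug (.mvar hc M ts))) →
      ∃ D : ABdry S c k 0, ⟨c, k, M, D⟩ ∈ Θ ∧ ArgsTyped T Θ Δ (D.wk0 n) ts ts ∧
        BdryEq T Θ Δ ((D.wk0 n).app ts) B := by
  induction h with
  | var a =>
    intro c k hc M ts B hX
    obtain ⟨rfl, -, he⟩ := Bdry.hasTy_inj hc (Stmt.base_inj hX)
    cases he
  | mvar hM ts ht hB ih ihB =>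
    intro c k hc M ts B hX
    obtain ⟨rfl, hB', he⟩ := Bdry.plug_inj hc (Stmt.base_inj hX)
    rw [MVar.app_eq hc] at he
    cases he; cases hB'
    exact ⟨_, hM, ht, .refl_of_bdry hB⟩
  | mvarCongr hM hc' ss ts hs ht he hC ihs iht ihe ihC =>
    intro c k hc M ts B hX
    exact absurd (Stmt.base_inj hX) (Bdry.plugEq_ne_plug hc' hc)
  | abs hA hJ ihA ihJ => intro c k hc M ts B hX; cases hX
  | tyRefl h ih =>
    intro c k hc M ts B hX
    exact absurd (Stmt.base_inj hX) (Bdry.eqTy_ne_plug hc)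
  | tySym h ih =>
    intro c k hc M ts B hX
    exact absurd (Stmt.base_inj hX) (Bdry.eqTy_ne_plug hc)
  | tyTran h h' ih ih' =>
    intro c k hc M ts B hX
    exact absurd (Stmt.base_inj hX) (Bdry.eqTy_ne_plug hc)
  | tmRefl h ih =>
    intro c k hc M ts B hX
    exact absurd (Stmt.base_inj hX) (Bdry.eqTm_ne_plug hc)
  | tmSym h ih =>
    intro c k hc M ts B hX
    exact absurd (Stmt.base_inj hX) (Bdry.eqTm_ne_plug hc)
  | tmTran h h' ih ih' =>
    intro c k hc M ts B hX
    exact absurd (Stmt.base_inj hX) (Bdry.eqTm_ne_plug hc)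
  | @convTm _ _ _ A _ h h' ih ih' =>
    intro c k hc M ts B hX
    obtain ⟨rfl, hB, he⟩ := Bdry.hasTy_inj hc (Stmt.base_inj hX)
    cases hB; cases he
    obtain ⟨D, h1, h2, h3⟩ := ih hc M ts (.tm A) rfl
    exact ⟨D, h1, h2, h3.trans (.of_eqTy h')⟩
  | convEq h h' ih ih' =>
    intro c k hc M ts B hX
    exact absurd (Stmt.base_inj hX) (Bdry.eqTm_ne_plug hc)
  | bdryTy => intro c k hc M ts B hX; cases hX
  | bdryTm hA ih => intro c k hc M ts B hX; cases hX
  | bdryEqTy hA hB ih ih' => intro c k hc M ts B hX; cases hX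
  | bdryEqTm hA hs ht ih ih' ih'' => intro c k hc M ts B hX; cases hX
  | bdryAbs hA hB ihA ihB => intro c k hc M ts B hX; cases hX
  | rule r I hI hB ih ihB =>
    intro c k hc M ts B hX
    have hX' := Bdry.plug_inj hc (Stmt.base_inj hX)
    obtain ⟨s', c', hs', d, hd⟩ := hT.2.1 r (hX'.1 ▸ hc)
    rw [hd] at hX'
    obtain ⟨h1, -, h3⟩ := hX'
    change c' = c at h1
    subst h1
    cases eq_of_heq h3
  | congr r hr I J hI hJ he hC ihI ihJ ihe ihC =>
    intro c k hc M ts B hX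
    exact absurd (Stmt.base_inj hX) (Bdry.plugEq_ne_plug hr hc)

/-- Inversion for applications of metavariables. -/
theorem Der.mvar_inv (hT : T.Standard) (hΘ : WfMCtx T Θ) {c : Cls} {k : ℕ} {hc : c.isObj = true}
    {M : MVar c k} {ts : Fin k → Tm S n} {B : Bdry S c n}
    (h : Der T Θ Δ (.jdg (.base (B.plug (.mvar hc M ts))))) {D : ABdry S c k 0}
    (hM : ⟨c, k, M, D⟩ ∈ Θ) :
    ArgsTyped T Θ Δ (D.wk0 n) ts ts ∧ BdryEq T Θ Δ ((D.wk0 n).app ts) B := by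
  obtain ⟨D', h1, h2, h3⟩ := h.mvar_inv' hT hc M ts B rfl
  cases hΘ.decl_unique hM h1 rfl
  exact ⟨h2, h3⟩

end

section

variable {T : RawTT.{u, v} S} {Θ Θ' Ξ : MCtx S} {l n : ℕ} {Γ : Ctx S l} {Δ : Ctx S n}

theorem Der.mvar_gen {d : Decl S} (hd : d ∈ Θ) {ts : Fin d.k → Tm S n}
    (ht : ArgsTyped T Θ Δ (d.bdry.inst Inst.id) ts ts)
    (hB : Der T Θ Δ (.bdry (.base ((d.bdry.inst Inst.id).app ts)))) :
    Der T Θ Δ (.jdg (.base (((d.bdry.inst Inst.id).app ts).plug (d.mvar.gen.app ts)))) := by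
  rw [MVar.gen_app]; exact Der.mvar_id hd ht hB

theorem Der.mvarCongr_gen {d : Decl S} (hd : d ∈ Θ) (hc : d.c.isObj = true)
    {ss ts : Fin d.k → Tm S n} (hs : ArgsTyped T Θ Δ (d.bdry.inst Inst.id) ss ss)
    (ht : ArgsTyped T Θ Δ (d.bdry.inst Inst.id) ts ts)
    (he : ArgsEq T Θ Δ (d.bdry.inst Inst.id) ss ts)
    (hC : BdryEq T Θ Δ ((d.bdry.inst Inst.id).app ss) ((d.bdry.inst Inst.id).app ts)) :
    Der T Θ Δ (.jdg (.base (((d.bdry.inst Inst.id).app ss).plugEq hc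
      (d.mvar.gen.app ss) (d.mvar.gen.app ts)))) := by
  rw [MVar.gen_app, MVar.gen_app]; exact Der.mvarCongr_id hd hc hs ht he hC

/-! ### Variables as metavariables -/

/-- A renaming of metavariables to names that are even and not smaller than `N`. -/
def shiftMVar (N : ℕ) ⦃c : Cls⦄ ⦃k : ℕ⦄ (M : MVar c k) : MVar c k := ⟨2 * (M.name + N)⟩

/-- Metavariables, with odd names not smaller than `N`, that stand for variables. -/
def varMVar (N i : ℕ) : MVar .tm 0 := ⟨2 * (i + N) + 1⟩

/-- The substitution of metavariables for variables. -/
def closeSub (N : ℕ) : Fin n → Tm S 0 :=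
  -- The reversal passes from de Bruijn indices to levels: the metavariable of a variable stays the
  -- same when the context is extended.
  fun x => .mvar rfl (varMVar N x.rev) (fun j => j.elim0)

theorem closeSub_succ (N : ℕ) :
    (closeSub N : Fin (n + 1) → Tm S 0) =
      consSub (.mvar rfl (varMVar N n) (fun j => j.elim0)) (closeSub N) := by
  funext x
  cases x using Fin.cases with
  | zero => simp [closeSub, consSub, Fin.rev]
  | succ y => simp [closeSub, consSub, Fin.rev]

/-- The declarations of the metavariables that stand for the variables of `Γ`. -/
def closeCtx (N : ℕ) : {n : ℕ} → Ctx S n → MCtx S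
  | _, .nil => []
  | n + 1, .snoc Γ A => closeCtx N Γ ++
      [⟨.tm, 0, varMVar N n, .base (.tm (A.act (renInst (shiftMVar N)) (closeSub N)))⟩]

/-- The metavariable context that consists of the renamed entries of `Θ` and of metavariables for
the variables of `Γ`. -/
def closure (N : ℕ) (Θ : MCtx S) {n : ℕ} (Γ : Ctx S n) : MCtx S :=
  Θ.map (Decl.rename (shiftMVar N)) ++ closeCtx N Γ

theorem mem_closeCtx {N : ℕ} {d : Decl S} :
    d ∈ closeCtx N Δ ↔ ∃ x : Fin n, d = ⟨.tm, 0, varMVar N x.rev,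
      .base (.tm ((Δ.get x).act (renInst (shiftMVar N)) (closeSub N)))⟩ := by
  induction Δ with
  | nil => exact ⟨fun h => (by cases h), fun ⟨x, _⟩ => x.elim0⟩
  | @snoc n Δ A ih =>
    have h0 : ((Δ.snoc A).get 0).act (renInst (shiftMVar N)) (closeSub N) =
        A.act (renInst (shiftMVar N)) (closeSub N) := by
      rw [closeSub_succ]; exact Arg.wk_act_consSub _ _ _ _
    have hs : ∀ x : Fin n, ((Δ.snoc A).get x.succ).act (renInst (shiftMVar N)) (closeSub N) =
        (Δ.get x).act (renInst (shiftMVar N)) (closeSub N) := by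
      intro x
      rw [closeSub_succ]; exact Arg.wk_act_consSub _ _ _ _
    rw [Fin.exists_fin_succ, h0, closeCtx, List.mem_append, List.mem_singleton, ih]
    simp only [hs, Fin.rev_succ, Fin.val_castSucc]
    rw [or_comm]
    simp [Fin.rev]

theorem key_name {c c' : Cls} {k k' : ℕ} {M : MVar c k} {M' : MVar c' k'}
    (h : (⟨c, k, M⟩ : AnyMVar) = ⟨c', k', M'⟩) : M.name = M'.name := by
  cases h; rfl

theorem WfMCtx.rename (N : ℕ) (h : WfMCtx T Θ) : WfMCtx T (Θ.map (Decl.rename (shiftMVar N))) := by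
  induction h with
  | nil => exact .nil
  | @snoc Θ d hΘ hd hn ih =>
    rw [List.map_append]
    refine .snoc ih (hd.rename (fun d hd => List.mem_map_of_mem hd) (SubTyped.nil _)) ?_
    rintro ⟨d', hd', hk⟩
    obtain ⟨d', hd', rfl⟩ := List.mem_map.1 hd'
    refine hn ⟨d', ‹_›, ?_⟩
    obtain ⟨c, k, ⟨a⟩, B⟩ := d
    obtain ⟨c', k', ⟨a'⟩, B'⟩ := d'
    simp only [Decl.key, Decl.rename, shiftMVar, Sigma.mk.injEq] at hk ⊢
    obtain ⟨rfl, hk⟩ := hk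
    have hk := eq_of_heq hk
    simp only [Sigma.mk.injEq] at hk
    obtain ⟨rfl, hk⟩ := hk
    have hk := eq_of_heq hk
    simp only [MVar.mk.injEq] at hk
    obtain rfl : a' = a := by omega
    exact ⟨rfl, HEq.rfl⟩

theorem rename_mem_closure (N : ℕ) (Δ : Ctx S n) {d : Decl S} (hd : d ∈ Θ) :
    d.rename (shiftMVar N) ∈ closure N Θ Δ :=
  List.mem_append_left _ (List.mem_map_of_mem hd)

theorem WfCtx.closure (N : ℕ) (h : WfCtx T Θ Δ) :
    WfMCtx T (closure N Θ Δ) ∧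
      SubTyped T (FTT.closure N Θ Δ) Δ .nil (renInst (shiftMVar N)) (closeSub N) := by
  induction h with
  | nil hΘ =>
    refine ⟨?_, SubTyped.nil _⟩
    rw [FTT.closure, closeCtx, List.append_nil]
    exact hΘ.rename N
  | @snoc n Δ A hΔ hA ih =>
    have h1 := hA.rename (fun d hd => rename_mem_closure N Δ hd) ih.2
    have hc : FTT.closure N Θ (Δ.snoc A) = FTT.closure N Θ Δ ++
      [⟨.tm, 0, varMVar N n, .base (.tm (A.act (renInst (shiftMVar N)) (closeSub N)))⟩] :=
      (List.append_assoc _ _ _).symm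
    rw [hc, closeSub_succ]
    refine ⟨.snoc ih.1 (.bdryTm h1) ?_, SubTyped.cons (fun a => (ih.2 a).mono
      (List.subset_append_left _ _)) ?_⟩
    · rintro ⟨d', hd', hk⟩
      rcases List.mem_append.1 hd' with hd' | hd'
      · obtain ⟨d', hd', rfl⟩ := List.mem_map.1 hd'
        have := key_name hk
        simp only [Decl.rename, shiftMVar, varMVar] at this
        omega
      · obtain ⟨x, rfl⟩ := mem_closeCtx.1 hd'
        have := key_name hk
        simp only [varMVar] at this
        omega
    · have := Der.mvar_id (T := T) (Δ := .nil) (List.mem_append_right (FTT.closure N Θ Δ)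
        (List.mem_singleton_self (⟨.tm, 0, varMVar N n,
          .base (.tm (A.act (renInst (shiftMVar N)) (closeSub N)))⟩ : Decl S)))
        (ts := fun j => j.elim0) (fun j => j.elim0) (by
          rw [ABdry.inst_id]
          exact .bdryTm (h1.mono (List.subset_append_left _ _)))
      rw [ABdry.inst_id] at this
      exact this

/-- The inverse of closing. Even names come from `Θ` and return to the original metavariables, odd
ones stand for variables; on all other names the value is arbitrary. -/
theorem exists_openInst (N n : ℕ) : ∃ K : Inst S n,
    (∀ (c : Cls) (k : ℕ) (M : MVar c k), K (shiftMVar N M) = M.gen) ∧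
    ∀ x : Fin n, K (varMVar N x.rev) = .var x := by
  classical
  refine ⟨fun c k M =>
    if M.name % 2 = 0 then (⟨M.name / 2 - N⟩ : MVar c k).gen
    else if h : ∃ (h : c = .tm ∧ k = 0) (x : Fin n), M.name = 2 * (x.rev + N) + 1 then
      (h.choose.1 ▸ h.choose.2 ▸ .var h.choose_spec.choose : Arg S c k n)
    else M.gen, ?_, ?_⟩
  · intro c k M
    have h1 : (shiftMVar N M).name % 2 = 0 := by simp only [shiftMVar]; omega
    have h2 : (⟨(shiftMVar N M).name / 2 - N⟩ : MVar c k) = M := by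
      cases M; simp only [shiftMVar, MVar.mk.injEq]; omega
    simp only [h1, if_true, h2]
  · intro x
    have h1 : ¬ (varMVar N x.rev).name % 2 = 0 := by simp only [varMVar]; omega
    have h2 : ∃ (_ : Cls.tm = .tm ∧ 0 = 0) (y : Fin n),
        (varMVar N x.rev).name = 2 * (y.rev + N) + 1 := ⟨⟨rfl, rfl⟩, x, rfl⟩
    beta_reduce
    rw [if_neg h1, dif_pos h2]
    have h3 : 2 * ((x.rev : ℕ) + N) + 1 = 2 * ((h2.choose_spec.choose.rev : ℕ) + N) + 1 :=
      h2.choose_spec.choose_spec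
    have h4 : x.rev = (h2.choose_spec.choose).rev := Fin.ext (by omega)
    change Arg.var _ = _
    rw [← Fin.rev_injective h4]

theorem renInst_act_open {N : ℕ} {K : Inst S n}
    (hK : ∀ (c : Cls) (k : ℕ) (M : MVar c k), K (shiftMVar N M) = M.gen) (σ : Fin l → Tm S n) :
    (renInst (shiftMVar N) : Inst S l).act K σ = Inst.id := by
  rw [renInst_act]; funext c k M; exact hK c k M

/-- Instances of rules that are closed by metavariables for variables are recovered by
substitution for these metavariables. -/
theorem closed_act_open {N : ℕ} {m : ℕ} {K : Inst S m} {ρ : Fin n → Fin m}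
    (hK : ∀ (c : Cls) (k : ℕ) (M : MVar c k), K (shiftMVar N M) = M.gen)
    (hKv : ∀ x : Fin n, K (varMVar N x.rev) = .var (ρ x)) (I : Inst S n) (σ : Fin 0 → Tm S m) :
    (I.act (renInst (shiftMVar N)) (closeSub N)).act K σ = I.ren ρ := by
  rw [Inst.act_act, renInst_act_open hK, Inst.ren_eq_act]
  congr 1; funext x; exact hKv x

theorem closed_arg_act_open {N : ℕ} {m : ℕ} {K : Inst S m} {ρ : Fin n → Fin m}
    (hK : ∀ (c : Cls) (k : ℕ) (M : MVar c k), K (shiftMVar N M) = M.gen)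
    (hKv : ∀ x : Fin n, K (varMVar N x.rev) = .var (ρ x)) {c : Cls} {k : ℕ} (e : Arg S c k n)
    (σ : Fin 0 → Tm S m) :
    (e.act (renInst (shiftMVar N)) (closeSub N)).act K σ = e.ren ρ := by
  rw [Arg.act_act, renInst_act_open hK, Arg.ren_eq_act]
  congr 1; funext x; exact hKv x

/-- Derivations over a residue are turned into derivations over `Θ; Δ` when those instances of the
equality entries are derivable whose boundaries are derivable. -/
theorem Der.of_residue (hΔ : WfCtx T Θ Δ) {N : ℕ} {K : Inst S n}
    (hK : ∀ (c : Cls) (k : ℕ) (M : MVar c k), K (shiftMVar N M) = M.gen)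
    (hKv : ∀ x : Fin n, K (varMVar N x.rev) = .var x) {I : Inst S n}
    (hEq : ∀ d ∈ Ξ, d.c.isObj = false → ∀ {m : ℕ} {Δ' : Ctx S m} {ρ : Fin n → Fin m},
      WfCtx T Θ Δ' → ∀ ts, ArgsTyped T Θ Δ' (d.bdry.inst (I.ren ρ)) ts ts →
      Der T Θ Δ' (.bdry (.base ((d.bdry.inst (I.ren ρ)).app ts))) →
      ∀ e, Der T Θ Δ' (.jdg (.base (((d.bdry.inst (I.ren ρ)).app ts).plug e))))
    {X : Stmt S 0} (h : Der T (residue (closure N Θ Δ) Ξ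
      (I.act (renInst (shiftMVar N)) (closeSub N))) .nil X) :
    Der T Θ Δ (X.act K (fun i => i.elim0)) := by
  have hmem : ∀ {m : ℕ} (ρ : Fin n → Fin m), ∀ d ∈ residue (closure N Θ Δ) Ξ
      (I.act (renInst (shiftMVar N)) (closeSub N)),
      (∃ d' ∈ Θ, d = d'.rename (shiftMVar N) ∧
        (d'.rename (shiftMVar N)).bdry.inst (K.ren ρ) = d'.bdry.inst Inst.id ∧
        K.ren ρ (d'.rename (shiftMVar N)).mvar = d'.mvar.gen) ∨
      (∃ x : Fin n, d = ⟨.tm, 0, varMVar N x.rev,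
        .base (.tm ((Δ.get x).act (renInst (shiftMVar N)) (closeSub N)))⟩) ∨
      (∃ d' ∈ Ξ, d'.c.isObj = false ∧ d = ⟨d'.c, d'.k, d'.mvar,
        d'.bdry.inst (I.act (renInst (shiftMVar N)) (closeSub N))⟩) := by
    intro m ρ d hd
    rcases List.mem_append.1 hd with hd | hd
    · rcases List.mem_append.1 hd with hd | hd
      · obtain ⟨d', hd', rfl⟩ := List.mem_map.1 hd
        refine Or.inl ⟨d', hd', rfl, ?_, ?_⟩
        · change (d'.bdry.inst _).inst _ = _
          rw [ABdry.inst, ABdry.inst_act, renInst_act_open]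
          intro c k M; rw [Inst.ren, hK, MVar.gen_ren]
        · change (K (shiftMVar N d'.mvar)).ren ρ = _
          rw [hK, MVar.gen_ren]
      · exact Or.inr (Or.inl (mem_closeCtx.1 hd))
    · obtain ⟨d', hd', rfl⟩ := List.mem_map.1 hd
      obtain ⟨h1, h2⟩ := List.mem_filter.1 hd'
      exact Or.inr (Or.inr ⟨d', h1, by simpa using h2, rfl⟩)
  have hKρ : ∀ {m : ℕ} (ρ : Fin n → Fin m) (c : Cls) (k : ℕ) (M : MVar c k),
      K.ren ρ (shiftMVar N M) = M.gen := by
    intro m ρ c k M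
    rw [Inst.ren, hK, MVar.gen_ren]
  have hKvρ : ∀ {m : ℕ} (ρ : Fin n → Fin m) (x : Fin n),
      K.ren ρ (varMVar N x.rev) = .var (ρ x) := by
    intro m ρ x
    rw [Inst.ren, hKv]; rfl
  -- The opening instantiation is weakened at each binder. The class therefore contains all its
  -- renamings `K.ren ρ` into well-formed contexts, and the hypothesis on equality entries must
  -- cover these as well.
  refine Der.act_of (Θ' := Θ) (fun {l m} Γ' Δ' K' σ => WfCtx T Θ Δ' ∧
    (∃ ρ : Fin n → Fin m, RenTyped Δ Δ' ρ ∧ K' = K.ren ρ) ∧ SubTyped T Θ Γ' Δ' K' σ)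
    ?_ ?_ ?_ ?_ h ⟨hΔ, ⟨fun x => x, RenTyped.id Δ, K.ren_id.symm⟩, SubTyped.nil _⟩
  · rintro l m Γ' Δ' _ σ A ⟨hΔ', ⟨ρ, hρ, rfl⟩, hσ⟩ hA
    exact ⟨.snoc hΔ' hA, ⟨_, hρ.succ _, Inst.ren_ren _ _ _⟩, hσ.lift A⟩
  · rintro l m Γ' Δ' _ σ ⟨hΔ', ⟨ρ, hρ, rfl⟩, hσ⟩ a
    exact hσ a
  · rintro l m Γ' Δ' _ σ ⟨hΔ', ⟨ρ, hρ, rfl⟩, hσ⟩ d hd ts ht hB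
    rcases hmem ρ d hd with ⟨d', hd', rfl, h1, h2⟩ | ⟨x, rfl⟩ | ⟨d', hd', hc, rfl⟩
    · rw [h1] at ht hB ⊢
      rw [h2]
      exact Der.mvar_gen hd' ht hB
    · change Der T Θ Δ' (.jdg (.base (.hasTy (K.ren ρ (varMVar N x.rev))
        (Arg.act (Arg.act (Δ.get x) _ _) (K.ren ρ) _))))
      rw [hKvρ, closed_arg_act_open (hKρ ρ) (hKvρ ρ), ← hρ x]
      exact .var _
    · have h1 : (d'.bdry.inst (I.act (renInst (shiftMVar N)) (closeSub N))).inst (K.ren ρ) =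
          d'.bdry.inst (I.ren ρ) := by
        rw [ABdry.inst, ABdry.inst_act, closed_act_open (hKρ ρ) (hKvρ ρ)]
      dsimp only at ht hB ⊢
      rw [h1] at ht hB ⊢
      -- An equality premise is used here. The metavariable rule provides its typed arguments and
      -- its derivable boundary, which is all that the hypothesis asks for.
      exact hEq d' hd' hc hΔ' ts ht hB _
  · rintro l m Γ' Δ' _ σ ⟨hΔ', ⟨ρ, hρ, rfl⟩, hσ⟩ d hd hc ss ts hs ht he hC
    rcases hmem ρ d hd with ⟨d', hd', rfl, h1, h2⟩ | ⟨x, rfl⟩ | ⟨d', hd', hc', rfl⟩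
    · rw [h1] at hs ht he hC ⊢
      rw [h2]
      exact Der.mvarCongr_gen hd' hc hs ht he hC
    -- A metavariable that codes a variable has no arguments, so its congruence is reflexivity.
    -- Equality metavariables, in the last case, have no congruence rule.
    · change Der T Θ Δ' (.jdg (.base (.eqTm (K.ren ρ (varMVar N x.rev))
        (K.ren ρ (varMVar N x.rev)) (Arg.act (Arg.act (Δ.get x) _ _) (K.ren ρ) _))))
      rw [hKvρ, closed_arg_act_open (hKρ ρ) (hKvρ ρ), ← hρ x]
      exact .tmRefl (.var _)
    · dsimp only at hc
      rw [hc'] at hc; cases hc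

/-! ### Object-invertibility over arbitrary variable contexts. -/

theorem MCtx.exists_name_lt (Ξ : MCtx S) : ∃ N, ∀ d ∈ Ξ, d.mvar.name < N := by
  induction Ξ with
  | nil => exact ⟨0, fun d hd => by cases hd⟩
  | cons d Ξ ih =>
    obtain ⟨N, hN⟩ := ih
    refine ⟨max N (d.mvar.name + 1), fun d' hd' => ?_⟩
    rcases List.mem_cons.1 hd' with rfl | hd'
    · exact lt_max_of_lt_right (Nat.lt_succ_self _)
    · exact lt_max_of_lt_left (hN d' hd')

/-- Instantiations that match the conclusion of an object-invertible rule are derivable when those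
instances of its equality premises are derivable whose boundaries are derivable. -/
theorem RawRule.ObjInvertible.instDer {R : RawRule S} (hR : R.ObjInvertible T)
    (hΔ : WfCtx T Θ Δ) {I : Inst S n} (hI : I.Over R.prem Θ)
    (h : Der T Θ Δ (.jdg (R.concl I)))
    (hEq : ∀ d ∈ R.prem, d.c.isObj = false → ∀ {m : ℕ} {Δ' : Ctx S m} {ρ : Fin n → Fin m},
      WfCtx T Θ Δ' → ∀ ts, ArgsTyped T Θ Δ' (d.bdry.inst (I.ren ρ)) ts ts →
      Der T Θ Δ' (.bdry (.base ((d.bdry.inst (I.ren ρ)).app ts))) →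
      ∀ e, Der T Θ Δ' (.jdg (.base (((d.bdry.inst (I.ren ρ)).app ts).plug e)))) :
    InstDer T Θ Δ R.prem I := by
  -- All names of the rule lie below `N` and all names of the closure are at least `N`. This yields
  -- the disjointness required by object-invertibility.
  obtain ⟨N, hN⟩ := R.prem.exists_name_lt
  obtain ⟨K, hK, hKv⟩ := exists_openInst (S := S) N n
  obtain ⟨hwf, hsub⟩ := hΔ.closure N
  have hdisj : Disjoint (MCtx.dom R.prem) (MCtx.dom (closure N Θ Δ)) := by
    rw [Set.disjoint_left]
    rintro _ ⟨d, hd, rfl⟩ ⟨d', hd', hk⟩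
    have h1 := hN d hd
    have h2 := key_name hk
    rcases List.mem_append.1 hd' with hd' | hd'
    · obtain ⟨d', -, rfl⟩ := List.mem_map.1 hd'
      simp only [Decl.rename, shiftMVar] at h2
      omega
    · obtain ⟨x, rfl⟩ := mem_closeCtx.1 hd'
      simp only [varMVar] at h2
      omega
  have hover : (I.act (renInst (shiftMVar N)) (closeSub N)).Over R.prem (closure N Θ Δ) := by
    intro d hd
    refine Arg.mv_act_subset _ _ _ (fun c k M hM => ?_) fun x => ?_
    · obtain ⟨d', hd', hk⟩ := hI d hd hM
      refine (MVar.mv_gen_subset _).trans (Set.singleton_subset_iff.2 ?_)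
      cases hk
      exact ⟨_, rename_mem_closure N Δ hd', rfl⟩
    · refine Set.union_subset (Set.singleton_subset_iff.2 ?_)
        (Set.iUnion_subset fun j => j.elim0)
      exact ⟨_, List.mem_append_right _ (mem_closeCtx.2 ⟨x, rfl⟩), rfl⟩
  have hconcl : Der T (closure N Θ Δ) .nil
      (.jdg (R.concl (I.act (renInst (shiftMVar N)) (closeSub N)))) := by
    rw [← RawRule.concl_act]
    exact h.rename (fun d hd => rename_mem_closure N Δ hd) hsub
  have hres := hR.2 _ _ hwf hdisj hover hconcl
  intro d hd
  have h1 := Der.of_residue hΔ hK hKv hEq (hres d hd)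
  -- Opening the residual instantiation gives back `I`: on object metavariables because opening
  -- undoes closing, on equality metavariables because there is only one possible value.
  have h2 : (Inst.residual (I.act (renInst (shiftMVar N)) (closeSub N))).act K
      (fun i => i.elim0) = I := by
    funext c k M
    cases hc : c.isObj
    · exact Arg.eq_of_not_isObj hc _ _
    · have h3 : Inst.residual (I.act (renInst (shiftMVar N)) (closeSub N)) M =
          (I.act (renInst (shiftMVar N)) (closeSub N)) M := if_pos hc
      have h4 := closed_act_open hK hKv I (fun i => i.elim0)
      rw [Inst.ren_id] at h4
      change (Inst.residual _ M).act K _ = _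
      rw [h3]
      exact congrFun (congrFun (congrFun h4 c) k) M
  simp only [Stmt.act, ABdry.plug_act, ABdry.inst_act, h2] at h1
  have h5 := congrFun (congrFun (congrFun h2 d.c) d.k) d.mvar
  rw [← h5]
  exact h1

end

section

variable {T : RawTT.{u, v} S} {Θ Θ' Ξ : MCtx S} {l n : ℕ} {Γ : Ctx S l} {Δ : Ctx S n}

/-! ### Equation boundaries -/

theorem ABdry.exists_eqBdry_ty {k n : ℕ} (B : ABdry S .eqTy k n) :
    ∃ (B' : ABdry S .ty k n) (a a' : Arg S .ty k n), B = B'.eqBdry rfl a a' := by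
  induction k generalizing n with
  | zero =>
    cases B with
    | base B =>
      cases B with
      | eqTy A A' => exact ⟨.base .ty, A, A', rfl⟩
  | succ k ih =>
    cases B with
    | abs A B =>
      obtain ⟨B', a, a', rfl⟩ := ih B
      exact ⟨.abs A B', .abs a, .abs a', rfl⟩

theorem ABdry.exists_eqBdry_tm {k n : ℕ} (B : ABdry S .eqTm k n) :
    ∃ (B' : ABdry S .tm k n) (a a' : Arg S .tm k n), B = B'.eqBdry rfl a a' := by
  induction k generalizing n with
  | zero =>
    cases B with
    | base B =>
      cases B with
      | eqTm s t A => exact ⟨.base (.tm A), s, t, rfl⟩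
  | succ k ih =>
    cases B with
    | abs A B =>
      obtain ⟨B', a, a', rfl⟩ := ih B
      exact ⟨.abs A B', .abs a, .abs a', rfl⟩

theorem Decl.exists_eqBdry (d : Decl S) (hd : d.c.isObj = false) :
    ∃ (c : Cls) (hc : c.isObj = true) (k : ℕ) (M : MVar c.eqOf k) (B : ABdry S c k 0)
      (a a' : Arg S c k 0), d = ⟨c.eqOf, k, M, B.eqBdry hc a a'⟩ := by
  obtain ⟨c, k, M, B⟩ := d
  cases c
  · cases hd
  · cases hd
  · obtain ⟨B', a, a', rfl⟩ := ABdry.exists_eqBdry_ty B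
    exact ⟨.ty, rfl, k, M, B', a, a', rfl⟩
  · obtain ⟨B', a, a', rfl⟩ := ABdry.exists_eqBdry_tm B
    exact ⟨.tm, rfl, k, M, B', a, a', rfl⟩

theorem Der.eqBdry_base_inv {c : Cls} (hc : c.isObj = true) {B : Bdry S c n} {e e' : Arg S c 0 n}
    (h : Der T Θ Δ (.bdry (.base (B.eqBdry hc e e')))) :
    Der T Θ Δ (.jdg (.base (B.plug e))) ∧ Der T Θ Δ (.jdg (.base (B.plug e'))) := by
  cases B with
  | ty => cases h; exact ⟨‹_›, ‹_›⟩
  | tm A => cases h; exact ⟨‹_›, ‹_›⟩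
  | eqTy => cases hc
  | eqTm => cases hc

theorem Der.eqBdry_inv {c : Cls} (hc : c.isObj = true) {k : ℕ} {B : ABdry S c k n}
    {e e' : Arg S c k n} (h : Der T Θ Δ (.bdry (B.eqBdry hc e e'))) :
    Der T Θ Δ (.jdg (B.plug e)) ∧ Der T Θ Δ (.jdg (B.plug e')) := by
  induction B with
  | base B => exact h.eqBdry_base_inv hc
  | abs A B ih =>
    obtain ⟨hA, hB⟩ := Der.bdryAbs_inv h
    obtain ⟨h1, h2⟩ := ih hc hB
    exact ⟨.abs hA h1, .abs hA h2⟩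

theorem Der.abs_plugEq_refl {c : Cls} (hc : c.isObj = true) {k : ℕ} {B : ABdry S c k n}
    {e : Arg S c k n} (h : Der T Θ Δ (.jdg (B.plug e))) :
    Der T Θ Δ (.jdg (B.plugEq hc e e)) := by
  induction B with
  | base B => exact Der.plugEq_refl hc h
  | abs A B ih => exact .abs (Der.abs_inv h).1 (ih hc (Der.abs_inv h).2)

/-! ### Congruence for symbols and metavariables -/

theorem WfMCtx.nodup_keys (h : WfMCtx T Ξ) : (Ξ.map Decl.key).Nodup := by
  induction h with
  | nil => exact List.nodup_nil
  | snoc _ _ hn ih =>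
    rw [List.map_append]
    refine List.nodup_append.2 ⟨ih, List.nodup_singleton _, ?_⟩
    intro a ha b hb hab
    obtain ⟨d', hd', rfl⟩ := List.mem_map.1 ha
    rw [List.map_singleton, List.mem_singleton] at hb
    exact hn ⟨d', hd', hab.trans hb⟩

/-- There is an instantiation with prescribed values on the premises of a symbol rule. -/
theorem SymRule.exists_inst {s : S.Sym} {c : Cls} (d : SymRule S s c) (hs : S.cls s = c)
    (hd : WfMCtx T (d.toRaw hs).prem)
    (e : (i : Fin (S.nargs s)) → Arg S (S.argCls s i) (S.argBinds s i) n) :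
    ∃ I : Inst S n, ∀ i, I (d.M i) = e i := by
  classical
  let key : Fin (S.nargs s) → AnyMVar := fun i => ⟨S.argCls s i, S.argBinds s i, d.M i⟩
  -- The premises declare distinct metavariables, so prescribing a value for each of them is
  -- consistent.
  have hinj : Function.Injective key := by
    have := hd.nodup_keys
    rw [SymRule.toRaw, List.map_ofFn, List.nodup_ofFn] at this
    exact this
  let F : (x : AnyMVar) → Arg S x.1 x.2.1 n := fun x =>
    if h : ∃ i, key i = x then h.choose_spec ▸ e h.choose else x.2.2.gen
  have hF : ∀ i, F (key i) = e i := by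
    intro i
    have h : ∃ j, key j = key i := ⟨i, rfl⟩
    have h1 : ∀ j (hj : key j = key i),
        (hj ▸ e j : Arg S (key i).1 (key i).2.1 n) = e i := by
      intro j hj
      obtain rfl := hinj hj
      rfl
    simp only [F]
    rw [dif_pos h]
    exact h1 _ h.choose_spec
  exact ⟨fun c k M => F ⟨c, k, M⟩, hF⟩

theorem Der.sym_congr (hT : T.Finitary) (hΔ : WfCtx T Θ Δ) {s : S.Sym} {c : Cls}
    (hs : S.cls s = c) (hc : c.isObj = true) {d : SymRule S s c} (hd : T.HasSymRule hs d)
    {I J : Inst S n} (hI : InstDer T Θ Δ (d.toRaw hs).prem I)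
    (hJ : InstDer T Θ Δ (d.toRaw hs).prem J) (he : InstEq T Θ Δ (d.toRaw hs).prem I J) :
    Der T Θ Δ (.jdg (.base ((d.bdry.inst I).plugEq hc (.sym s hs fun i => I (d.M i))
      (.sym s hs fun i => J (d.M i))))) := by
  obtain ⟨r, hr⟩ := hd
  have hfin := (hT r).2
  have key : ∀ R : RawRule S, T.rule r = R → ∀ hc : R.c.isObj = true,
      InstDer T Θ Δ R.prem I → InstDer T Θ Δ R.prem J → InstEq T Θ Δ R.prem I J →
      Der T Θ Δ (.jdg (.base ((R.bdry.inst I).plugEq hc (R.head.inst I) (R.head.inst J)))) := by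
    rintro _ rfl hc hI hJ he
    refine .congr r hc I J hI hJ he fun C hC => ?_
    -- The premise of the congruence rule about types follows by letting the two equal
    -- instantiations act on the conclusion boundary, which is well formed over the premises.
    have hB : BdryEq T Θ Δ ((T.rule r).bdry.inst I) ((T.rule r).bdry.inst J) :=
      hfin.instEq hT (he.actEq hΔ hI hJ)
    exact hB _ _ (by rw [Bdry.objTy_inst_eq, hC]; rfl) (by rw [Bdry.objTy_inst_eq, hC]; rfl)
  have h := key _ hr hc hI hJ he
  simp only [SymRule.toRaw, Arg.inst, Arg.act, MVar.gen_act] at h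
  exact h

theorem Der.mvar_congr (hΔ : WfCtx T Θ Δ) {c : Cls} {k : ℕ} (hc : c.isObj = true) {M : MVar c k}
    {D : ABdry S c k 0} (hM : ⟨c, k, M, D⟩ ∈ Θ) {ss ts : Fin k → Tm S n}
    (hs : ArgsTyped T Θ Δ (D.wk0 n) ss ss) (ht : ArgsTyped T Θ Δ (D.wk0 n) ts ts)
    (he : ArgsEq T Θ Δ (D.wk0 n) ss ts) :
    Der T Θ Δ (.jdg (.base (((D.wk0 n).app ss).plugEq hc (.mvar hc M ss) (.mvar hc M ts)))) := by
  have hD := hΔ.mctx.bdry_id hM Δ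
  rw [← ABdry.wk0_eq_inst] at hD
  rw [← MVar.app_eq, ← MVar.app_eq]
  exact .mvarCongr hM hc ss ts hs ht he (hD.bdry_app_eq hs ht he)

/-- A boundary mentions only earlier entries. Once these are derivable, so is its instance, and each
entry may be treated under that assumption. -/
theorem WfMCtx.instDer (hΞ : WfMCtx T Ξ) {I : Inst S n}
    (h : ∀ d ∈ Ξ, Der T Θ Δ (.bdry (d.bdry.inst I)) →
      Der T Θ Δ (.jdg ((d.bdry.inst I).plug (I d.mvar)))) : InstDer T Θ Δ Ξ I := by
  induction hΞ with
  | nil => intro d hd; cases hd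
  | @snoc Ξ d _ hd _ ih =>
    have h1 := ih fun d' hd' => h d' (List.mem_append_left _ hd')
    intro d' hd'
    rcases List.mem_append.1 hd' with hd'' | hd''
    · exact h1 d' hd''
    · cases List.mem_singleton.1 hd''
      exact h d hd' (h1.bdry hd)

theorem Arg.mvar_act_id {c : Cls} {k : ℕ} (hc : c.isObj = true) (M : MVar c k)
    (ts : Fin k → Tm S l) (σ : Fin l → Tm S n) :
    (Arg.mvar hc M ts).act Inst.id σ = .mvar hc M (fun j => (ts j).act Inst.id σ) := by
  simp only [Arg.act_id]; rfl

theorem ABdry.wk0_argTy_act {c : Cls} {k : ℕ} (D : ABdry S c k 0) (ts : Fin k → Tm S l)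
    (σ : Fin l → Tm S n) (j : Fin k) :
    ((D.wk0 l).argTy ts j).act Inst.id σ =
      (D.wk0 n).argTy (fun j => (ts j).act Inst.id σ) j := by
  rw [ABdry.argTy_act, ABdry.wk0_act, ABdry.wk0_eq_inst]

/-! ### Soundness of the relations of the algorithm

The derivability statements are closed under substitution, so that they do not depend on the
variable context. -/

/-- Normalization of `e` to `e'` at `B` is sound over `Θ`. -/
def NormSound (T : RawTT.{u, v} S) (Θ : MCtx S) {c : Cls} {k l : ℕ} (B : ABdry S c k l)
    (e e' : Arg S c k l) : Prop :=
  ∀ (hc : c.isObj = true) (n : ℕ) (Δ : Ctx S n) (σ : Fin l → Tm S n), WfCtx T Θ Δ →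
    (∀ x, (σ x).mv ⊆ MCtx.dom Θ) →
    Der T Θ Δ (.jdg ((B.act Inst.id σ).plug (e.act Inst.id σ))) →
    Der T Θ Δ (.jdg ((B.act Inst.id σ).plugEq hc (e.act Inst.id σ) (e'.act Inst.id σ)))

/-- Comparison of `e` and `e'` at `B` is sound over `Θ`. -/
def SimSound (T : RawTT.{u, v} S) (Θ : MCtx S) {c : Cls} {k l : ℕ} (B : ABdry S c k l)
    (e e' : Arg S c k l) : Prop :=
  ∀ (hc : c.isObj = true) (n : ℕ) (Δ : Ctx S n) (σ : Fin l → Tm S n), WfCtx T Θ Δ →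
    (∀ x, (σ x).mv ⊆ MCtx.dom Θ) →
    Der T Θ Δ (.jdg ((B.act Inst.id σ).plug (e.act Inst.id σ))) →
    Der T Θ Δ (.jdg ((B.act Inst.id σ).plug (e'.act Inst.id σ))) →
    Der T Θ Δ (.jdg ((B.act Inst.id σ).plugEq hc (e.act Inst.id σ) (e'.act Inst.id σ)))

/-- Comparison of `e` and `e'` at `B` is sound over `Θ` for all applications to terms. -/
def SimAppSound (T : RawTT.{u, v} S) (Θ : MCtx S) {c : Cls} {k l : ℕ} (B : ABdry S c k l)
    (e e' : Arg S c k l) : Prop :=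
  ∀ (hc : c.isObj = true) (n : ℕ) (Δ : Ctx S n) (σ : Fin l → Tm S n) (ts : Fin k → Tm S n),
    WfCtx T Θ Δ → (∀ x, (σ x).mv ⊆ MCtx.dom Θ) → (∀ j, (ts j).mv ⊆ MCtx.dom Θ) →
    Der T Θ Δ (.jdg (.base (((B.act Inst.id σ).app ts).plug ((e.act Inst.id σ).app ts)))) →
    Der T Θ Δ (.jdg (.base (((B.act Inst.id σ).app ts).plug ((e'.act Inst.id σ).app ts)))) →
    Der T Θ Δ (.jdg (.base (((B.act Inst.id σ).app ts).plugEq hc ((e.act Inst.id σ).app ts)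
      ((e'.act Inst.id σ).app ts))))

/-- Soundness of the relation named by a mode. -/
def Mode.Sound (T : RawTT.{u, v} S) (Θ : MCtx S) {c : Cls} {k l : ℕ} (B : ABdry S c k l)
    (e e' : Arg S c k l) : Mode → Prop
  | .norm => NormSound T Θ B e e'
  | .normP => NormSound T Θ B e e'
  | .normC => NormSound T Θ B e e'
  | .sim => SimAppSound T Θ B e e'
  | .simE => SimSound T Θ B e e'
  | .simN => SimSound T Θ B e e'

theorem liftSub_mv_subset {σ : Fin l → Tm S n} {D : Set AnyMVar} (hσ : ∀ x, (σ x).mv ⊆ D)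
    (x : Fin (l + 1)) : (liftSub σ x).mv ⊆ D := by
  cases x using Fin.cases with
  | zero => exact Set.empty_subset _
  | succ y => exact (Arg.mv_ren (σ y) _).subset.trans (hσ y)

/-- Applying an abstraction substitutes its first argument in the body. Soundness phrased by
applications thus passes through binders without the abstraction itself being typed; in a residue
only applied instances of the boundaries are known to be derivable. -/
theorem SimAppSound.abs {c : Cls} {k : ℕ} {A : Ty S l} {B : ABdry S c k (l + 1)}
    {e e' : Arg S c (k + 1) l} :
    SimAppSound T Θ (.abs A B) e e' ↔ SimAppSound T Θ B e.body e'.body := by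
  constructor
  · intro h hc n Δ σ ts hΔ hσ ht h1 h2
    have := h hc n Δ (fun x => σ x.succ) (Fin.cases (σ 0) ts) hΔ (fun x => hσ x.succ)
      (fun j => by cases j using Fin.cases with
        | zero => exact hσ 0
        | succ j => exact ht j)
    rw [ABdry.abs_app, Arg.succ_app, Arg.succ_app] at this
    simp only [Fin.cases_zero, Fin.cases_succ, consSub_eta] at this
    exact this h1 h2
  · intro h hc n Δ σ ts hΔ hσ ht h1 h2
    rw [ABdry.abs_app, Arg.succ_app] at h1 h2
    rw [ABdry.abs_app, Arg.succ_app, Arg.succ_app]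
    refine h hc n Δ _ _ hΔ (fun x => ?_) (fun j => ht j.succ) h1 h2
    cases x using Fin.cases with
    | zero => exact ht 0
    | succ y => exact hσ y

/-- When both sides are typed as abstractions, the body is compared in the context extended by the
bound variable, with `liftSub σ` as the substitution. -/
theorem SimAppSound.simSound {c : Cls} {k : ℕ} {B : ABdry S c k l} {e e' : Arg S c k l}
    (h : SimAppSound T Θ B e e') : SimSound T Θ B e e' := by
  intro hc n Δ σ hΔ hσ h1 h2
  induction B generalizing n with
  | base B => exact h hc n Δ σ (fun j => j.elim0) hΔ hσ (fun j => j.elim0) h1 h2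
  | abs A B ih =>
    obtain ⟨hA, h1⟩ := Der.abs_inv h1
    obtain ⟨-, h2⟩ := Der.abs_inv h2
    refine .abs hA ?_
    simp only [Inst.id_wk, Arg.body_act] at h1 h2 ⊢
    exact ih (SimAppSound.abs.1 h) hc (n + 1) _ _ (.snoc hΔ hA) (liftSub_mv_subset hσ) h1 h2

/-- Instantiations that match the conclusion of an object-invertible rule are derivable when the
comparisons of the equality entries are sound. -/
theorem RawRule.ObjInvertible.instDer_of_sound {R : RawRule S} (hR : R.ObjInvertible T)
    (hΔ : WfCtx T Θ Δ) {I : Inst S l} (hI : I.Over R.prem Θ) {σ : Fin l → Tm S n}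
    (hσ : ∀ x, (σ x).mv ⊆ MCtx.dom Θ)
    (hprem : ∀ (c : Cls) (hc : c.isObj = true) (k : ℕ) (M : MVar c.eqOf k)
      (B : ABdry S c k 0) (a a' : Arg S c k 0), ⟨c.eqOf, k, M, B.eqBdry hc a a'⟩ ∈ R.prem →
      SimAppSound T Θ (B.inst I) (a.inst I) (a'.inst I))
    (h : Der T Θ Δ (.jdg (R.concl (I.act Inst.id σ)))) :
    InstDer T Θ Δ R.prem (I.act Inst.id σ) := by
  refine hR.instDer hΔ ?_ h ?_
  · intro d hd
    refine Arg.mv_act_subset _ _ _ (fun c k M hM => ?_) hσ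
    exact (MVar.mv_gen_subset M).trans (Set.singleton_subset_iff.2 (hI d hd hM))
  · intro d hd hdc m Δ' ρ hΔ' ts ht hB e
    obtain ⟨c, hc, k, M, B, a, a', rfl⟩ := d.exists_eqBdry hdc
    have hI' : (I.act Inst.id σ).ren ρ = I.act Inst.id (fun x => (σ x).ren ρ) := by
      rw [Inst.act_ren, Inst.id_ren]
    -- The arguments come from a derivation over the residue and are known to be over `Θ` only
    -- because they are typed.
    have htm : ∀ j, (ts j).mv ⊆ MCtx.dom Θ := fun j =>
      Set.subset_union_left.trans ((ht j).mv_subset hΔ'.mv_subset)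
    have key := hprem c hc k M B a a' hd hc m Δ' (fun x => (σ x).ren ρ) ts hΔ'
      (fun x => (Arg.mv_ren _ _).subset.trans (hσ x)) htm
    have hE : (B.eqBdry hc a a').inst ((I.act Inst.id σ).ren ρ) =
        ((B.inst I).act Inst.id (fun x => (σ x).ren ρ)).eqBdry hc
          ((a.inst I).act Inst.id (fun x => (σ x).ren ρ))
          ((a'.inst I).act Inst.id (fun x => (σ x).ren ρ)) := by
      rw [hI', ABdry.inst, ABdry.eqBdry_act, ABdry.inst_act, Arg.inst_act, Arg.inst_act]; rfl
    dsimp only at hB ⊢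
    rw [hE, ABdry.eqBdry_app] at hB ⊢
    rw [Bdry.eqBdry_plug]
    obtain ⟨h1, h2⟩ := Der.eqBdry_base_inv hc hB
    exact key h1 h2

/-- Soundness of the use of a computation rule. -/
theorem IsCompRule.normSound (hT : T.Standard) {c : Cls} {R : EqRule S c} (hR : IsCompRule T R)
    {B : Bdry S c l} {I : Inst S l} (hI : I.Over R.prem Θ)
    (hprem : ∀ (c : Cls) (hc : c.isObj = true) (k : ℕ) (M : MVar c.eqOf k)
      (B : ABdry S c k 0) (a a' : Arg S c k 0), ⟨c.eqOf, k, M, B.eqBdry hc a a'⟩ ∈ R.prem →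
      SimAppSound T Θ (B.inst I) (a.inst I) (a'.inst I)) :
    NormSound T Θ (.base B) (R.lhs.inst I) (R.rhs.inst I) := by
  intro hc n Δ σ hΔ hσ h
  simp only [Arg.inst_act] at h ⊢
  have hconcl := fun hK : InstDer T Θ Δ R.prem (I.act Inst.id σ) => fun hD : R.toRaw.Derivable T =>
    Der.inst hD hK (SubTyped.nil (fun i => i.elim0))
  obtain ⟨hobj, prem, bdry, lhs, rhs⟩ := R
  cases c with
  | ty =>
    obtain ⟨hD, hF, -, hinv⟩ := hR
    cases B; cases bdry
    exact hconcl (hinv.instDer_of_sound hΔ hI hσ hprem h) hD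
  | tm =>
    obtain ⟨hD, hF, s, hs, e, hlhs, C, ⟨d, A₀, I₀, hd, hdb, hI₀, rfl⟩, -, hinv⟩ := hR
    dsimp only at hlhs
    subst hlhs
    cases B with
    | tm A =>
    cases bdry with
    | tm A' =>
    -- `I₀` records the arguments of the left-hand side as values for the premises of the rule for
    -- `s`; composed with the matching instantiation it records those of the expression being
    -- normalized.
    have hJ : ∀ i, (I₀.act (I.act Inst.id σ) (fun i => i.elim0)) (d.M i) =
        (e i).inst (I.act Inst.id σ) := fun i => by
      rw [← hI₀ i]; rfl
    have hnat : d.bdry.inst (I₀.act (I.act Inst.id σ) (fun i => i.elim0)) =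
        .tm ((A₀.inst I₀).inst (I.act Inst.id σ)) := by
      rw [hdb]
      change Bdry.tm (A₀.inst _) = _
      rw [← Arg.inst_act]; rfl
    -- Inversion equates the natural type with the type `A` at which the expression is given.
    -- Object-invertibility concerns the judgement at the natural type, so the hypothesis is
    -- converted first.
    have hb := (Der.sym_inv hT (B := .tm (A.act Inst.id σ)) h hd hJ).2
    rw [hnat] at hb
    have hb := hb _ _ rfl rfl
    have hinst := hinv.instDer_of_sound hΔ hI hσ hprem (.convTm h (.tySym hb))
    have heq : Der T Θ Δ (.jdg (.base (.eqTm ((Arg.sym s hs e).inst (I.act Inst.id σ))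
      (rhs.inst (I.act Inst.id σ)) (A'.inst (I.act Inst.id σ))))) := hconcl hinst hD
    -- The computation rule gives the equation at its own type `A'`. The same symbol application has
    -- that type by presuppositivity, so a second inversion links `A'` to `A` through the natural
    -- type.
    have hb' := (Der.sym_inv hT (B := .tm (A'.inst (I.act Inst.id σ)))
      (heq.presup_eqTm hT.1 hΔ).2.1 hd hJ).2
    rw [hnat] at hb'
    exact .convEq heq (.tyTran (.tySym (hb' _ _ rfl rfl)) hb)
  | eqTy => cases hc
  | eqTm => cases hc

/-- The common type of the terms is the matched instance of `P`, and presuppositivity makes it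
derivable; object-invertibility then provides `Ξ`. The two terms fill `s` and `t`, and the checked
equations fill `Φ`. -/
theorem ExtRule.simSound (hT : T.Standard) {R : ExtRule S} (hR : IsExtRule T R)
    {I : Inst S l} (hI : I.Over R.prem Θ)
    (hprem : ∀ (c : Cls) (hc : c.isObj = true) (k : ℕ) (M : MVar c.eqOf k)
      (B : ABdry S c k 0) (a a' : Arg S c k 0), ⟨c.eqOf, k, M, B.eqBdry hc a a'⟩ ∈ R.prem →
      SimAppSound T Θ (B.inst I) (a.inst I) (a'.inst I))
    (hpost : ∀ (c : Cls) (hc : c.isObj = true) (k : ℕ) (M : MVar c.eqOf k)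
      (B : ABdry S c k 0) (a a' : Arg S c k 0), ⟨c.eqOf, k, M, B.eqBdry hc a a'⟩ ∈ R.post →
      SimAppSound T Θ (B.inst I) (a.inst I) (a'.inst I)) :
    SimSound T Θ (.base (.tm (R.ty.inst I))) (I R.s) (I R.t) := by
  intro hc n Δ σ hΔ hσ h1 h2
  obtain ⟨hD, hF, hobj, -, hinv⟩ := hR
  have hA : Der T Θ Δ (.jdg (.base (.isTy (R.ty.inst (I.act Inst.id σ))))) := by
    rw [← Arg.inst_act]; exact h1.presup_hasTy hT.1 hΔ
  have hK := hinv.instDer_of_sound hΔ hI hσ hprem hA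
  have hK' : InstDer T Θ Δ R.toRaw.prem (I.act Inst.id σ) := by
    -- Each equation of `Φ` is handled when its boundary is already derivable, so both of its sides
    -- are well typed and its check is sound.
    refine hF.1.instDer fun d hd hB => ?_
    rcases List.mem_append.1 hd with hd | hd
    · rcases List.mem_append.1 hd with hd | hd
      · exact hK d hd
      · rcases List.mem_pair.1 hd with rfl | rfl
        · change Der T Θ Δ (.jdg (.base (.hasTy _ (R.ty.inst _))))
          rw [← Arg.inst_act]; exact h1
        · change Der T Θ Δ (.jdg (.base (.hasTy _ (R.ty.inst _))))
          rw [← Arg.inst_act]; exact h2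
    · obtain ⟨c, hc, k, M, B, a, a', rfl⟩ := d.exists_eqBdry (hobj d hd)
      have key := (hpost c hc k M B a a' hd).simSound hc n Δ σ hΔ hσ
      simp only [ABdry.inst_act, Arg.inst_act] at key
      simp only [ABdry.inst, ABdry.eqBdry_act] at hB ⊢
      rw [ABdry.eqBdry_plug]
      obtain ⟨h3, h4⟩ := Der.eqBdry_inv hc hB
      exact key h3 h4
  have h3 := Der.inst hD hK' (SubTyped.nil (fun i => i.elim0))
  simp only [RawRule.jdg, ExtRule.toRaw, Bdry.plug, Stmt.act, AJdg.act, Jdg.act,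
    MVar.gen_act] at h3
  change Der T Θ Δ (.jdg (.base (.eqTm _ _ ((R.ty.inst I).act Inst.id σ))))
  rw [Arg.inst_act]
  exact h3

/-- Soundness of all relations of the algorithm. -/
theorem Alg.sound (hT : T.Standard) {C : (c : Cls) → Set (EqRule S c)}
    (hC : ∀ c, ∀ R ∈ C c, IsCompRule T R) {E : Set (ExtRule S)} (hE : ∀ R ∈ E, IsExtRule T R)
    {P : Principal S} {m : Mode} {c : Cls} {k : ℕ} {B : ABdry S c k l} {e e' : Arg S c k l}
    (h : Alg T C E P Θ m Γ B e e') : m.Sound T Θ B e e' := by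
  induction h with
  | normCRule R hR I hI hprem ih =>
    obtain ⟨hI, rfl⟩ := hI
    exact (hC _ R hR).normSound hT hI ih
  | @normPSym l Γ c B s hs d hd e e' I hI hp hn ih =>
    intro hc n Δ σ hΔ hσ h
    have hI' : ∀ i, I.act Inst.id σ (d.M i) = (e i).act Inst.id σ := fun i => by
      rw [← hI i]; rfl
    obtain ⟨h1, h2⟩ := Der.sym_inv hT h hd hI'
    have hwf : WfMCtx T (d.toRaw hs).prem := by
      obtain ⟨r, hr⟩ := hd; exact hr ▸ (hT.1 r).1
    -- `J` fills the premises with the new arguments. Nothing is known yet about their typing; `J`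
    -- is derivable because it equals a derivable instantiation.
    obtain ⟨J, hJ⟩ := d.exists_inst hs hwf (fun i => (e' i).act Inst.id σ)
    have hIJ : InstEq T Θ Δ (d.toRaw hs).prem (I.act Inst.id σ) J := by
      refine (d.forall_prem hs).2 fun i hi => ?_
      have h3 := (d.forall_prem hs).1 h1 i
      dsimp only at h3 ⊢
      rw [hJ i]
      by_cases hip : i ∈ P.sym s
      · have h4 := ih i hip hi n Δ σ hΔ hσ
        rw [ABdry.inst_act, ← hI' i] at h4
        exact h4 h3
      · rw [← hn i hip, ← hI' i]
        exact h3.abs_plugEq_refl hi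
    have h5 := Der.sym_congr hT.1 hΔ hs hc hd h1 (hIJ.instDer hT.1 hwf hΔ h1) hIJ
    simp only [hI', hJ] at h5
    exact h5.plugEq_conv hc h2
  | @normPMVar l Γ c k B hc' M D hM ts ts' hp hn ih =>
    intro hc n Δ σ hΔ hσ h
    rw [Arg.mvar_act_id] at h
    rw [Arg.mvar_act_id, Arg.mvar_act_id]
    obtain ⟨h1, h2⟩ := Der.mvar_inv hT hΔ.mctx h hM
    have he : ArgsEq T Θ Δ (D.wk0 n) (fun j => (ts j).act Inst.id σ)
        (fun j => (ts' j).act Inst.id σ) := by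
      intro j
      by_cases hj : j ∈ P.mvar M
      · have h3 := ih j hj rfl n Δ σ hΔ hσ
        simp only [ABdry.act, Bdry.act, ABdry.wk0_argTy_act] at h3
        exact h3 (h1 j)
      · dsimp only
        rw [← hn j hj]
        exact .tmRefl (h1 j)
    have hD := hΔ.mctx.bdry_id hM Δ
    rw [← ABdry.wk0_eq_inst] at hD
    have ht := hD.argTys_of_bdry.argsTyped_of_eq h1
      (fun j => ((he j).presup_eqTm hT.1 hΔ).2.2) he
    exact (Der.mvar_congr hΔ hc hM h1 ht he).plugEq_conv hc h2
  | normStep h h' h'' ih ih' ih'' =>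
    intro hc n Δ σ hΔ hσ h
    have h1 := ih hc n Δ σ hΔ hσ h
    have h2 := ih' hc n Δ σ hΔ hσ (h1.presup_plugEq hT.1 hΔ).2
    have h3 := ih'' hc n Δ σ hΔ hσ (h2.presup_plugEq hT.1 hΔ).2
    exact h1.plugEq_trans hc (h2.plugEq_trans hc h3)
  | normStop h hno ih => exact ih
  | normAbs h ih =>
    intro hc n Δ σ hΔ hσ h
    obtain ⟨hA, h⟩ := Der.abs_inv h
    refine .abs hA ?_
    simp only [Inst.id_wk, Arg.body_act] at h ⊢
    exact ih hc (n + 1) _ _ (.snoc hΔ hA) (liftSub_mv_subset hσ) h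
  | normVar a A => intro hc n Δ σ hΔ hσ h; exact .tmRefl h
  | normDummyTy B => intro hc; cases hc
  | normDummyTm B => intro hc; cases hc
  | simTm hA h ihA ih =>
    intro hc n Δ σ ts hΔ hσ ht h1 h2
    -- Soundness for the type shows it equal to its normal form. The terms are converted to the
    -- normal form, compared there, and their equation is converted back.
    have h3 : Der _ _ _ (.jdg (.base (.eqTy _ _))) :=
      ihA rfl n Δ σ hΔ hσ (h1.presup_hasTy hT.1 hΔ)
    exact .convEq (ih rfl n Δ σ hΔ hσ (.convTm h1 h3) (.convTm h2 h3)) (.tySym h3)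
  | simTy hA hB h ihA ihB ih =>
    intro hc n Δ σ ts hΔ hσ ht h1 h2
    have h3 : Der _ _ _ (.jdg (.base (.eqTy _ _))) := ihA rfl n Δ σ hΔ hσ h1
    have h4 : Der _ _ _ (.jdg (.base (.eqTy _ _))) := ihB rfl n Δ σ hΔ hσ h2
    exact .tyTran h3 (.tyTran (ih rfl n Δ σ hΔ hσ (h3.presup_eqTy hT.1 hΔ).2
      (h4.presup_eqTy hT.1 hΔ).2) (.tySym h4))
  | simAbs h ih => exact SimAppSound.abs.2 ih
  | simExt R hR I hI hu hv hprem hpost ih ih' =>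
    obtain ⟨hI, rfl⟩ := hI
    subst hu hv
    exact ExtRule.simSound hT (hE R hR) hI ih ih'
  | simENorm hno hu hv h ihu ihv ih =>
    intro hc n Δ σ hΔ hσ h1 h2
    have h3 := ihu rfl n Δ σ hΔ hσ h1
    have h4 := ihv rfl n Δ σ hΔ hσ h2
    exact .tmTran h3 (.tmTran (ih rfl n Δ σ hΔ hσ (h3.presup_plugEq hT.1 hΔ).2
      (h4.presup_plugEq hT.1 hΔ).2) (.tmSym h4))
  | simNVar a A => intro hc n Δ σ hΔ hσ h _; exact .tmRefl h
  | @simNSym l Γ c B s hs d hd e e' I hI hp hn ih ih' =>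
    intro hc n Δ σ hΔ hσ h h'
    have hI' : ∀ i, I.act Inst.id σ (d.M i) = (e i).act Inst.id σ := fun i => by
      rw [← hI i]; rfl
    obtain ⟨h1, h2⟩ := Der.sym_inv hT h hd hI'
    have hwf : WfMCtx T (d.toRaw hs).prem := by
      obtain ⟨r, hr⟩ := hd; exact hr ▸ (hT.1 r).1
    obtain ⟨J, hJ⟩ := d.exists_inst hs hwf (fun i => (e' i).act Inst.id σ)
    have h1' := (Der.sym_inv hT h' hd hJ).1
    have hIJ : InstEq T Θ Δ (d.toRaw hs).prem (I.act Inst.id σ) J := by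
      -- Both lists of arguments are derivable by inversion, each at its own boundaries, whereas the
      -- algorithm compares at those of the left one. `InstDer.instEq_of` retypes each right
      -- argument before its comparison is used.
      refine h1.instEq_of hT.1 hwf hΔ h1' ((d.forall_prem hs).2 fun i hi hi' => ?_)
      have h3 := (d.forall_prem hs).1 h1 i
      have key : SimSound T Θ ((d.premBdry i).inst I) (e i) (e' i) := by
        by_cases hip : i ∈ P.sym s
        · exact ih i hip hi
        · exact (ih' i hip hi).simSound
      have h4 := key hi n Δ σ hΔ hσ
      rw [ABdry.inst_act, ← hI' i, ← hJ i] at h4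
      exact h4 h3 hi'
    have h5 := Der.sym_congr hT.1 hΔ hs hc hd h1 h1' hIJ
    simp only [hI', hJ] at h5
    exact h5.plugEq_conv hc h2
  | @simNMVar l Γ c k B hc' M D hM ts ts' hp hn ih ih' =>
    intro hc n Δ σ hΔ hσ h h'
    rw [Arg.mvar_act_id] at h h'
    rw [Arg.mvar_act_id, Arg.mvar_act_id]
    obtain ⟨h1, h2⟩ := Der.mvar_inv hT hΔ.mctx h hM
    have h1' := (Der.mvar_inv hT hΔ.mctx h' hM).1
    have hD := hΔ.mctx.bdry_id hM Δ
    rw [← ABdry.wk0_eq_inst] at hD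
    have he : ArgsEq T Θ Δ (D.wk0 n) (fun j => (ts j).act Inst.id σ)
        (fun j => (ts' j).act Inst.id σ) := by
      refine hD.argTys_of_bdry.argsEq_of h1 h1' fun j hj => ?_
      have key : SimSound T Θ (.base (.tm ((D.wk0 l).argTy ts j))) (ts j) (ts' j) := by
        by_cases hjp : j ∈ P.mvar M
        · exact ih j hjp
        · exact (ih' j hjp).simSound
      have h3 := key rfl n Δ σ hΔ hσ
      simp only [ABdry.act, Bdry.act, ABdry.wk0_argTy_act] at h3
      exact h3 (h1 j) hj
    exact (Der.mvar_congr hΔ hc hM h1 h1' he).plugEq_conv hc h2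
  | simNAbs h ih =>
    intro hc n Δ σ hΔ hσ h1 h2
    obtain ⟨hA, h1⟩ := Der.abs_inv h1
    obtain ⟨-, h2⟩ := Der.abs_inv h2
    refine .abs hA ?_
    simp only [Inst.id_wk, Arg.body_act] at h1 h2 ⊢
    exact ih hc (n + 1) _ _ (.snoc hΔ hA) (liftSub_mv_subset hσ) h1 h2

/-! ### Specialization to the identity substitution and the soundness theorem. -/

theorem SimSound.plugEq {c : Cls} (hc : c.isObj = true) {k : ℕ} {B : ABdry S c k n}
    {e e' : Arg S c k n} (h : SimSound T Θ B e e') (hΔ : WfCtx T Θ Δ)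
    (he : Der T Θ Δ (.jdg (B.plug e))) (he' : Der T Θ Δ (.jdg (B.plug e'))) :
    Der T Θ Δ (.jdg (B.plugEq hc e e')) := by
  have := h hc n Δ Arg.var hΔ (fun x => Set.empty_subset _)
  simp only [ABdry.act_id_var, Arg.act_id_var] at this
  exact this he he'

end

end FTT

theorem mainTheorem2 {S : FTT.Signature.{u}} (T : FTT.RawTT.{u, v} S) (hT : T.Standard)
    (C : (c : FTT.Cls) → Set (FTT.EqRule S c)) (hC : ∀ c, ∀ R ∈ C c, FTT.IsCompRule T R)
    (E : Set (FTT.ExtRule S)) (hE : ∀ R ∈ E, FTT.IsExtRule T R)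
    (P : FTT.Principal S)
    (Θ : FTT.MCtx S) (n : ℕ) (Γ : FTT.Ctx S n) (hΓ : FTT.WfCtx T Θ Γ) :
    -- general comparison
    (∀ (c : FTT.Cls) (hc : c.isObj = true) (k : ℕ) (B : FTT.ABdry S c k n)
        (e e' : FTT.Arg S c k n),
      FTT.Der T Θ Γ (.jdg (B.plug e)) → FTT.Der T Θ Γ (.jdg (B.plug e')) →
      FTT.Alg T C E P Θ .sim Γ B e e' →
      FTT.Der T Θ Γ (.jdg (B.plugEq hc e e'))) ∧
    -- type-directed comparison
    (∀ (u v : FTT.Tm S n) (A : FTT.Ty S n),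
      FTT.Der T Θ Γ (.jdg (.base (.hasTy u A))) → FTT.Der T Θ Γ (.jdg (.base (.hasTy v A))) →
      FTT.Alg T C E P Θ .simE Γ (.base (.tm A)) u v →
      FTT.Der T Θ Γ (.jdg (.base (.eqTm u v A)))) ∧
    -- comparison of normalized types
    (∀ A B : FTT.Ty S n,
      FTT.Der T Θ Γ (.jdg (.base (.isTy A))) → FTT.Der T Θ Γ (.jdg (.base (.isTy B))) →
      FTT.Alg T C E P Θ .simN Γ (.base .ty) A B →
      FTT.Der T Θ Γ (.jdg (.base (.eqTy A B)))) ∧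
    -- comparison of normalized terms
    (∀ (u v : FTT.Tm S n) (A : FTT.Ty S n),
      FTT.Der T Θ Γ (.jdg (.base (.hasTy u A))) → FTT.Der T Θ Γ (.jdg (.base (.hasTy v A))) →
      FTT.Alg T C E P Θ .simN Γ (.base (.tm A)) u v →
      FTT.Der T Θ Γ (.jdg (.base (.eqTm u v A)))) := by
  refine ⟨fun c hc k B e e' he he' h => ?_, fun u v A hu hv h => ?_, fun A B hA hB h => ?_,
    fun u v A hu hv h => ?_⟩
  · exact (FTT.Alg.sound hT hC hE h).simSound.plugEq hc hΓ he he'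
  · exact FTT.SimSound.plugEq (B := .base (.tm A)) rfl (FTT.Alg.sound hT hC hE h) hΓ hu hv
  · exact FTT.SimSound.plugEq (B := .base .ty) rfl (FTT.Alg.sound hT hC hE h) hΓ hA hB
  · exact FTT.SimSound.plugEq (B := .base (.tm A)) rfl (FTT.Alg.sound hT hC hE h) hΓ hu hv
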